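/- Let $d\ge 1$, $N\ge 0$, and let $A^0,A^1,\dots,A^d$ be Hermitian complex $N\times N$ matrices with $A^0$ positive definite, so that $P=A^0\partial_t+\sum_{j=1}^dA^j\partial_{x_j}$ is symmetric hyperbolic; $A^d$ may be singular (characteristic boundary). Write $\mathbb R^{d+1}_+=\{(t,x)\in\mathbb R\times\mathbb R^d: x_d>0\}$, $y=(x_1,\dots,x_{d-1})$, $S^d_+=\{(\tau,\eta,\gamma)\in\mathbb R\times\mathbb R^{d-1}\times\mathbb R:\tau^2+|\eta|^2+\gamma^2=1,\ \gamma>0\}$ and $G(\tau-i\gamma,\eta)=-i\big[A^0(\tau-i\gamma)+\sum_{j=1}^{d-1}A^j\eta_j\big]$. Let $E^s(\tau-i\gamma,\eta)\subset\mathbb C^N$ be the sum of the generalized eigenspaces of the matrix pair $(A^d,G)$ for the finite eigenvalues $\lambda$ ($\lambda A^dz=Gz$) with $\operatorname{Re}\lambda<0$; its dimension $\mu$ is the same for all points of $S^d_+$. Let $B$ be a complex $\mu\times N$ matrix that satisfies the uniform Kreiss–Sakamoto condition (with power $s=0$): $N(A^d)\subset N(B)$, where $N(\cdot)$ is the null space,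 and there is $c>0$ such that $|Bv|\ge c\,|A^dv|$ for all $v\in E^s(\tau-i\gamma,\eta)$ and all $(\tau,\eta,\gamma)\in S^d_+$. Then the boundary problem $Pu=f$ in $\mathbb R^{d+1}_+$, $Bu=g$ on $\{x_d=0\}$, is strongly well-posed in $L_2$: there are constants $C,\gamma_0>0$, depending only on $A^0,\dots,A^d$ and $B$, such that for all $f\in L_2(\mathbb R^{d+1}_+;\mathbb C^N)$ and $g\in L_2(\mathbb R^d;\mathbb C^\mu)$ vanishing for $t<0$ there is exactly one $u$ that is square integrable on bounded subsets of $\mathbb R^{d+1}_+$, vanishes for $t<0$ and is a weak solution, i.e. $$\int_{\mathbb R^{d+1}_+}\langle\varphi,f\rangle\,dt\,dx=-\int_{\mathbb R^{d+1}_+}\langle P\varphi,u\rangle\,dt\,dx-\int_{\mathbb R^d}\langle\psi,g\rangle\,dt\,dy$$ for all $\varphi\in C_c^\infty(\mathbb R^{d+1};\mathbb C^N)$ and $\psi\in C_c^\infty(\mathbb R^d;\mathbb C^\mu)$ with $A^d\varphi|_{x_d=0}=B^H\psi$. This $u$ has a boundary trace $A^du|_{x_d=0}\in L_{2,loc}(\mathbb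 R^d;\mathbb C^N)$, i.e. $$\int_{\mathbb R^{d+1}_+}\langle\varphi,f\rangle\,dt\,dx=-\int_{\mathbb R^{d+1}_+}\langle P\varphi,u\rangle\,dt\,dx-\int_{\mathbb R^d}\langle\varphi|_{x_d=0},A^du|_{x_d=0}\rangle\,dt\,dy$$ for all $\varphi\in C_c^\infty(\mathbb R^{d+1};\mathbb C^N)$, and for all $\gamma\ge\gamma_0$ $$\gamma\int_{\mathbb R^{d+1}_+}e^{-2\gamma t}|u|^2\,dt\,dx+\int_{\mathbb R^d}e^{-2\gamma t}|A^du(t,y,0)|^2\,dt\,dy\le C\Big(\frac1\gamma\int_{\mathbb R^{d+1}_+}e^{-2\gamma t}|f|^2\,dt\,dx+\int_{\mathbb R^d}e^{-2\gamma t}|g|^2\,dt\,dy\Big).$$ -/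

import Mathlib

namespace HyperbolicBVP

open MeasureTheory
open scoped ContDiff ComplexOrder

noncomputable section

/-- Tangential variables `z = (t, x₁, …, x_{d-1}) ∈ ℝ^d`, with `z 0 = t` the time. The same space
is used for the dual variables `σ = (τ, η₁, …, η_{d-1})`, with `σ 0 = τ`. -/
abbrev Tangential (d : ℕ) := EuclideanSpace ℝ (Fin d)

/-- Space-time points `(z, x_d)` with `z = (t, x₁, …, x_{d-1})` and `x_d ∈ ℝ`. -/
abbrev SpaceTime (d : ℕ) := Tangential d × ℝ

/-- The open half space `ℝ^{d+1}_+ = {(t, x) : x_d > 0}`. -/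
def halfSpace (d : ℕ) : Set (SpaceTime d) := {q | 0 < q.2}

/-- `|·|` is the Euclidean (Hermitian) norm of `ℂ^m`. -/
abbrev CVec (m : ℕ) := EuclideanSpace ℂ (Fin m)

/-- The action `v ↦ M v` of a complex `m × n` matrix on `ℂ^n`. -/
abbrev act {m n : ℕ} (M : Matrix (Fin m) (Fin n) ℂ) : CVec n →ₗ[ℂ] CVec m :=
  Matrix.toEuclideanLin M

/-- The operator `P = A⁰ ∂_t + ∑_{j=1}^d A^j ∂_{x_j}`, given by its coefficients `A 0, …, A d`, is
symmetric hyperbolic: all coefficients are Hermitian and `A⁰` is positive definite. -/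
structure SymmetricHyperbolic {d N : ℕ} (A : Fin (d + 1) → Matrix (Fin N) (Fin N) ℂ) : Prop where
  isHermitian : ∀ j, (A j).IsHermitian
  posDef : (A 0).PosDef

/-! ### Stable subspace and Kreiss–Sakamoto condition -/

/-- The set `S^d_+` of `(τ, η, γ)` with `τ² + |η|² + γ² = 1` and `γ > 0`; here `σ = (τ, η)`. -/
def upperSphere (d : ℕ) : Set (Tangential d × ℝ) := {s | ‖s.1‖ ^ 2 + s.2 ^ 2 = 1 ∧ 0 < s.2}

/-- `G(τ - iγ, η) = -i [A⁰ (τ - iγ) + ∑_{j=1}^{d-1} A^j η_j]`, with `σ = (τ, η)`. The index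
`j.castSucc` runs through `0, …, d - 1`. -/
def symbolG {d N : ℕ} (A : Fin (d + 1) → Matrix (Fin N) (Fin N) ℂ) (σ : Tangential d) (γ : ℝ) :
    Matrix (Fin N) (Fin N) ℂ :=
  (-Complex.I) •
    ((∑ j : Fin d, (σ j : ℂ) • A j.castSucc) - (Complex.I * (γ : ℂ)) • A 0)

/-- The stable subspace `E^s(τ - iγ, η) ⊆ ℂ^N` of the matrix pair `(A^d, G)`: the sum of the
generalized eigenspaces for the finite eigenvalues `l` (`l A^d z = G z`) with `Re l < 0`.
Since `G` is invertible for `γ > 0`, the generalized eigenspace of the pair for `l` is the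
generalized eigenspace of `G⁻¹ A^d` for `l⁻¹`. -/
def stableSubspace {d N : ℕ} (A : Fin (d + 1) → Matrix (Fin N) (Fin N) ℂ) (σ : Tangential d)
    (γ : ℝ) : Submodule ℂ (CVec N) :=
  ⨆ l : {l : ℂ // l.re < 0},
    Module.End.maxGenEigenspace (act ((symbolG A σ γ)⁻¹ * A (Fin.last d))) (l : ℂ)⁻¹

/-- The Kreiss–Sakamoto condition with power `s`: `N(A^d) ⊆ N(B)`, and there is a constant `c > 0`
with `|B v| ≥ c γ^s |A^d v|` for all `v ∈ E^s(τ - iγ, η)`, uniformly in `(τ, η, γ) ∈ S^d_+`. -/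
def KreissSakamoto {d N p : ℕ} (A : Fin (d + 1) → Matrix (Fin N) (Fin N) ℂ)
    (B : Matrix (Fin p) (Fin N) ℂ) (s : ℝ) : Prop :=
  LinearMap.ker (act (A (Fin.last d))) ≤ LinearMap.ker (act B) ∧
    ∃ c : ℝ, 0 < c ∧ ∀ (σ : Tangential d) (γ : ℝ), (σ, γ) ∈ upperSphere d →
      ∀ v ∈ stableSubspace A σ γ, c * γ ^ s * ‖act (A (Fin.last d)) v‖ ≤ ‖act B v‖

/-! ### Weak solutions -/

/-- Smooth functions with compact support. On `SpaceTime d` the support may meet `{x_d = 0}`. -/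
def IsTestFunction {E F : Type*} [NormedAddCommGroup E] [NormedSpace ℝ E] [NormedAddCommGroup F]
    [NormedSpace ℝ F] (φ : E → F) : Prop :=
  ContDiff ℝ ∞ φ ∧ HasCompactSupport φ

/-- Local square integrability with respect to `μ`. With `μ` the Lebesgue measure of the half space
this is local square integrability up to the boundary, as `K` may meet `{x_d = 0}`. -/
def MemL2loc {X F : Type*} [TopologicalSpace X] [MeasurableSpace X] [NormedAddCommGroup F]
    (v : X → F) (μ : Measure X) : Prop :=
  ∀ K : Set X, IsCompact K → MemLp v 2 (μ.restrict K)

/-- The formal adjoint `P* φ = -∑_{j=0}^d (A^j)ᴴ ∂_j φ`, where `∂_0 = ∂_t`, `∂_j = ∂_{x_j}`. -/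
def adjointOp {d N : ℕ} (A : Fin (d + 1) → Matrix (Fin N) (Fin N) ℂ) (φ : SpaceTime d → CVec N)
    (q : SpaceTime d) : CVec N :=
  -((∑ j : Fin d, act (A j.castSucc).conjTranspose
      (fderiv ℝ φ q (EuclideanSpace.single j (1 : ℝ), 0)))
    + act (A (Fin.last d)).conjTranspose (fderiv ℝ φ q (0, 1)))

/-- `u` is a weak solution of `P u = f` in `{x_d > 0}`, `B u = g` on `{x_d = 0}`. For smooth `u` and
`φ`, Green's formula reads `∫_{x_d>0} ⟨φ, P u⟩ = ∫_{x_d>0} ⟨P* φ, u⟩ - ∫_{x_d=0} ⟨(A^d)ᴴ φ, u⟩`, and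
`⟨(A^d)ᴴ φ, u⟩ = ⟨ψ, B u⟩` when `(A^d)ᴴ φ = Bᴴ ψ` on the boundary. -/
def IsWeakSolution {d N p : ℕ} (A : Fin (d + 1) → Matrix (Fin N) (Fin N) ℂ)
    (B : Matrix (Fin p) (Fin N) ℂ) (f : SpaceTime d → CVec N) (g : Tangential d → CVec p)
    (u : SpaceTime d → CVec N) : Prop :=
  ∀ (φ : SpaceTime d → CVec N) (ψ : Tangential d → CVec p),
    IsTestFunction φ → IsTestFunction ψ →
    (∀ z, act (A (Fin.last d)).conjTranspose (φ (z, 0)) = act B.conjTranspose (ψ z)) →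
    ∫ q in halfSpace d, inner ℂ (φ q) (f q) =
      (∫ q in halfSpace d, inner ℂ (adjointOp A φ q) (u q)) - ∫ z, inner ℂ (ψ z) (g z)

/-- The function `h ∈ L_{2,loc}(ℝ^d)` is the boundary trace `A^d u |_{x_d = 0}` of a function `u`
with `P u = f`: Green's formula holds with `h` in place of `A^d u |_{x_d = 0}`, for all test
functions. -/
def IsBoundaryTrace {d N : ℕ} (A : Fin (d + 1) → Matrix (Fin N) (Fin N) ℂ)
    (f u : SpaceTime d → CVec N) (h : Tangential d → CVec N) : Prop :=
  MemL2loc h volume ∧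
    ∀ φ : SpaceTime d → CVec N, IsTestFunction φ →
      ∫ q in halfSpace d, inner ℂ (φ q) (f q) =
        (∫ q in halfSpace d, inner ℂ (adjointOp A φ q) (u q)) - ∫ z, inner ℂ (φ (z, 0)) (h z)

/-! ### Strong well-posedness in `L₂` -/

/-- `∫_{x_d>0} e^{-2γt} |v(t, x)|² dt dx`, as an element of `[0, ∞]`. -/
def interiorEnergy {d m : ℕ} [NeZero d] (γ : ℝ) (v : SpaceTime d → CVec m) : ENNReal :=
  ∫⁻ q in halfSpace d, ENNReal.ofReal (Real.exp (-2 * γ * q.1 0)) * ‖v q‖ₑ ^ 2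

/-- `∫_{ℝ^d} e^{-2γt} |v(t, y)|² dt dy`, as an element of `[0, ∞]`. -/
def boundaryEnergy {d m : ℕ} [NeZero d] (γ : ℝ) (v : Tangential d → CVec m) : ENNReal :=
  ∫⁻ z, ENNReal.ofReal (Real.exp (-2 * γ * z 0)) * ‖v z‖ₑ ^ 2

/-- `v` is defined on the half space and vanishes for `t < 0` (almost everywhere). -/
def InteriorVanishes {d m : ℕ} [NeZero d] (v : SpaceTime d → CVec m) : Prop :=
  ∀ᵐ q ∂(volume.restrict (halfSpace d)), q.1 0 < 0 → v q = 0

/-- `v` is defined on the boundary and vanishes for `t < 0` (almost everywhere). -/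
def BoundaryVanishes {d m : ℕ} [NeZero d] (v : Tangential d → CVec m) : Prop :=
  ∀ᵐ z, z 0 < 0 → v z = 0

/-- `u ∈ L_{2,loc}` is a weak solution of `P u = f`, `B u = g` that vanishes for `t < 0`. -/
def IsCausalSolution {d N p : ℕ} [NeZero d] (A : Fin (d + 1) → Matrix (Fin N) (Fin N) ℂ)
    (B : Matrix (Fin p) (Fin N) ℂ) (f : SpaceTime d → CVec N) (g : Tangential d → CVec p)
    (u : SpaceTime d → CVec N) : Prop :=
  MemL2loc u (volume.restrict (halfSpace d)) ∧ InteriorVanishes u ∧ IsWeakSolution A B f g u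

/-- Strong well-posedness in `L₂` of `P u = f` in `{x_d > 0}`, `B u = g` on `{x_d = 0}`. The
constants `C`, `γ₀` do not depend on `f`, `g`, `u`, `γ`. Functions are identified when they agree
almost everywhere. -/
def StronglyWellPosed {d N p : ℕ} [NeZero d] (A : Fin (d + 1) → Matrix (Fin N) (Fin N) ℂ)
    (B : Matrix (Fin p) (Fin N) ℂ) : Prop :=
  ∃ C γ₀ : ℝ, 0 < C ∧ 0 < γ₀ ∧
    ∀ (f : SpaceTime d → CVec N) (g : Tangential d → CVec p),
      MemLp f 2 (volume.restrict (halfSpace d)) → MemLp g 2 volume →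
      InteriorVanishes f → BoundaryVanishes g →
      ∃ u : SpaceTime d → CVec N,
        IsCausalSolution A B f g u ∧
        (∀ w : SpaceTime d → CVec N, IsCausalSolution A B f g w →
          w =ᵐ[volume.restrict (halfSpace d)] u) ∧
        ∃ h : Tangential d → CVec N, IsBoundaryTrace A f u h ∧
          ∀ γ : ℝ, γ₀ ≤ γ →
            ENNReal.ofReal γ * interiorEnergy γ u + boundaryEnergy γ h ≤
              ENNReal.ofReal C *
                (ENNReal.ofReal (1 / γ) * interiorEnergy γ f + boundaryEnergy γ g)

end

end HyperbolicBVP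

/-!
Write `a_j = A^j` for the tangential coefficients (`a_0 = A⁰`) and `D = A^d`. The weight `e^{-γt}`
turns `P` into `P + γ A⁰`, and a Fourier transform in the tangential variables turns the boundary
problem into the singular ODE `D u' = G u` on the half line, with `G` the symbol of
`-(P + γ A⁰)` without its normal part. The one structural fact about `G` is dissipativity,
`Re ⟨v, G v⟩ ≤ -κγ |v|²`, which holds uniformly in the frequency. Everything follows from it and
from the Kreiss–Sakamoto bound; no symmetrizer and no matrix perturbation theory is used.

*The pencil.* Vectors of the stable subspace are initial values of decaying solutions (Jordan
chains, `stablePart_le_decayingData`), and dissipativity makes the form `⟨v, D v⟩` positive on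
initial values of decaying solutions of `D u' = G u` and negative on those of `-D u' = G' u`, for
every dissipative `G'`. Since there are no imaginary eigenvalues and no Jordan blocks at infinity
(`stablePart_sup`), a dimension count shows that the dimension of the stable subspace does not
depend on the frequency, and that the orthogonal complement of `D E^s` is exactly the
space of initial values of decaying solutions of the adjoint ODE `-D y' = G* y`, up to `ker D`
(`exists_decaying_of_orthogonal`).

*The half-line estimate.* Pairing a solution of `D χ' - G χ = F` with a decaying adjoint solution
controls the component of `D χ(0)` orthogonal to `D E^s` by `F` (`norm_inner_decaying_le`). The
component in `D E^s` is controlled by the Kreiss–Sakamoto bound, and `χ` itself by the energy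
identity. This gives an estimate with constants that are uniform in the frequency
(`halfLine_estimate`) for the boundary operator `B`. The adjoint problem has the same form: its
decaying adjoint solutions are the decaying solutions of the original ODE, and its boundary
operator is the projection onto `Z = D (ker B)`. It uses that `B` maps `E^s` onto `ℂ^μ`, which is
where the number of rows of `B` enters. Plancherel turns both estimates into weighted a priori
estimates for test functions (`HalfLineEstimate.energy_estimate`).

*Uniqueness.* A compactly supported weak solution is a limit of smooth functions: convolution with
a kernel supported in `{x_d < 0}` commutes with `P` up to the boundary, also for characteristic
boundaries, and the boundary values of the mollification vanish in the limit because a boundary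
layer of the test function reproduces them (`IsWeakSolutionOn.exists_approx`). So the a priori
estimate holds for weak solutions. Applied to `χ e^{-ψ} w` with `∇ψ` close to `γ dt`, it
gives `IsWeakSolutionOn.weighted_estimate`. The choice `ψ = γ (t + δ √(1 + |z|² + x_d²))`, whose
sublevel sets are compact in `{t ≥ 0}`, yields uniqueness of causal solutions without a condition at
infinity as `γ → ∞`. A weight `ψ` above both `γ t` and `γ' t` shows that square integrable
solutions for the nearby weights `γ` and `γ'` coincide.

*Existence.* For each `γ > 0`, the adjoint estimate and the Riesz theorem give a solution with its
trace and the bound for this `γ` (`exists_weighted_solution`). These solutions agree for all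
`γ ≥ 1`, so one function satisfies the bound for all `γ`, and letting `γ → ∞` shows that it
vanishes for `t < 0`.
-/

namespace HyperbolicBVP

open MeasureTheory Filter Topology
open scoped ContDiff ComplexOrder FourierTransform

noncomputable section

/-! ### Stable subspaces and decaying solutions of a dissipative pencil -/

section Pencil

variable {E : Type*} [NormedAddCommGroup E] [InnerProductSpace ℂ E]

/-- The sum of the generalized eigenspaces of `M` for the eigenvalues in the open left half plane.
For `M = G⁻¹ D` this is the stable subspace of the pair `(D, G)`: inversion `μ ↦ μ⁻¹` preserves the
half plane, and the eigenvalue `0` of `M`, which is the infinite eigenvalue of the pair, is left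
out. -/
def stablePart (M : Module.End ℂ E) : Submodule ℂ E :=
  ⨆ μ : {μ : ℂ // μ.re < 0}, Module.End.maxGenEigenspace M (μ : ℂ)

/-- A `C¹` solution of `D u' = G u` that tends to zero at `+∞`. The equation is required on the
whole line, which costs nothing: the solutions of interest are exponential polynomials. -/
def IsDecayingSolution (D G : E →L[ℂ] E) (u : ℝ → E) : Prop :=
  ContDiff ℝ 1 u ∧ (∀ x, D (deriv u x) = G (u x)) ∧ Tendsto u atTop (𝓝 0)

theorem exists_apply_eq_of_genEigen (M : Module.End ℂ E) {μ : ℂ} (hμ : μ ≠ 0) (k : ℕ) :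
    ∀ v : E, ((M - μ • 1) ^ k) v = 0 → ∃ w, ((M - μ • 1) ^ k) w = 0 ∧ M w = v := by
  induction k with
  | zero =>
    intro v hv
    have : v = 0 := by simpa using hv
    exact ⟨0, by simp, by simp [this]⟩
  | succ k ih =>
    intro v hv
    rw [pow_succ, Module.End.mul_apply] at hv
    obtain ⟨w, hw, hMw⟩ := ih _ hv
    refine ⟨μ⁻¹ • (v - w), ?_, ?_⟩
    · rw [map_smul, map_sub, pow_succ, Module.End.mul_apply, hv, ← pow_succ, pow_succ',
        Module.End.mul_apply, hw]
      simp
    · rw [map_smul, map_sub, hMw]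
      simp [smul_smul, hμ]

theorem exists_shift_of_genEigen (M : Module.End ℂ E) {μ : ℂ} (hμ : μ ≠ 0) (k : ℕ) (v : E)
    (hv : ((M - μ • 1) ^ (k + 1)) v = 0) :
    ∃ w, ((M - μ • 1) ^ k) w = 0 ∧ M (μ⁻¹ • v + w) = v := by
  have h1 : ((M - μ • 1) ^ k) (-(μ⁻¹ • (M - μ • 1) v)) = 0 := by
    rw [pow_succ, Module.End.mul_apply] at hv
    rw [map_neg, map_smul, hv]; simp
  obtain ⟨w, hw, hMw⟩ := exists_apply_eq_of_genEigen M hμ k _ h1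
  refine ⟨w, hw, ?_⟩
  rw [map_add, hMw]
  simp [smul_sub, smul_smul, hμ]

/-- A generalized eigenvector `v` of `M` for `μ ≠ 0` starts a Jordan chain `c` of the pencil: with
`l = μ⁻¹` and `M = G⁻¹ D`, the relation says `D (l c_j + c_{j+1}) = G c_j`. -/
theorem exists_chain (M : Module.End ℂ E) {μ : ℂ} (hμ : μ ≠ 0) (k : ℕ) :
    ∀ v : E, ((M - μ • 1) ^ k) v = 0 →
    ∃ c : ℕ → E, c 0 = v ∧ c k = 0 ∧ ∀ j, M (μ⁻¹ • c j + c (j + 1)) = c j := by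
  induction k with
  | zero =>
    intro v hv
    have : v = 0 := by simpa using hv
    exact ⟨fun _ => 0, this.symm, rfl, by simp⟩
  | succ k ih =>
    intro v hv
    obtain ⟨w, hw, hMw⟩ := exists_shift_of_genEigen M hμ k v hv
    obtain ⟨c, hc0, hck, hc⟩ := ih w hw
    refine ⟨fun j => Nat.casesOn j v c, rfl, hck, ?_⟩
    rintro (_ | j)
    · simpa [hc0] using hMw
    · exact hc j

theorem tendsto_pow_mul_cexp (k : ℕ) {l : ℂ} (hl : l.re < 0) :
    Tendsto (fun x : ℝ => ((x : ℂ) ^ k / (k.factorial : ℂ)) * Complex.exp (l * x)) atTop (𝓝 0) := by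
  rw [tendsto_zero_iff_norm_tendsto_zero]
  have h := (tendsto_rpow_mul_exp_neg_mul_atTop_nhds_zero k (-l.re) (by linarith)).div_const
    (k.factorial : ℝ)
  rw [zero_div] at h
  refine h.congr' ?_
  filter_upwards [eventually_ge_atTop 0] with x hx
  rw [norm_mul, Complex.norm_exp, norm_div, norm_pow, Complex.norm_real, Real.norm_of_nonneg hx,
    Complex.norm_natCast, Real.rpow_natCast]
  simp
  ring

theorem hasDerivAt_pow_mul_cexp (k : ℕ) (l : ℂ) (x : ℝ) :
    HasDerivAt (fun x : ℝ => ((x : ℂ) ^ (k + 1) / ((k + 1).factorial : ℂ)) * Complex.exp (l * x))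
      (((x : ℂ) ^ k / (k.factorial : ℂ)) * Complex.exp (l * x) +
        l * (((x : ℂ) ^ (k + 1) / ((k + 1).factorial : ℂ)) * Complex.exp (l * x))) x := by
  have h0 : HasDerivAt (fun y : ℝ => (y : ℂ)) 1 x := Complex.ofRealCLM.hasDerivAt
  have h1 := ((h0.pow (k + 1)).div_const ((k + 1).factorial : ℂ)).mul ((h0.const_mul l).cexp)
  refine h1.congr_deriv ?_
  have hk : (k.factorial : ℂ) ≠ 0 := by exact_mod_cast k.factorial_ne_zero
  have hk' : ((k : ℂ) + 1) ≠ 0 := by exact_mod_cast k.succ_ne_zero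
  simp only [Nat.factorial_succ, Nat.add_sub_cancel]
  push_cast
  field_simp
  simp only [Pi.pow_apply]

/-- A Jordan chain of the pencil for `l` yields the solution `∑ x^j / j! e^{l x} c_j`. -/
theorem exists_decaying_of_chain (D G : E →L[ℂ] E) {l : ℂ} (hl : l.re < 0) (k : ℕ) (c : ℕ → E)
    (hck : c k = 0) (hc : ∀ j, D (l • c j + c (j + 1)) = G (c j)) :
    ∃ u, IsDecayingSolution D G u ∧ u 0 = c 0 := by
  set a : ℕ → ℝ → ℂ := fun j x => ((x : ℂ) ^ j / (j.factorial : ℂ)) * Complex.exp (l * x) with ha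
  have ha' : ∀ j x, HasDerivAt (a (j + 1)) (a j x + l * a (j + 1) x) x := fun j x =>
    hasDerivAt_pow_mul_cexp j l x
  have ha0 : ∀ x, HasDerivAt (a 0) (l * a 0 x) x := by
    intro x
    have h0 : HasDerivAt (fun y : ℝ => (y : ℂ)) 1 x := Complex.ofRealCLM.hasDerivAt
    have := (h0.const_mul l).cexp
    simp only [ha, pow_zero, Nat.factorial_zero, Nat.cast_one, div_one, one_mul]
    refine this.congr_deriv (by ring)
  set u : ℝ → E := fun x => ∑ j ∈ Finset.range (k + 1), a j x • c j with hu
  set u' : ℝ → E := fun x => ∑ j ∈ Finset.range k, a j x • c (j + 1) +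
    ∑ j ∈ Finset.range (k + 1), (l * a j x) • c j with hu'
  have hder : ∀ x, HasDerivAt u (u' x) x := by
    intro x
    have h1 : HasDerivAt u (∑ j ∈ Finset.range k, ((a j x + l * a (j + 1) x) • c (j + 1)) +
        (l * a 0 x) • c 0) x := by
      have : u = fun x => ∑ j ∈ Finset.range k, a (j + 1) x • c (j + 1) + a 0 x • c 0 := by
        funext x; rw [hu]; exact Finset.sum_range_succ' _ _
      rw [this]
      exact (HasDerivAt.fun_sum fun j _ => (ha' j x).smul_const _).add ((ha0 x).smul_const _)
    refine h1.congr_deriv ?_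
    simp only [hu', add_smul, Finset.sum_add_distrib]
    rw [Finset.sum_range_succ' (fun j => (l * a j x) • c j), add_assoc]
  have hcont : ∀ j, Continuous (a j) := by
    intro j; simp only [ha]; fun_prop
  have hderiv : deriv u = u' := funext fun x => (hder x).deriv
  refine ⟨u, ⟨?_, ?_, ?_⟩, ?_⟩
  · rw [contDiff_one_iff_deriv]
    refine ⟨fun x => (hder x).differentiableAt, ?_⟩
    rw [hderiv, hu']
    fun_prop
  · intro x
    rw [hderiv]
    simp only [hu', hu]
    rw [Finset.sum_range_succ, Finset.sum_range_succ, hck, smul_zero, add_zero, smul_zero, add_zero,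
      ← Finset.sum_add_distrib, map_sum, map_sum]
    refine Finset.sum_congr rfl fun j _ => ?_
    rw [map_smul G, ← hc j, ← map_smul, smul_add, smul_smul, mul_comm l, add_comm]
  · have : Tendsto u atTop (𝓝 (∑ j ∈ Finset.range (k + 1), (0 : ℂ) • c j)) :=
      tendsto_finsetSum _ fun j _ => (tendsto_pow_mul_cexp j hl).smul_const _
    simpa using this
  · simp only [hu]
    rw [Finset.sum_range_succ']
    simp [ha]

/-- The space of initial values `u 0` of decaying solutions of `D u' = G u`. -/
def decayingData (D G : E →L[ℂ] E) : Submodule ℂ E where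
  carrier := {v | ∃ u, IsDecayingSolution D G u ∧ u 0 = v}
  zero_mem' := ⟨0, ⟨contDiff_const, by intro x; simp [Pi.zero_def], tendsto_const_nhds⟩, rfl⟩
  add_mem' := by
    rintro _ _ ⟨u, ⟨h1, h2, h3⟩, rfl⟩ ⟨v, ⟨h4, h5, h6⟩, rfl⟩
    refine ⟨u + v, ⟨h1.add h4, ?_, ?_⟩, rfl⟩
    · intro x
      rw [deriv_add (h1.differentiable one_ne_zero x) (h4.differentiable one_ne_zero x), map_add,
        h2,
        h5, Pi.add_apply, map_add]
    · have := h3.add h6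
      rwa [add_zero] at this
  smul_mem' := by
    rintro c _ ⟨u, ⟨h1, h2, h3⟩, rfl⟩
    refine ⟨c • u, ⟨h1.const_smul c, ?_, ?_⟩, rfl⟩
    · intro x
      rw [deriv_const_smul _ (h1.differentiable one_ne_zero x), map_smul, h2, Pi.smul_apply,
        map_smul]
    · have := h3.const_smul c
      rwa [smul_zero] at this

theorem stablePart_le_decayingData (D G : E →L[ℂ] E) (M : Module.End ℂ E)
    (hM : ∀ x, G (M x) = D x) : stablePart M ≤ decayingData D G := by
  refine iSup_le fun ⟨μ, hμ⟩ v hv => ?_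
  have hμ0 : μ ≠ 0 := by rintro rfl; simp at hμ
  obtain ⟨k, hk⟩ := (Module.End.mem_maxGenEigenspace _ _ _).1 hv
  obtain ⟨c, hc0, hck, hc⟩ := exists_chain M hμ0 k v hk
  have hl : (μ⁻¹).re < 0 := by
    rw [Complex.inv_re]
    exact div_neg_of_neg_of_pos hμ (Complex.normSq_pos.2 hμ0)
  obtain ⟨u, hu, hu0⟩ := exists_decaying_of_chain D G hl k c hck
    (fun j => by rw [← hM, hc])
  exact ⟨u, hu, hu0.trans hc0⟩

/-- The energy identity `(⟨u, D u⟩)' = 2 Re ⟨u, G u⟩`, integrated over `[0, Y]` with `Y → ∞`. -/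
theorem IsDecayingSolution.energy {D G : E →L[ℂ] E} {κ : ℝ}
    (hD : ∀ x y, inner ℂ (D x) y = inner ℂ x (D y))
    (hG : ∀ v, (inner ℂ v (G v)).re ≤ -κ * ‖v‖ ^ 2) {u : ℝ → E}
    (hu : IsDecayingSolution D G u) {X : ℝ} (hX : 0 ≤ X) (hκ : 0 ≤ κ) :
    2 * κ * ∫ x in (0 : ℝ)..X, ‖u x‖ ^ 2 ≤ (inner ℂ (u 0) (D (u 0))).re := by
  obtain ⟨h1, h2, h3⟩ := hu
  have hd : ∀ x, HasDerivAt u (deriv u x) x := fun x =>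
    (h1.differentiable one_ne_zero x).hasDerivAt
  have hc : Continuous (deriv u) := h1.continuous_deriv_one
  set e : ℝ → ℝ := fun x => (inner ℂ (u x) (D (u x))).re with he
  have hDd : ∀ x, HasDerivAt (fun x => D (u x)) (D (deriv u x)) x := fun x =>
    (D.restrictScalars ℝ).hasFDerivAt.comp_hasDerivAt x (hd x)
  have hed : ∀ x, HasDerivAt e (2 * (inner ℂ (u x) (G (u x))).re) x := by
    intro x
    have := ((hd x).inner ℂ (hDd x))
    have h4 := Complex.reCLM.hasFDerivAt.comp_hasDerivAt x this
    refine h4.congr_deriv ?_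
    simp only [Complex.reCLM_apply, Complex.add_re]
    rw [← hD (deriv u x) (u x), h2, ← inner_conj_symm (G (u x)) (u x), Complex.conj_re]
    ring
  have hcont : Continuous fun x => (inner ℂ (u x) (G (u x))).re :=
    Complex.continuous_re.comp (h1.continuous.inner (G.continuous.comp h1.continuous))
  have hcn : Continuous fun x => ‖u x‖ ^ 2 := h1.continuous.norm.pow 2
  have key : ∀ Y, 0 ≤ Y → 2 * κ * ∫ x in (0 : ℝ)..Y, ‖u x‖ ^ 2 ≤ e 0 - e Y := by
    intro Y hY
    have := intervalIntegral.integral_eq_sub_of_hasDerivAt (a := 0) (b := Y) (fun x _ => hed x)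
      ((hcont.const_mul 2).intervalIntegrable _ _)
    rw [← neg_sub, ← this, ← intervalIntegral.integral_neg, ← intervalIntegral.integral_const_mul]
    refine intervalIntegral.integral_mono_on hY ((hcn.const_mul _).intervalIntegrable _ _)
      ((hcont.const_mul 2).neg.intervalIntegrable _ _) fun x _ => ?_
    have := hG (u x)
    linarith
  have hlim : Tendsto (fun Y => e 0 - e Y) atTop (𝓝 (e 0 - 0)) := by
    refine tendsto_const_nhds.sub ?_
    have : Tendsto (fun x => inner ℂ (u x) (D (u x))) atTop (𝓝 (inner ℂ (0 : E) (D 0))) :=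
      h3.inner ((D.continuous.tendsto 0).comp h3)
    rw [inner_zero_left] at this
    exact (Complex.continuous_re.tendsto _).comp this
  rw [sub_zero] at hlim
  refine ge_of_tendsto hlim ?_
  filter_upwards [eventually_ge_atTop X] with Y hY
  refine le_trans ?_ (key Y (hX.trans hY))
  refine mul_le_mul_of_nonneg_left ?_ (by positivity)
  exact intervalIntegral.integral_mono_interval le_rfl hX hY
    (Eventually.of_forall fun x => by positivity) (hcn.intervalIntegrable _ _)

theorem decayingData_pos {D G : E →L[ℂ] E} {κ : ℝ}
    (hD : ∀ x y, inner ℂ (D x) y = inner ℂ x (D y)) (hκ : 0 < κ)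
    (hG : ∀ v, (inner ℂ v (G v)).re ≤ -κ * ‖v‖ ^ 2) {v : E} (hv : v ∈ decayingData D G)
    (h : (inner ℂ v (D v)).re ≤ 0) : v = 0 := by
  obtain ⟨u, hu, rfl⟩ := hv
  by_contra hne
  have h1 := hu.energy hD hG zero_le_one hκ.le
  have h2 : 0 < ∫ x in (0 : ℝ)..1, ‖u x‖ ^ 2 := by
    refine intervalIntegral.integral_pos zero_lt_one (hu.1.continuous.norm.pow 2).continuousOn
      (fun x _ => by positivity) ⟨0, by simp, by positivity⟩
  have : 0 < 2 * κ * ∫ x in (0 : ℝ)..1, ‖u x‖ ^ 2 := by positivity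
  linarith

/-- The pairing `⟨w, D u⟩` of a decaying solution with a decaying solution of the adjoint equation
`-D w' = G' w` is constant in `x`, hence zero. -/
theorem inner_decayingData_adjoint {D G G' : E →L[ℂ] E}
    (hD : ∀ x y, inner ℂ (D x) y = inner ℂ x (D y))
    (hG' : ∀ x y, inner ℂ (G' x) y = inner ℂ x (G y)) {v y : E} (hv : v ∈ decayingData D G)
    (hy : y ∈ decayingData (-D) G') : inner ℂ y (D v) = 0 := by
  obtain ⟨u, ⟨h1, h2, h3⟩, rfl⟩ := hv
  obtain ⟨w, ⟨h4, h5, h6⟩, rfl⟩ := hy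
  have hDd : ∀ x, HasDerivAt (fun x => D (u x)) (D (deriv u x)) x := fun x =>
    (D.restrictScalars ℝ).hasFDerivAt.comp_hasDerivAt x
      (h1.differentiable one_ne_zero x).hasDerivAt
  have hd : ∀ x, HasDerivAt (fun x => inner ℂ (w x) (D (u x))) 0 x := by
    intro x
    have := (h4.differentiable one_ne_zero x).hasDerivAt.inner ℂ (hDd x)
    refine this.congr_deriv ?_
    have h := h5 x
    rw [neg_apply, neg_eq_iff_eq_neg] at h
    rw [h2, ← hD, h, inner_neg_left, hG', add_neg_cancel]
  have hconst : ∀ x, inner ℂ (w x) (D (u x)) = inner ℂ (w 0) (D (u 0)) := fun x =>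
    is_const_of_deriv_eq_zero (fun x => (hd x).differentiableAt) (fun x => (hd x).deriv) x 0
  have : Tendsto (fun x => inner ℂ (w x) (D (u x))) atTop (𝓝 (inner ℂ (0 : E) (D 0))) :=
      h6.inner ((D.continuous.tendsto 0).comp h3)
  simp only [hconst, inner_zero_left] at this
  exact tendsto_const_nhds_iff.1 this

theorem maxGenEigenspace_eq_bot {M : Module.End ℂ E} {μ : ℂ}
    (h : ∀ x, M x = μ • x → x = 0) : Module.End.maxGenEigenspace M μ = ⊥ := by
  refine (Submodule.eq_bot_iff _).2 fun v hv => ?_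
  obtain ⟨k, hk⟩ := (Module.End.mem_maxGenEigenspace _ _ _).1 hv
  induction k with
  | zero => simpa using hk
  | succ k ih =>
    refine ih (h _ ?_)
    rw [pow_succ', Module.End.mul_apply] at hk
    simpa [sub_eq_zero] using hk

/-- If the eigenvalue zero has no Jordan block of size two, then its generalized eigenspace is the
kernel. -/
theorem maxGenEigenspace_zero_le {M : Module.End ℂ E}
    (h : ∀ x, M (M x) = 0 → M x = 0) :
    Module.End.maxGenEigenspace M 0 ≤ LinearMap.ker M := by
  intro v hv
  obtain ⟨k, hk⟩ := (Module.End.mem_maxGenEigenspace _ _ _).1 hv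
  simp only [zero_smul, sub_zero] at hk
  induction k with
  | zero => simp_all
  | succ k ih =>
    rcases k with _ | k
    · simpa using hk
    · refine ih ?_
      rw [pow_succ', Module.End.mul_apply, pow_succ', Module.End.mul_apply] at hk
      rw [pow_succ', Module.End.mul_apply]
      exact h _ hk

/-- The stable and the antistable part of `M = G⁻¹ D` and the kernel of `D` span the whole space.
Since `⟨x, D x⟩` is real, dissipativity of `G` excludes nonzero imaginary eigenvalues, and also
Jordan blocks at the eigenvalue zero. -/
theorem stablePart_sup {D G : E →L[ℂ] E} {κ : ℝ} [FiniteDimensional ℂ E]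
    (hD : ∀ x y, inner ℂ (D x) y = inner ℂ x (D y)) (hκ : 0 < κ)
    (hG : ∀ v, (inner ℂ v (G v)).re ≤ -κ * ‖v‖ ^ 2) (M : Module.End ℂ E)
    (hM : ∀ x, G (M x) = D x) :
    stablePart M ⊔ (stablePart (-M) ⊔ LinearMap.ker (D : E →ₗ[ℂ] E)) = ⊤ := by
  have hG0 : ∀ v, (inner ℂ v (G v)).re = 0 → v = 0 := by
    intro v hv
    have := hG v
    have h2 : ‖v‖ ^ 2 ≤ 0 := by rw [hv] at this; nlinarith
    simpa using le_antisymm h2 (by positivity)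
  have hker : ∀ x, M x = 0 ↔ D x = 0 := by
    intro x
    rw [← hM]
    refine ⟨fun h => by rw [h, map_zero], fun h => hG0 _ (by rw [h]; simp)⟩
  rw [eq_top_iff, ← Module.End.iSup_maxGenEigenspace_eq_top M]
  refine iSup_le fun μ => ?_
  rcases lt_trichotomy μ.re 0 with h | h | h
  · exact le_trans (le_iSup (fun μ : {μ : ℂ // μ.re < 0} =>
      Module.End.maxGenEigenspace M (μ : ℂ)) ⟨μ, h⟩) le_sup_left
  · by_cases h0 : μ = 0
    · subst h0
      refine le_trans (maxGenEigenspace_zero_le ?_) (le_trans ?_ (le_sup_right.trans le_sup_right))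
      · intro x hx
        apply hG0
        rw [hM, ← hD, (hker _).1 hx]; simp
      · intro x hx
        exact (hker x).1 hx
    · rw [maxGenEigenspace_eq_bot]
      · exact bot_le
      · intro x hx
        apply hG0
        have h1 : D x = μ • G x := by rw [← hM, hx, map_smul]
        have h2 : (inner ℂ x (D x)).im = 0 := by
          have := hD x x
          rw [← inner_conj_symm] at this
          exact Complex.conj_eq_iff_im.1 this
        rw [h1, inner_smul_right, Complex.mul_im, h, zero_mul, zero_add] at h2
        rcases mul_eq_zero.1 h2 with h3 | h3
        · exact absurd (Complex.ext h h3) h0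
        · exact h3
  · refine le_trans ?_ (le_sup_left.trans le_sup_right)
    have : Module.End.maxGenEigenspace M μ ≤ Module.End.maxGenEigenspace (-M) (-μ) := by
      intro v hv
      rw [Module.End.mem_maxGenEigenspace] at hv ⊢
      obtain ⟨k, hk⟩ := hv
      refine ⟨k, ?_⟩
      have h5 : -M - (-μ) • (1 : Module.End ℂ E) = -(M - μ • 1) := by rw [neg_smul]; abel
      rw [h5, neg_pow]
      simp [hk]
    exact this.trans (le_iSup (fun μ : {μ : ℂ // μ.re < 0} =>
      Module.End.maxGenEigenspace (-M) (μ : ℂ)) ⟨-μ, by simpa using h⟩)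

/-- The form `⟨v, D v⟩` is positive on the decaying data of `(D, G)`, and at most zero on those of
`(-D, G')`; adding elements of `ker D` does not change the form. The operators `G` and `G'` need not
be related. -/
theorem disjoint_decayingData {D G G' : E →L[ℂ] E} {κ κ' : ℝ}
    (hD : ∀ x y, inner ℂ (D x) y = inner ℂ x (D y)) (hκ : 0 < κ)
    (hG : ∀ v, (inner ℂ v (G v)).re ≤ -κ * ‖v‖ ^ 2) (hκ' : 0 < κ')
    (hG' : ∀ v, (inner ℂ v (G' v)).re ≤ -κ' * ‖v‖ ^ 2) :
    Disjoint (decayingData D G) (decayingData (-D) G' ⊔ LinearMap.ker (D : E →ₗ[ℂ] E)) := by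
  rw [Submodule.disjoint_def]
  intro v hv hv'
  refine decayingData_pos hD hκ hG hv ?_
  obtain ⟨w, hw, k, hk, rfl⟩ := Submodule.mem_sup.1 hv'
  have hk' : D k = 0 := hk
  obtain ⟨u, hu, rfl⟩ := hw
  have := hu.energy (D := -D) (fun x y => by simp [hD]) hG' le_rfl hκ'.le
  rw [map_add, hk', add_zero, inner_add_left, ← hD k, hk', inner_zero_left, add_zero]
  simpa using this

theorem disjoint_decayingData_ker {D G : E →L[ℂ] E} {κ : ℝ}
    (hD : ∀ x y, inner ℂ (D x) y = inner ℂ x (D y)) (hκ : 0 < κ)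
    (hG : ∀ v, (inner ℂ v (G v)).re ≤ -κ * ‖v‖ ^ 2) :
    Disjoint (decayingData D G) (LinearMap.ker (D : E →ₗ[ℂ] E)) := by
  rw [Submodule.disjoint_def]
  intro v hv hv'
  refine decayingData_pos hD hκ hG hv ?_
  have : D v = 0 := hv'
  simp [this]

/-- The dimension of the stable part is the same for all dissipative `G` with given `D` (the
opposite inequality is the same statement with `G` and `G'` exchanged). No continuity in the
parameters is needed. -/
theorem finrank_stablePart_le {D G G' : E →L[ℂ] E} {κ κ' : ℝ} [FiniteDimensional ℂ E]
    (hD : ∀ x y, inner ℂ (D x) y = inner ℂ x (D y)) (hκ : 0 < κ)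
    (hG : ∀ v, (inner ℂ v (G v)).re ≤ -κ * ‖v‖ ^ 2) (hκ' : 0 < κ')
    (hG' : ∀ v, (inner ℂ v (G' v)).re ≤ -κ' * ‖v‖ ^ 2) (M M' : Module.End ℂ E)
    (hM : ∀ x, G (M x) = D x) (hM' : ∀ x, G' (M' x) = D x) :
    Module.finrank ℂ (stablePart M) ≤ Module.finrank ℂ (stablePart M') := by
  have hM'n : ∀ x, G' ((-M') x) = (-D) x := by simp [hM']
  have hDn : ∀ x y, inner ℂ ((-D) x) y = inner ℂ x ((-D) y) := fun x y => by simp [hD]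
  have hkn : LinearMap.ker ((-D : E →L[ℂ] E) : E →ₗ[ℂ] E) = LinearMap.ker (D : E →ₗ[ℂ] E) := by
    ext; simp
  have h1 := Submodule.finrank_add_finrank_le_of_disjoint
    ((disjoint_decayingData hD hκ hG hκ' hG').mono (stablePart_le_decayingData D G M hM)
      (sup_le_sup_right (stablePart_le_decayingData (-D) G' (-M') hM'n) _))
  have h2 : Module.finrank ℂ (stablePart (-M') ⊔ LinearMap.ker (D : E →ₗ[ℂ] E) : Submodule ℂ E) =
      Module.finrank ℂ (stablePart (-M')) + Module.finrank ℂ (LinearMap.ker (D : E →ₗ[ℂ] E)) := by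
    have h := Submodule.finrank_sup_add_finrank_inf_eq (stablePart (-M'))
      (LinearMap.ker (D : E →ₗ[ℂ] E))
    have hdis := (disjoint_decayingData_ker hDn hκ' hG').mono_left
      (stablePart_le_decayingData (-D) G' (-M') hM'n)
    rw [hkn] at hdis
    rw [hdis.eq_bot, finrank_bot, add_zero] at h
    exact h
  have h3 := Submodule.finrank_add_le_finrank_add_finrank (stablePart M')
    (stablePart (-M') ⊔ LinearMap.ker (D : E →ₗ[ℂ] E))
  rw [stablePart_sup hD hκ' hG' M' hM', finrank_top] at h3
  omega

/-- The orthogonal complement of `D E^s` consists of initial values of decaying solutions of the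
adjoint equation `-D y' = G' y`, modulo `ker D`. The inclusion of these initial values is Green's
identity; equality follows by counting dimensions. -/
theorem exists_decaying_of_orthogonal {D G G' : E →L[ℂ] E} {κ : ℝ} [FiniteDimensional ℂ E]
    (hD : ∀ x y, inner ℂ (D x) y = inner ℂ x (D y)) (hκ : 0 < κ)
    (hG : ∀ v, (inner ℂ v (G v)).re ≤ -κ * ‖v‖ ^ 2)
    (hG' : ∀ x y, inner ℂ (G' x) y = inner ℂ x (G y)) (M : Module.End ℂ E)
    (hM : ∀ x, G (M x) = D x) (χ : E) (hχ : ∀ v ∈ stablePart M, inner ℂ χ (D v) = 0) :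
    ∃ y ∈ decayingData (-D) G', D y = D χ := by
  have hG'd : ∀ v, (inner ℂ v (G' v)).re ≤ -κ * ‖v‖ ^ 2 := by
    intro v
    rw [← inner_conj_symm, Complex.conj_re, hG']
    exact hG v
  have hinj : Function.Injective (G' : E →ₗ[ℂ] E) := by
    rw [injective_iff_map_eq_zero]
    intro v hv
    have h1 := hG'd v
    have hv' : G' v = 0 := hv
    rw [hv', inner_zero_right, Complex.zero_re] at h1
    have h2 : ‖v‖ ^ 2 ≤ 0 := by nlinarith
    simpa using le_antisymm h2 (by positivity)
  have hsurj : Function.Surjective (G' : E →ₗ[ℂ] E) := LinearMap.injective_iff_surjective.1 hinj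
  obtain ⟨R, hR⟩ := LinearMap.exists_rightInverse_of_surjective _ (LinearMap.range_eq_top.2 hsurj)
  set M' : Module.End ℂ E := R ∘ₗ (D : E →ₗ[ℂ] E) with hM'
  have hM'' : ∀ x, G' (M' x) = D x := fun x => by
    exact LinearMap.congr_fun hR (D x)
  have hM'n : ∀ x, G' ((-M') x) = (-D) x := by simp [hM'']
  have hDn : ∀ x y, inner ℂ ((-D) x) y = inner ℂ x ((-D) y) := fun x y => by simp [hD]
  -- The image `D S` of the stable part and its orthogonal complement.
  set S := stablePart M
  have hS : S ≤ decayingData D G := stablePart_le_decayingData D G M hM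
  have hSk : Disjoint S (LinearMap.ker (D : E →ₗ[ℂ] E)) :=
    (disjoint_decayingData_ker hD hκ hG).mono_left hS
  set W := stablePart (-M')
  have hW : W ≤ decayingData (-D) G' := stablePart_le_decayingData (-D) G' (-M') hM'n
  have hWk : Disjoint W (LinearMap.ker (D : E →ₗ[ℂ] E)) := by
    have := (disjoint_decayingData_ker hDn hκ hG'd).mono_left hW
    convert this using 1
    ext; simp
  set DS : Submodule ℂ E := S.map (D : E →ₗ[ℂ] E)
  have hle : W ⊔ LinearMap.ker (D : E →ₗ[ℂ] E) ≤ DSᗮ := by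
    refine sup_le ?_ ?_
    · intro y hy
      rw [Submodule.mem_orthogonal']
      rintro _ ⟨v, hv, rfl⟩
      exact inner_decayingData_adjoint hD hG' (hS hv) (hW hy)
    · intro k hk
      rw [Submodule.mem_orthogonal']
      rintro _ ⟨v, hv, rfl⟩
      have : D k = 0 := hk
      change inner ℂ k (D v) = 0
      rw [← hD, this, inner_zero_left]
  have hdim : Module.finrank ℂ (W ⊔ LinearMap.ker (D : E →ₗ[ℂ] E) : Submodule ℂ E) =
      Module.finrank ℂ DSᗮ := by
    have h1 : Module.finrank ℂ DS = Module.finrank ℂ S := by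
      have hi : Function.Injective ((D : E →ₗ[ℂ] E).domRestrict S) := by
        rw [injective_iff_map_eq_zero]
        intro v hv
        exact Subtype.ext (Submodule.disjoint_def.1 hSk v v.2 hv)
      have := LinearMap.finrank_range_of_inj hi
      rwa [LinearMap.range_domRestrict] at this
    have h2 := Submodule.finrank_add_finrank_orthogonal DS
    have h3 := Submodule.finrank_sup_add_finrank_inf_eq W (LinearMap.ker (D : E →ₗ[ℂ] E))
    rw [hWk.eq_bot, finrank_bot, add_zero] at h3
    have h4 := finrank_stablePart_le hD hκ hG'd hκ hG M' M hM'' hM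
    have h5 := Submodule.finrank_add_le_finrank_add_finrank (stablePart M')
      (W ⊔ LinearMap.ker (D : E →ₗ[ℂ] E))
    rw [stablePart_sup hD hκ hG'd M' hM'', finrank_top] at h5
    have h6 := Submodule.finrank_mono hle
    have h7 : Module.finrank ℂ S = Module.finrank ℂ (stablePart M) := rfl
    omega
  have heq := Submodule.eq_of_le_of_finrank_eq hle hdim
  have hχ' : χ ∈ W ⊔ LinearMap.ker (D : E →ₗ[ℂ] E) := by
    rw [heq, Submodule.mem_orthogonal']
    rintro _ ⟨v, hv, rfl⟩
    exact hχ v hv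
  obtain ⟨w, hw, k, hk, rfl⟩ := Submodule.mem_sup.1 hχ'
  have hk' : D k = 0 := hk
  exact ⟨w, hW hw, by rw [map_add, hk', add_zero]⟩

end Pencil

/-! ### The a priori estimate on the half line -/

section HalfLine

variable {E : Type*} [NormedAddCommGroup E] [InnerProductSpace ℂ E]

/-- Pairing with a decaying adjoint solution `w`, `w 0 = y`, recovers `⟨y, D χ(0)⟩` from the
residual `D χ' - G χ`. The parameter `s` weighs the energy of `w` against the residual. -/
theorem norm_inner_decaying_le {D G G' : E →L[ℂ] E} {κ s X : ℝ}
    (hD : ∀ x y, inner ℂ (D x) y = inner ℂ x (D y))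
    (hG' : ∀ x y, inner ℂ (G' x) y = inner ℂ x (G y))
    (hκ : 0 < κ) (hG'd : ∀ v, (inner ℂ v (G' v)).re ≤ -κ * ‖v‖ ^ 2)
    {y : E} (hy : y ∈ decayingData (-D) G') {χ : ℝ → E} (hχ : ContDiff ℝ 1 χ) (hX : 0 ≤ X)
    (hχX : χ X = 0) (hs : 0 < s) :
    ‖inner ℂ y (D (χ 0))‖ ≤ s / 4 * |(inner ℂ y (D y)).re| +
      (2 * s * κ)⁻¹ * ∫ x in (0 : ℝ)..X, ‖D (deriv χ x) - G (χ x)‖ ^ 2 := by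
  obtain ⟨w, hw, rfl⟩ := hy
  have hen := hw.energy (D := -D) (fun x y => by simp [hD]) hG'd hX hκ.le
  obtain ⟨h4, h5, h6⟩ := hw
  set F : ℝ → E := fun x => D (deriv χ x) - G (χ x) with hF
  have hFc : Continuous F :=
    (D.continuous.comp hχ.continuous_deriv_one).sub (G.continuous.comp hχ.continuous)
  have hDd : ∀ x, HasDerivAt (fun x => D (χ x)) (D (deriv χ x)) x := fun x =>
    (D.restrictScalars ℝ).hasFDerivAt.comp_hasDerivAt x
      (hχ.differentiable one_ne_zero x).hasDerivAt
  have hd : ∀ x, HasDerivAt (fun x => inner ℂ (w x) (D (χ x))) (inner ℂ (w x) (F x)) x := by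
    intro x
    have := (h4.differentiable one_ne_zero x).hasDerivAt.inner ℂ (hDd x)
    refine this.congr_deriv ?_
    have h := h5 x
    rw [neg_apply, neg_eq_iff_eq_neg] at h
    rw [← hD (deriv w x), h, inner_neg_left, hG', hF]
    simp only
    rw [inner_sub_right, sub_eq_add_neg]
  have hint := intervalIntegral.integral_eq_sub_of_hasDerivAt (a := 0) (b := X)
    (fun x _ => hd x) ((h4.continuous.inner hFc).intervalIntegrable _ _)
  rw [hχX, map_zero, inner_zero_right, zero_sub] at hint
  have hwn : Continuous fun x => ‖w x‖ ^ 2 := h4.continuous.norm.pow 2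
  have hFn : Continuous fun x => ‖F x‖ ^ 2 := hFc.norm.pow 2
  calc ‖inner ℂ (w 0) (D (χ 0))‖ = ‖∫ x in (0 : ℝ)..X, inner ℂ (w x) (F x)‖ := by
        rw [hint, norm_neg]
    _ ≤ ∫ x in (0 : ℝ)..X, ‖inner ℂ (w x) (F x)‖ :=
        intervalIntegral.norm_integral_le_integral_norm hX
    _ ≤ ∫ x in (0 : ℝ)..X, (s * κ / 2 * ‖w x‖ ^ 2 + (2 * s * κ)⁻¹ * ‖F x‖ ^ 2) := by
        refine intervalIntegral.integral_mono_on hX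
          ((h4.continuous.inner hFc).norm.intervalIntegrable _ _)
          (((hwn.const_mul _).add (hFn.const_mul _)).intervalIntegrable _ _) fun x _ => ?_
        refine (norm_inner_le_norm _ _).trans ?_
        have h1 : (0 : ℝ) < 2 * s * κ := by positivity
        have h2 : s * κ / 2 * ‖w x‖ ^ 2 + (2 * s * κ)⁻¹ * ‖F x‖ ^ 2 - ‖w x‖ * ‖F x‖ =
            (2 * s * κ)⁻¹ * (s * κ * ‖w x‖ - ‖F x‖) ^ 2 := by
          field_simp; ring
        have h3 : 0 ≤ (2 * s * κ)⁻¹ * (s * κ * ‖w x‖ - ‖F x‖) ^ 2 := by positivity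
        linarith
    _ = s / 4 * (2 * κ * ∫ x in (0 : ℝ)..X, ‖w x‖ ^ 2) +
          (2 * s * κ)⁻¹ * ∫ x in (0 : ℝ)..X, ‖F x‖ ^ 2 := by
        rw [intervalIntegral.integral_add ((hwn.const_mul _).intervalIntegrable _ _)
          ((hFn.const_mul _).intervalIntegrable _ _), intervalIntegral.integral_const_mul,
          intervalIntegral.integral_const_mul]
        ring
    _ ≤ _ := by
        gcongr
        refine hen.trans ((le_abs_self _).trans ?_)
        simp

/-- The energy identity for a function that vanishes at `X`; it controls the interior norm once
`D χ(0)` is known. -/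
theorem energy_halfLine {D G : E →L[ℂ] E} {κ X : ℝ}
    (hD : ∀ x y, inner ℂ (D x) y = inner ℂ x (D y))
    (hκ : 0 < κ) (hG : ∀ v, (inner ℂ v (G v)).re ≤ -κ * ‖v‖ ^ 2)
    {χ : ℝ → E} (hχ : ContDiff ℝ 1 χ) (hX : 0 ≤ X) (hχX : χ X = 0) :
    κ * ∫ x in (0 : ℝ)..X, ‖χ x‖ ^ 2 ≤ (inner ℂ (χ 0) (D (χ 0))).re +
      κ⁻¹ * ∫ x in (0 : ℝ)..X, ‖D (deriv χ x) - G (χ x)‖ ^ 2 := by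
  set F : ℝ → E := fun x => D (deriv χ x) - G (χ x) with hF
  have hFc : Continuous F :=
    (D.continuous.comp hχ.continuous_deriv_one).sub (G.continuous.comp hχ.continuous)
  have hd : ∀ x, HasDerivAt χ (deriv χ x) x := fun x =>
    (hχ.differentiable one_ne_zero x).hasDerivAt
  set e : ℝ → ℝ := fun x => (inner ℂ (χ x) (D (χ x))).re with he
  have hDd : ∀ x, HasDerivAt (fun x => D (χ x)) (D (deriv χ x)) x := fun x =>
    (D.restrictScalars ℝ).hasFDerivAt.comp_hasDerivAt x (hd x)
  have hed : ∀ x, HasDerivAt e (2 * (inner ℂ (χ x) (G (χ x) + F x)).re) x := by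
    intro x
    have h4 := Complex.reCLM.hasFDerivAt.comp_hasDerivAt x ((hd x).inner ℂ (hDd x))
    refine h4.congr_deriv ?_
    have h5 : D (deriv χ x) = G (χ x) + F x := by simp [hF]
    simp only [Complex.reCLM_apply, Complex.add_re]
    rw [← hD (deriv χ x) (χ x), h5, ← inner_conj_symm (G (χ x) + F x) (χ x), Complex.conj_re]
    ring
  have hcont : Continuous fun x => (inner ℂ (χ x) (G (χ x) + F x)).re :=
    Complex.continuous_re.comp (hχ.continuous.inner ((G.continuous.comp hχ.continuous).add hFc))
  have hwn : Continuous fun x => ‖χ x‖ ^ 2 := hχ.continuous.norm.pow 2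
  have hFn : Continuous fun x => ‖F x‖ ^ 2 := hFc.norm.pow 2
  have hint := intervalIntegral.integral_eq_sub_of_hasDerivAt (a := 0) (b := X)
    (fun x _ => hed x) ((hcont.const_mul 2).intervalIntegrable _ _)
  have heX : e X = 0 := by simp [he, hχX]
  rw [heX, zero_sub] at hint
  have h1 : e 0 + κ⁻¹ * ∫ x in (0 : ℝ)..X, ‖F x‖ ^ 2 =
      ∫ x in (0 : ℝ)..X, (κ⁻¹ * ‖F x‖ ^ 2 - 2 * (inner ℂ (χ x) (G (χ x) + F x)).re) := by
    rw [intervalIntegral.integral_sub ((hFn.const_mul _).intervalIntegrable _ _)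
      ((hcont.const_mul 2).intervalIntegrable _ _), hint, intervalIntegral.integral_const_mul]
    ring
  change _ ≤ e 0 + _
  rw [h1, ← intervalIntegral.integral_const_mul]
  refine intervalIntegral.integral_mono_on hX ((hwn.const_mul _).intervalIntegrable _ _)
    (((hFn.const_mul _).sub (hcont.const_mul 2)).intervalIntegrable _ _) fun x _ => ?_
  have h2 := hG (χ x)
  have h3 : (inner ℂ (χ x) (F x)).re ≤ ‖χ x‖ * ‖F x‖ := re_inner_le_norm (𝕜 := ℂ) _ _
  have h4 : κ * ‖χ x‖ ^ 2 + κ⁻¹ * ‖F x‖ ^ 2 - 2 * (‖χ x‖ * ‖F x‖) =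
      κ⁻¹ * (κ * ‖χ x‖ - ‖F x‖) ^ 2 := by field_simp; ring
  have h5 : 0 ≤ κ⁻¹ * (κ * ‖χ x‖ - ‖F x‖) ^ 2 := by positivity
  rw [inner_add_right, Complex.add_re]
  linarith

/-- The a priori estimate on the half line, for a boundary operator `T`. By `hT`, the boundary value
`D a` is controlled by `T a` and by the pairing with one decaying adjoint solution, chosen depending
on `a`. -/
theorem halfLine_estimate {E' : Type*} [NormedAddCommGroup E'] [NormedSpace ℂ E']
    {D G G' : E →L[ℂ] E} {T : E →L[ℂ] E'} {κ K C X : ℝ} (hK0 : 0 ≤ K) (hC0 : 0 ≤ C)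
    (hD : ∀ x y, inner ℂ (D x) y = inner ℂ x (D y))
    (hG' : ∀ x y, inner ℂ (G' x) y = inner ℂ x (G y))
    (hκ : 0 < κ) (hG : ∀ v, (inner ℂ v (G v)).re ≤ -κ * ‖v‖ ^ 2)
    (hK : ∀ a, |(inner ℂ a (D a)).re| ≤ K * ‖D a‖ ^ 2)
    (hT : ∀ a, ∃ y ∈ decayingData (-D) G', ‖D y‖ ≤ C * ‖D a‖ ∧
      ‖D a‖ ^ 2 ≤ C * (‖inner ℂ y (D a)‖ + ‖T a‖ ^ 2))
    {χ : ℝ → E} (hχ : ContDiff ℝ 1 χ) (hX : 0 ≤ X) (hχX : χ X = 0) :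
    κ * (∫ x in (0 : ℝ)..X, ‖χ x‖ ^ 2) + ‖D (χ 0)‖ ^ 2 ≤
      ((K + 1) * (C * (K * C ^ 3 + 1) + 2 * C) + 1) *
        (κ⁻¹ * (∫ x in (0 : ℝ)..X, ‖D (deriv χ x) - G (χ x)‖ ^ 2) + ‖T (χ 0)‖ ^ 2) := by
  have hG'd : ∀ v, (inner ℂ v (G' v)).re ≤ -κ * ‖v‖ ^ 2 := by
    intro v
    rw [← inner_conj_symm, Complex.conj_re, hG']
    exact hG v
  obtain ⟨y, hy, hy1, hy2⟩ := hT (χ 0)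
  have hL : 0 < K * C ^ 3 + 1 := by positivity
  -- With this `s`, the term `s / 4 * |⟨y, D y⟩|` is at most `‖D (χ 0)‖ ^ 2 / 4` and can be
  -- absorbed.
  have h1 := norm_inner_decaying_le hD hG' hκ hG'd hy hχ hX hχX (s := (K * C ^ 3 + 1)⁻¹)
    (by positivity)
  have h2 := energy_halfLine hD hκ hG hχ hX hχX
  set I := ∫ x in (0 : ℝ)..X, ‖D (deriv χ x) - G (χ x)‖ ^ 2
  have hI : 0 ≤ I := intervalIntegral.integral_nonneg hX fun x _ => by positivity
  set b := ‖D (χ 0)‖ ^ 2 with hb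
  set t := ‖T (χ 0)‖ ^ 2
  have ht : 0 ≤ t := by positivity
  have hb0 : 0 ≤ b := by positivity
  have h3 : |(inner ℂ y (D y)).re| ≤ K * (C ^ 2 * b) := by
    refine (hK y).trans (mul_le_mul_of_nonneg_left ?_ hK0)
    rw [hb, ← mul_pow]
    gcongr
  have h4 := (le_abs_self _).trans (hK (χ 0))
  have h5 : (2 * (K * C ^ 3 + 1)⁻¹ * κ)⁻¹ = (K * C ^ 3 + 1) / 2 * κ⁻¹ := by
    field_simp
  rw [h5] at h1
  have h6 : C * ((K * C ^ 3 + 1)⁻¹ / 4 * (K * (C ^ 2 * b))) ≤ b / 4 := by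
    have : C * ((K * C ^ 3 + 1)⁻¹ / 4 * (K * (C ^ 2 * b))) =
      b / 4 * ((K * C ^ 3) / (K * C ^ 3 + 1)) := by field_simp
    rw [this]
    refine mul_le_of_le_one_right (by positivity) ?_
    rw [div_le_one hL]; linarith
  have h7 : b ≤ C * (K * C ^ 3 + 1) * (κ⁻¹ * I) + 2 * C * t := by
    have h8 : C * (‖inner ℂ y (D (χ 0))‖ + t) ≤ C * ((K * C ^ 3 + 1)⁻¹ / 4 * (K * (C ^ 2 * b)) +
        (K * C ^ 3 + 1) / 2 * κ⁻¹ * I + t) := by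
      gcongr
      refine h1.trans ?_
      gcongr
    have h9 : 0 ≤ C * (K * C ^ 3 + 1) * (κ⁻¹ * I) := by positivity
    have h10 : 0 ≤ C * t := by positivity
    nlinarith
  have h11 : 0 ≤ κ⁻¹ * I := by positivity
  calc _ ≤ K * b + κ⁻¹ * I + b := by linarith
    _ = (K + 1) * b + κ⁻¹ * I := by ring
    _ ≤ (K + 1) * (C * (K * C ^ 3 + 1) * (κ⁻¹ * I) + 2 * C * t) + κ⁻¹ * I := by gcongr
    _ ≤ _ := by
      have a1 : 0 ≤ (K + 1) * (C * (K * C ^ 3 + 1)) * t := by positivity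
      have a2 : 0 ≤ (K + 1) * (2 * C) * (κ⁻¹ * I) := by positivity
      nlinarith

end HalfLine

/-! ### Choice of the adjoint solution from the Kreiss–Sakamoto bound -/

section BoundaryCondition

variable {E : Type*} [NormedAddCommGroup E] [InnerProductSpace ℂ E] [FiniteDimensional ℂ E]
  {E' : Type*} [NormedAddCommGroup E'] [NormedSpace ℂ E']

theorem exists_pseudoInverse (D : E →L[ℂ] E) : ∃ R : E →L[ℂ] E, ∀ x, D (R (D x)) = D x := by
  obtain ⟨g, hg⟩ := LinearMap.exists_rightInverse_of_surjective
    (D : E →ₗ[ℂ] E).rangeRestrict (LinearMap.range_rangeRestrict _)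
  obtain ⟨R, hR⟩ := LinearMap.exists_extend g
  refine ⟨LinearMap.toContinuousLinearMap R, fun x => ?_⟩
  have h1 := LinearMap.congr_fun hR ⟨D x, ⟨x, rfl⟩⟩
  have h2 := congrArg Subtype.val (LinearMap.congr_fun hg ⟨D x, ⟨x, rfl⟩⟩)
  simp only [LinearMap.coe_toContinuousLinearMap']
  have h3 : R (D x) = g ⟨D x, ⟨x, rfl⟩⟩ := h1
  rw [h3]
  exact h2

theorem exists_bound_of_ker_le (D : E →L[ℂ] E) (B : E →L[ℂ] E')
    (h : ∀ x, D x = 0 → B x = 0) : ∃ K, 0 ≤ K ∧ ∀ a, ‖B a‖ ≤ K * ‖D a‖ := by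
  obtain ⟨R, hR⟩ := exists_pseudoInverse D
  refine ⟨‖B.comp R‖, norm_nonneg _, fun a => ?_⟩
  have h1 : B a = B.comp R (D a) := by
    have := h (a - R (D a)) (by rw [map_sub, hR, sub_self])
    rw [map_sub, sub_eq_zero] at this
    exact this
  rw [h1]
  exact (B.comp R).le_opNorm _

/-- As `D` is symmetric, the form `⟨a, D a⟩` depends on `D a` only. -/
theorem exists_quadratic_bound (D : E →L[ℂ] E) (hD : ∀ x y, inner ℂ (D x) y = inner ℂ x (D y)) :
    ∃ K, 0 ≤ K ∧ ∀ a, |(inner ℂ a (D a)).re| ≤ K * ‖D a‖ ^ 2 := by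
  obtain ⟨R, hR⟩ := exists_pseudoInverse D
  refine ⟨‖R‖, norm_nonneg _, fun a => ?_⟩
  rw [← hR a, ← hD]
  refine (Complex.abs_re_le_norm _).trans ((norm_inner_le_norm _ _).trans ?_)
  rw [hR]
  calc _ ≤ ‖D a‖ * (‖R‖ * ‖D a‖) := by gcongr; exact R.le_opNorm _
    _ = _ := by ring

/-- The pairing for the problem with boundary operator `B`. With `χ` the component of `D a`
orthogonal to `D E^s`, the adjoint solution is chosen with `D y = D χ`, so that `⟨y, D a⟩ = |χ|²`;
the other component of `D a` is controlled by the Kreiss–Sakamoto bound. -/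
theorem exists_pairing_direct {D G G' : E →L[ℂ] E} {B : E →L[ℂ] E'} {κ c K : ℝ}
    (hD : ∀ x y, inner ℂ (D x) y = inner ℂ x (D y)) (hκ : 0 < κ)
    (hG : ∀ v, (inner ℂ v (G v)).re ≤ -κ * ‖v‖ ^ 2)
    (hG' : ∀ x y, inner ℂ (G' x) y = inner ℂ x (G y)) (M : Module.End ℂ E)
    (hM : ∀ x, G (M x) = D x) (hc : 0 < c) (hK : 0 ≤ K)
    (hB : ∀ v ∈ stablePart M, c * ‖D v‖ ≤ ‖B v‖) (hBK : ∀ a, ‖B a‖ ≤ K * ‖D a‖) (a : E) :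
    ∃ y ∈ decayingData (-D) G', ‖D y‖ ≤ ‖D‖ * ‖D a‖ ∧
      ‖D a‖ ^ 2 ≤ 2 * ((1 + K / c) ^ 2 + (1 / c) ^ 2) * (‖inner ℂ y (D a)‖ + ‖B a‖ ^ 2) := by
  set DS : Submodule ℂ E := (stablePart M).map (D : E →ₗ[ℂ] E)
  obtain ⟨v, hv, hvD⟩ : ∃ v ∈ stablePart M, D v = DS.starProjection (D a) :=
    DS.starProjection_apply_mem (D a)
  set χ := D a - DS.starProjection (D a) with hχ
  have hχo : χ ∈ DSᗮ := DS.sub_starProjection_mem_orthogonal _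
  rw [Submodule.mem_orthogonal'] at hχo
  obtain ⟨y, hy, hyD⟩ := exists_decaying_of_orthogonal hD hκ hG hG' M hM χ
    (fun v hv => hχo _ ⟨v, hv, rfl⟩)
  have hn : ‖χ‖ ≤ ‖D a‖ := by
    have := (DSᗮ).norm_starProjection_apply_le (D a)
    rwa [Submodule.starProjection_orthogonal_val] at this
  have hin : inner ℂ y (D a) = ((‖χ‖ ^ 2 : ℝ) : ℂ) := by
    rw [← hD, hyD, hD]
    have h1 : D a = χ + DS.starProjection (D a) := by rw [hχ]; abel
    rw [h1, inner_add_right, hχo _ (DS.starProjection_apply_mem _), add_zero,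
      inner_self_eq_norm_sq_to_K]
    push_cast; rfl
  refine ⟨y, hy, ?_, ?_⟩
  · rw [hyD]
    exact (D.le_opNorm _).trans (by gcongr)
  · rw [hin, Complex.norm_real, Real.norm_of_nonneg (by positivity)]
    have h1 : c * ‖D v‖ ≤ ‖B a‖ + K * ‖χ‖ := by
      refine (hB v hv).trans ?_
      have : B v = B a - B (a - v) := by rw [map_sub]; abel
      rw [this]
      refine (norm_sub_le _ _).trans ?_
      gcongr
      refine (hBK _).trans ?_
      rw [map_sub, hvD]
    have h2 : ‖D a‖ ≤ ‖χ‖ + ‖D v‖ := by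
      have : D a = χ + D v := by rw [hχ, hvD]; abel
      calc ‖D a‖ = ‖χ + D v‖ := by rw [← this]
        _ ≤ _ := norm_add_le _ _
    have h3 : ‖D a‖ ≤ (1 + K / c) * ‖χ‖ + 1 / c * ‖B a‖ := by
      have : ‖D v‖ ≤ (‖B a‖ + K * ‖χ‖) / c := by rw [le_div_iff₀ hc]; linarith
      calc _ ≤ ‖χ‖ + (‖B a‖ + K * ‖χ‖) / c := by linarith
        _ = _ := by field_simp; ring
    have hx : 0 ≤ 1 + K / c := by positivity
    have hy : 0 ≤ 1 / c := by positivity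
    calc ‖D a‖ ^ 2 ≤ ((1 + K / c) * ‖χ‖ + 1 / c * ‖B a‖) ^ 2 := by gcongr
      _ ≤ 2 * ((1 + K / c) ^ 2 * ‖χ‖ ^ 2 + (1 / c) ^ 2 * ‖B a‖ ^ 2) := by
        have := sq_nonneg ((1 + K / c) * ‖χ‖ - 1 / c * ‖B a‖)
        nlinarith
      _ ≤ _ := by
        have a1 : 0 ≤ (1 + K / c) ^ 2 * ‖B a‖ ^ 2 := by positivity
        have a2 : 0 ≤ (1 / c) ^ 2 * ‖χ‖ ^ 2 := by positivity
        nlinarith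

/-- The pairing for the adjoint problem, whose boundary operator is the projection onto
`Z = D (ker B)`. Modulo `ker D` one has `a = D b`. If `v ∈ E^s` has the same boundary value
`B v = B b`, then `D (b - v) ∈ Z`, and `⟨D b, a⟩ = ⟨v, D a⟩ + ⟨D (b - v), a⟩`. The hypothesis
`hsurj` is where `B` has to be onto on the stable subspace. -/
theorem exists_pairing_adjoint {D G : E →L[ℂ] E} {B : E →L[ℂ] E'} {c K : ℝ}
    (hD : ∀ x y, inner ℂ (D x) y = inner ℂ x (D y)) (M : Module.End ℂ E)
    (hM : ∀ x, G (M x) = D x) (hc : 0 < c) (hK : 0 ≤ K)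
    (hB : ∀ v ∈ stablePart M, c * ‖D v‖ ≤ ‖B v‖) (hBK : ∀ a, ‖B a‖ ≤ K * ‖D a‖)
    (hsurj : ∀ a, ∃ v ∈ stablePart M, B v = B a)
    (R : E →L[ℂ] E) (hR : ∀ x, D (R (D x)) = D x) (a : E) :
    ∃ y ∈ decayingData D G, ‖D y‖ ≤ K / c * ‖R‖ * ‖D a‖ ∧
      ‖D a‖ ^ 2 ≤ ‖D‖ ^ 2 * (2 + (1 + K / c) ^ 2) * (‖inner ℂ y (D a)‖ +
        ‖((LinearMap.ker (B : E →ₗ[ℂ] E')).map (D : E →ₗ[ℂ] E)).starProjection a‖ ^ 2) := by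
  set Z := (LinearMap.ker (B : E →ₗ[ℂ] E')).map (D : E →ₗ[ℂ] E)
  set Rg := LinearMap.range (D : E →ₗ[ℂ] E)
  -- The range of `D` is the orthogonal complement of its kernel.
  set r := Rg.starProjection a with hr
  obtain ⟨b, hb⟩ : ∃ b, D b = r := Rg.starProjection_apply_mem a
  have hperp : ∀ x, inner ℂ (D x) (a - r) = 0 := fun x =>
    (Submodule.mem_orthogonal _ _).1 (Rg.sub_starProjection_mem_orthogonal a) _ ⟨x, rfl⟩
  have hDr : D a = D r := by
    have : D (a - r) = 0 := by
      rw [← inner_self_eq_zero (𝕜 := ℂ), ← hD, hperp]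
    rwa [map_sub, sub_eq_zero] at this
  obtain ⟨v, hv, hvB⟩ := hsurj b
  have hDv : ‖D v‖ ≤ K / c * ‖r‖ := by
    have h1 := hB v hv
    rw [hvB] at h1
    have h2 := h1.trans (hBK b)
    rw [hb] at h2
    rw [div_mul_eq_mul_div, le_div_iff₀ hc]; linarith
  have hrn : ‖r‖ ≤ ‖R‖ * ‖D a‖ := by
    have h1 : inner ℂ r r = inner ℂ r (R (D a)) := by
      have h2 : D (r - R (D a)) = 0 := by rw [map_sub, hR, ← hDr, sub_self]
      have h3 : inner ℂ r (r - R (D a)) = 0 := by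
        have h4 := hD b (r - R (D a))
        rwa [hb, h2, inner_zero_right] at h4
      rwa [inner_sub_right, sub_eq_zero] at h3
    have h2 : ‖r‖ * ‖r‖ ≤ ‖r‖ * (‖R‖ * ‖D a‖) := by
      rw [← inner_self_eq_norm_mul_norm (𝕜 := ℂ), h1]
      refine (RCLike.re_le_norm _).trans ?_
      exact (norm_inner_le_norm _ _).trans (by gcongr; exact R.le_opNorm _)
    rcases (norm_nonneg r).eq_or_lt with h | h
    · rw [← h]; positivity
    · exact le_of_mul_le_mul_left h2 h
  refine ⟨v, stablePart_le_decayingData D G M hM hv, ?_, ?_⟩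
  · calc _ ≤ K / c * ‖r‖ := hDv
      _ ≤ K / c * (‖R‖ * ‖D a‖) := by gcongr
      _ = _ := by ring
  · have hz : D (b - v) ∈ Z := ⟨b - v, by
      rw [SetLike.mem_coe, LinearMap.mem_ker]; change B (b - v) = 0
      rw [map_sub, hvB, sub_self], rfl⟩
    have h1 : inner ℂ r r = inner ℂ v (D a) + inner ℂ (D (b - v)) (Z.starProjection a) := by
      have e1 : inner ℂ r (a - r) = 0 := by
        have h4 := hperp b
        rwa [hb] at h4
      rw [inner_sub_right, sub_eq_zero] at e1
      have e2 : inner ℂ (D (b - v)) (a - Z.starProjection a) = 0 :=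
        (Submodule.mem_orthogonal _ _).1 (Z.sub_starProjection_mem_orthogonal a) _ hz
      rw [inner_sub_right, sub_eq_zero] at e2
      rw [← e1, ← e2, map_sub, hb, inner_sub_left, hD v a]
      ring
    have h2 : ‖D (b - v)‖ ≤ (1 + K / c) * ‖r‖ := by
      rw [map_sub, hb]
      refine (norm_sub_le _ _).trans ?_
      linarith
    have h3 : ‖r‖ ^ 2 ≤ ‖inner ℂ v (D a)‖ + (1 + K / c) * ‖r‖ * ‖Z.starProjection a‖ := by
      rw [pow_two, ← inner_self_eq_norm_mul_norm (𝕜 := ℂ), h1]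
      refine ((RCLike.re_le_norm _).trans (norm_add_le _ _)).trans ?_
      gcongr
      refine (norm_inner_le_norm _ _).trans ?_
      gcongr
    have h4 : ‖r‖ ^ 2 ≤ (2 + (1 + K / c) ^ 2) * (‖inner ℂ v (D a)‖ + ‖Z.starProjection a‖ ^ 2) := by
      have a1 := sq_nonneg (‖r‖ - (1 + K / c) * ‖Z.starProjection a‖)
      have a2 : 0 ≤ (1 + K / c) ^ 2 * ‖inner ℂ v (D a)‖ := by positivity
      have a3 : 0 ≤ ‖Z.starProjection a‖ ^ 2 := by positivity
      nlinarith
    calc ‖D a‖ ^ 2 ≤ (‖D‖ * ‖r‖) ^ 2 := by rw [hDr]; gcongr; exact D.le_opNorm _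
      _ = ‖D‖ ^ 2 * ‖r‖ ^ 2 := by ring
      _ ≤ _ := by rw [mul_assoc]; gcongr

end BoundaryCondition

/-! ### The symbol in the tangential variables -/

section Symbol

variable {E : Type*} [NormedAddCommGroup E] [InnerProductSpace ℂ E]
  {E' : Type*} [NormedAddCommGroup E'] [NormedSpace ℂ E'] {d : ℕ}

/-- The symbol `∑ i σ_j a_j + γ S` of the tangential part of `∑ a_j ∂_j + γ S`. -/
def tangentialSymbol (a : Fin d → E →L[ℂ] E) (S : E →L[ℂ] E) (σ : Tangential d) (γ : ℝ) :
    E →L[ℂ] E :=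
  (∑ j, (Complex.I * (σ j : ℂ)) • a j) + (γ : ℂ) • S

/-- The a priori estimate on the half line for `D ∂_x + ∑ i σ_j a_j + γ S` with boundary operator
`T`, at all frequencies `σ` with the same constant `C`. The functions `χ` vanish at the right end
point `X` of the interval of integration, which replaces decay at infinity. -/
def HalfLineEstimate (a : Fin d → E →L[ℂ] E) (D S : E →L[ℂ] E) (T : E →L[ℂ] E') (C γ : ℝ) :
    Prop :=
  ∀ (σ : Tangential d) (χ : ℝ → E) (X : ℝ), ContDiff ℝ 1 χ → 0 ≤ X → χ X = 0 →
    γ * (∫ x in (0 : ℝ)..X, ‖χ x‖ ^ 2) + ‖D (χ 0)‖ ^ 2 ≤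
      C * (γ⁻¹ * (∫ x in (0 : ℝ)..X, ‖D (deriv χ x) + tangentialSymbol a S σ γ (χ x)‖ ^ 2) +
        ‖T (χ 0)‖ ^ 2)

theorem tangentialSymbol_dissipative {a : Fin d → E →L[ℂ] E} {S : E →L[ℂ] E} {κ : ℝ}
    (ha : ∀ j x y, inner ℂ (a j x) y = inner ℂ x (a j y))
    (hS : ∀ v, κ * ‖v‖ ^ 2 ≤ (inner ℂ v (S v)).re) (σ : Tangential d) {γ : ℝ} (hγ : 0 < γ)
    (v : E) : (inner ℂ v ((-tangentialSymbol a S σ γ) v)).re ≤ -(κ * γ) * ‖v‖ ^ 2 := by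
  have h1 : ∀ j, (inner ℂ v (a j v)).im = 0 := by
    intro j
    have := ha j v v
    rw [← inner_conj_symm] at this
    exact Complex.conj_eq_iff_im.1 this
  have h2 : (∑ j, inner ℂ v ((Complex.I * (σ j : ℂ)) • a j v)).re = 0 := by
    rw [Complex.re_sum]
    refine Finset.sum_eq_zero fun j _ => ?_
    rw [inner_smul_right, Complex.mul_re, h1]
    simp
  simp only [tangentialSymbol, neg_apply, add_apply, sum_apply, smul_apply, inner_neg_right,
    inner_add_right, inner_sum, Complex.neg_re, Complex.add_re, h2]
  rw [inner_smul_right, Complex.re_ofReal_mul, zero_add]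
  have := mul_le_mul_of_nonneg_left (hS v) hγ.le
  linarith

/-- The adjoint of the symbol: the signs of the `a_j` change, the zeroth-order term stays. -/
theorem inner_tangentialSymbol {a : Fin d → E →L[ℂ] E} {S : E →L[ℂ] E}
    (ha : ∀ j x y, inner ℂ (a j x) y = inner ℂ x (a j y))
    (hS : ∀ x y, inner ℂ (S x) y = inner ℂ x (S y)) (σ : Tangential d) (γ : ℝ) (x y : E) :
    inner ℂ (tangentialSymbol (fun j => -a j) S σ γ x) y =
      inner ℂ x (tangentialSymbol a S σ γ y) := by
  simp only [tangentialSymbol, add_apply, sum_apply, smul_apply, inner_add_left, inner_add_right,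
    sum_inner, inner_sum, inner_smul_left, inner_smul_right, neg_apply, inner_neg_left, ha, hS]
  simp

end Symbol

/-! ### The estimates for the symmetric hyperbolic system and for its adjoint -/

section Matrices

variable {d N p : ℕ}

/-- The action of a matrix as a continuous linear map. -/
def coef {m n : ℕ} (M : Matrix (Fin m) (Fin n) ℂ) : CVec n →L[ℂ] CVec m :=
  LinearMap.toContinuousLinearMap (act M)

theorem coef_apply {m n : ℕ} (M : Matrix (Fin m) (Fin n) ℂ) (v : CVec n) : coef M v = act M v := rfl

theorem inner_coef_conjTranspose {m n : ℕ} (M : Matrix (Fin m) (Fin n) ℂ) (x : CVec m)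
    (y : CVec n) : inner ℂ (coef M.conjTranspose x) y = inner ℂ x (coef M y) := by
  rw [coef_apply, coef_apply, act, Matrix.toEuclideanLin_conjTranspose_eq_adjoint,
    LinearMap.adjoint_inner_left]

theorem inner_coef_left {N : ℕ} {M : Matrix (Fin N) (Fin N) ℂ} (hM : M.IsHermitian)
    (x y : CVec N) : inner ℂ (coef M x) y = inner ℂ x (coef M y) := by
  rw [← inner_coef_conjTranspose, hM.eq]

theorem exists_posDef_bound {M : Matrix (Fin N) (Fin N) ℂ} (hM : M.PosDef) :
    ∃ κ, 0 < κ ∧ ∀ v : CVec N, κ * ‖v‖ ^ 2 ≤ (inner ℂ v (coef M v)).re := by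
  have hpos : ∀ v : CVec N, v ≠ 0 → 0 < (inner ℂ v (coef M v)).re := by
    intro v hv
    have h := hM.dotProduct_mulVec_pos (x := v.ofLp) (by simpa using hv)
    rw [EuclideanSpace.inner_eq_star_dotProduct, dotProduct_comm]
    exact (Complex.pos_iff.1 h).1
  rcases subsingleton_or_nontrivial (CVec N) with hsub | hnt
  · exact ⟨1, one_pos, fun v => by simp [Subsingleton.elim v 0]⟩
  have hcont : Continuous fun v : CVec N => (inner ℂ v (coef M v)).re :=
    Complex.continuous_re.comp (continuous_id.inner (coef M).continuous)
  obtain ⟨v₀, hv₀, hmin⟩ := (isCompact_sphere (0 : CVec N) 1).exists_isMinOn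
    (NormedSpace.sphere_nonempty.2 zero_le_one) hcont.continuousOn
  have hv₀' : v₀ ≠ 0 := by rintro rfl; simp at hv₀
  refine ⟨_, hpos v₀ hv₀', fun v => ?_⟩
  by_cases hv : v = 0
  · simp [hv]
  have hn : 0 < ‖v‖ := norm_pos_iff.2 hv
  have h1 := hmin (a := ((‖v‖⁻¹ : ℝ) : ℂ) • v) (by
    rw [mem_sphere_zero_iff_norm, norm_smul, Complex.norm_real, norm_inv, norm_norm,
      inv_mul_cancel₀ hn.ne'])
  simp only [Set.mem_ofPred_eq, map_smul, inner_smul_left, inner_smul_right, Complex.conj_ofReal,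
    Complex.re_ofReal_mul] at h1
  rw [pow_two]
  calc _ ≤ (‖v‖⁻¹ * (‖v‖⁻¹ * (inner ℂ v (coef M v)).re)) * (‖v‖ * ‖v‖) := by gcongr
    _ = _ := by field_simp

theorem coef_symbolG (A : Fin (d + 1) → Matrix (Fin N) (Fin N) ℂ) (σ : Tangential d) (γ : ℝ) :
    coef (symbolG A σ γ) =
      -tangentialSymbol (fun j => coef (A j.castSucc)) (coef (A 0)) σ γ := by
  ext1 v
  simp only [coef_apply, symbolG, tangentialSymbol, neg_apply, add_apply, sum_apply, smul_apply,
    act, map_smul, map_sub, map_sum, LinearMap.sub_apply, LinearMap.smul_apply, LinearMap.sum_apply]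
  rw [smul_sub, smul_smul, Finset.smul_sum, neg_add, ← Finset.sum_neg_distrib, sub_eq_add_neg,
    ← neg_smul]
  congr 1
  · refine Finset.sum_congr rfl fun j _ => ?_
    rw [smul_smul, ← neg_smul, neg_mul]
  · rw [← neg_smul]
    congr 1
    rw [← mul_assoc]; simp

theorem stableSubspace_eq (A : Fin (d + 1) → Matrix (Fin N) (Fin N) ℂ) (σ : Tangential d) (γ : ℝ) :
    stableSubspace A σ γ = stablePart (act ((symbolG A σ γ)⁻¹ * A (Fin.last d))) := by
  have key : ∀ l : ℂ, l.re < 0 → (l⁻¹).re < 0 := by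
    intro l hl
    have hl0 : l ≠ 0 := by rintro rfl; simp at hl
    rw [Complex.inv_re]
    exact div_neg_of_neg_of_pos hl (Complex.normSq_pos.2 hl0)
  refine le_antisymm (iSup_le fun l => ?_) (iSup_le fun l => ?_)
  · exact le_iSup (fun μ : {μ : ℂ // μ.re < 0} => Module.End.maxGenEigenspace
      (act ((symbolG A σ γ)⁻¹ * A (Fin.last d))) (μ : ℂ)) ⟨(l : ℂ)⁻¹, key _ l.2⟩
  · have := le_iSup (fun μ : {μ : ℂ // μ.re < 0} => Module.End.maxGenEigenspace
      (act ((symbolG A σ γ)⁻¹ * A (Fin.last d))) (μ : ℂ)⁻¹) ⟨(l : ℂ)⁻¹, key _ l.2⟩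
    rw [inv_inv] at this
    exact this

theorem SymmetricHyperbolic.exists_dissipative {A : Fin (d + 1) → Matrix (Fin N) (Fin N) ℂ}
    (hA : SymmetricHyperbolic A) : ∃ κ, 0 < κ ∧ ∀ (σ : Tangential d) (γ : ℝ), 0 < γ → ∀ v,
      (inner ℂ v (coef (symbolG A σ γ) v)).re ≤ -(κ * γ) * ‖v‖ ^ 2 := by
  obtain ⟨κ, hκ, h⟩ := exists_posDef_bound hA.posDef
  refine ⟨κ, hκ, fun σ γ hγ v => ?_⟩
  rw [coef_symbolG]
  exact tangentialSymbol_dissipative (fun j => inner_coef_left (hA.isHermitian _)) h σ hγ v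

theorem SymmetricHyperbolic.isUnit_det_symbolG {A : Fin (d + 1) → Matrix (Fin N) (Fin N) ℂ}
    (hA : SymmetricHyperbolic A) (σ : Tangential d) {γ : ℝ} (hγ : 0 < γ) :
    IsUnit (symbolG A σ γ).det := by
  obtain ⟨κ, hκ, h⟩ := hA.exists_dissipative
  rw [← Matrix.isUnit_iff_isUnit_det, ← Matrix.mulVec_injective_iff_isUnit]
  refine (injective_iff_map_eq_zero (symbolG A σ γ).mulVecLin).2 fun x hx => ?_
  have h1 : coef (symbolG A σ γ) (WithLp.toLp 2 x) = 0 := by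
    rw [coef_apply, act, Matrix.toLpLin_apply]
    exact congrArg (WithLp.toLp 2) hx
  have h2 := h σ γ hγ (WithLp.toLp 2 x)
  rw [h1, inner_zero_right, Complex.zero_re] at h2
  have h3 : ‖(WithLp.toLp 2 x : CVec N)‖ ^ 2 ≤ 0 := by nlinarith [mul_pos hκ hγ]
  simpa using le_antisymm h3 (by positivity)

theorem SymmetricHyperbolic.coef_symbolG_act {A : Fin (d + 1) → Matrix (Fin N) (Fin N) ℂ}
    (hA : SymmetricHyperbolic A) (σ : Tangential d) {γ : ℝ} (hγ : 0 < γ) (x : CVec N) :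
    coef (symbolG A σ γ) (act ((symbolG A σ γ)⁻¹ * A (Fin.last d)) x) =
      coef (A (Fin.last d)) x := by
  have hdet := hA.isUnit_det_symbolG σ hγ
  have hmul : ∀ X Y : Matrix (Fin N) (Fin N) ℂ, coef X (act Y x) = act (X * Y) x := by
    intro X Y
    simp [coef_apply, act, Matrix.toLpLin_apply, Matrix.mulVec_mulVec]
  rw [hmul, Matrix.mul_nonsing_inv_cancel_left _ _ hdet, coef_apply]

theorem finrank_stableSubspace {A : Fin (d + 1) → Matrix (Fin N) (Fin N) ℂ}
    (hA : SymmetricHyperbolic A) {σ σ' : Tangential d} {γ γ' : ℝ} (hγ : 0 < γ) (hγ' : 0 < γ') :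
    Module.finrank ℂ (stableSubspace A σ γ) = Module.finrank ℂ (stableSubspace A σ' γ') := by
  obtain ⟨κ, hκ, h⟩ := hA.exists_dissipative
  have hD := inner_coef_left (hA.isHermitian (Fin.last d))
  rw [stableSubspace_eq, stableSubspace_eq]
  exact le_antisymm
    (finrank_stablePart_le hD (mul_pos hκ hγ) (h σ γ hγ) (mul_pos hκ hγ') (h σ' γ' hγ') _ _
      (hA.coef_symbolG_act σ hγ) (hA.coef_symbolG_act σ' hγ'))
    (finrank_stablePart_le hD (mul_pos hκ hγ') (h σ' γ' hγ') (mul_pos hκ hγ) (h σ γ hγ) _ _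
      (hA.coef_symbolG_act σ' hγ') (hA.coef_symbolG_act σ hγ))

theorem stablePart_smul_le {E : Type*} [NormedAddCommGroup E] [InnerProductSpace ℂ E]
    (M : Module.End ℂ E) {r : ℝ} (hr : 0 < r) :
    stablePart M ≤ stablePart ((r : ℂ) • M) := by
  refine iSup_le fun ⟨μ, hμ⟩ => ?_
  have : Module.End.maxGenEigenspace M μ ≤
      Module.End.maxGenEigenspace ((r : ℂ) • M) ((r : ℂ) * μ) := by
    intro v hv
    rw [Module.End.mem_maxGenEigenspace] at hv ⊢
    obtain ⟨k, hk⟩ := hv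
    refine ⟨k, ?_⟩
    rw [mul_smul, ← smul_sub, smul_pow, LinearMap.smul_apply, hk, smul_zero]
  exact this.trans (le_iSup (fun μ : {μ : ℂ // μ.re < 0} =>
      Module.End.maxGenEigenspace ((r : ℂ) • M) (μ : ℂ)) ⟨(r : ℂ) * μ, by
        rw [Complex.re_ofReal_mul]; exact mul_neg_of_pos_of_neg hr hμ⟩)

theorem symbolG_smul (A : Fin (d + 1) → Matrix (Fin N) (Fin N) ℂ) (σ : Tangential d) (γ r : ℝ) :
    symbolG A (r • σ) (r * γ) = (r : ℂ) • symbolG A σ γ := by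
  simp only [symbolG]
  rw [smul_comm (r : ℂ) (-Complex.I), smul_sub (r : ℂ), Finset.smul_sum, smul_smul (r : ℂ)]
  congr 2; swap
  · congr 1; push_cast; ring
  · refine Finset.sum_congr rfl fun j _ => ?_
    rw [smul_smul]; simp

/-- The Kreiss–Sakamoto bound with power zero extends from the sphere to all `(σ, γ)` with `γ > 0`,
since the stable subspace is invariant under scaling. -/
theorem KreissSakamoto.exists_bound {A : Fin (d + 1) → Matrix (Fin N) (Fin N) ℂ}
    {B : Matrix (Fin p) (Fin N) ℂ} (hA : SymmetricHyperbolic A) (hB : KreissSakamoto A B 0) :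
    ∃ c, 0 < c ∧ ∀ (σ : Tangential d) (γ : ℝ), 0 < γ → ∀ v ∈ stableSubspace A σ γ,
      c * ‖coef (A (Fin.last d)) v‖ ≤ ‖coef B v‖ := by
  obtain ⟨-, c, hc, h⟩ := hB
  refine ⟨c, hc, fun σ γ hγ v hv => ?_⟩
  set r := Real.sqrt (‖σ‖ ^ 2 + γ ^ 2) with hr
  have hr0 : 0 < r := Real.sqrt_pos.2 (by positivity)
  have hr2 : r ^ 2 = ‖σ‖ ^ 2 + γ ^ 2 := Real.sq_sqrt (by positivity)
  have hmem : ((r⁻¹ • σ, r⁻¹ * γ) : Tangential d × ℝ) ∈ upperSphere d := by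
    refine ⟨?_, mul_pos (inv_pos.2 hr0) hγ⟩
    simp only [norm_smul, norm_inv, Real.norm_of_nonneg hr0.le]
    rw [mul_pow, mul_pow, ← mul_add, ← hr2]
    field_simp
  have h1 := h _ _ hmem v ?_
  · simpa [coef_apply] using h1
  · rw [stableSubspace_eq, symbolG_smul]
    rw [stableSubspace_eq] at hv
    have := stablePart_smul_le _ hr0 hv
    convert this using 2
    have hr0' : ((r⁻¹ : ℝ) : ℂ) ≠ 0 := by exact_mod_cast (inv_pos.2 hr0).ne'
    have hinv := Matrix.inv_smul' (symbolG A σ γ) (Units.mk0 _ hr0') (hA.isUnit_det_symbolG σ hγ)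
    rw [Units.smul_mk0] at hinv
    rw [hinv, act, act, ← map_smul, ← smul_mul_assoc]
    congr 2
    rw [Units.smul_def, Units.val_inv_eq_inv_val, Units.val_mk0]
    simp

/-- The dissipativity constant `κ` of `A⁰` in the weights `κγ` is moved into the constant. -/
theorem HalfLineEstimate.of_scaled {E E' : Type*} [NormedAddCommGroup E] [InnerProductSpace ℂ E]
    [NormedAddCommGroup E'] [NormedSpace ℂ E'] {a : Fin d → E →L[ℂ] E} {D S : E →L[ℂ] E}
    {T : E →L[ℂ] E'} {C κ γ : ℝ} (hκ : 0 < κ) (hγ : 0 < γ) (hC : 0 ≤ C)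
    (h : ∀ (σ : Tangential d) (χ : ℝ → E) (X : ℝ), ContDiff ℝ 1 χ → 0 ≤ X → χ X = 0 →
      κ * γ * (∫ x in (0 : ℝ)..X, ‖χ x‖ ^ 2) + ‖D (χ 0)‖ ^ 2 ≤
      C * ((κ * γ)⁻¹ *
        (∫ x in (0 : ℝ)..X, ‖D (deriv χ x) - (-tangentialSymbol a S σ γ) (χ x)‖ ^ 2) +
        ‖T (χ 0)‖ ^ 2)) : HalfLineEstimate a D S T ((1 + κ⁻¹) ^ 2 * C) γ := by
  intro σ χ X h1 h2 h3
  have h4 := h σ χ X h1 h2 h3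
  simp only [neg_apply, sub_neg_eq_add] at h4
  set I := ∫ x in (0 : ℝ)..X, ‖χ x‖ ^ 2
  set J := ∫ x in (0 : ℝ)..X, ‖D (deriv χ x) + tangentialSymbol a S σ γ (χ x)‖ ^ 2
  have hI : 0 ≤ I := intervalIntegral.integral_nonneg h2 fun x _ => by positivity
  have hJ : 0 ≤ J := intervalIntegral.integral_nonneg h2 fun x _ => by positivity
  have hκ' : 0 < κ⁻¹ := inv_pos.2 hκ
  calc γ * I + ‖D (χ 0)‖ ^ 2 ≤ (1 + κ⁻¹) * (κ * γ * I + ‖D (χ 0)‖ ^ 2) := by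
        have e : (1 + κ⁻¹) * (κ * γ * I + ‖D (χ 0)‖ ^ 2) = γ * I + ‖D (χ 0)‖ ^ 2 +
          (κ * γ * I + κ⁻¹ * ‖D (χ 0)‖ ^ 2) := by field_simp; ring
        rw [e]
        have : 0 ≤ κ * γ * I + κ⁻¹ * ‖D (χ 0)‖ ^ 2 := by positivity
        linarith
    _ ≤ (1 + κ⁻¹) * (C * ((1 + κ⁻¹) * (γ⁻¹ * J + ‖T (χ 0)‖ ^ 2))) := by
        refine mul_le_mul_of_nonneg_left (h4.trans (mul_le_mul_of_nonneg_left ?_ hC))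
          (by positivity)
        have e : (1 + κ⁻¹) * (γ⁻¹ * J + ‖T (χ 0)‖ ^ 2) = (κ * γ)⁻¹ * J + ‖T (χ 0)‖ ^ 2 +
          (γ⁻¹ * J + κ⁻¹ * ‖T (χ 0)‖ ^ 2) := by rw [mul_inv]; ring
        rw [e]
        have : 0 ≤ γ⁻¹ * J + κ⁻¹ * ‖T (χ 0)‖ ^ 2 := by positivity
        linarith
    _ = _ := by ring

/-- The estimate for `P` with boundary operator `B`. It does not use the number of rows of `B`. -/
theorem exists_halfLineEstimate {A : Fin (d + 1) → Matrix (Fin N) (Fin N) ℂ}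
    {B : Matrix (Fin p) (Fin N) ℂ} (hA : SymmetricHyperbolic A) (hB : KreissSakamoto A B 0) :
    ∃ C, 0 < C ∧ ∀ γ : ℝ, 0 < γ → HalfLineEstimate (fun j : Fin d => coef (A j.castSucc))
      (coef (A (Fin.last d))) (coef (A 0)) (coef B) C γ := by
  obtain ⟨κ, hκ, hdiss⟩ := hA.exists_dissipative
  obtain ⟨c, hc, hcB⟩ := hB.exists_bound hA
  set D := coef (A (Fin.last d)) with hDdef
  have hD : ∀ x y, inner ℂ (D x) y = inner ℂ x (D y) :=
    inner_coef_left (hA.isHermitian (Fin.last d))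
  obtain ⟨K, hK, hBK⟩ := exists_bound_of_ker_le D (coef B) (fun x hx => hB.1 hx)
  obtain ⟨K', hK', hq⟩ := exists_quadratic_bound D hD
  set C := ‖D‖ + 2 * ((1 + K / c) ^ 2 + (1 / c) ^ 2)
  have hC : 0 ≤ C := by positivity
  refine ⟨_, ?_, fun γ hγ => HalfLineEstimate.of_scaled hκ hγ ?_ fun σ χ X h1 h2 h3 =>
    halfLine_estimate (G' := -tangentialSymbol (fun j => -coef (A j.castSucc)) (coef (A 0)) σ γ)
      hK' hC hD (fun x y => ?_) (mul_pos hκ hγ) (fun v => ?_) hq (fun a => ?_) h1 h2 h3⟩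
  · positivity
  · positivity
  · rw [neg_apply, neg_apply, inner_neg_left, inner_neg_right, inner_tangentialSymbol
      (fun j => inner_coef_left (hA.isHermitian _)) (inner_coef_left (hA.isHermitian _))]
  · rw [← coef_symbolG]; exact hdiss σ γ hγ v
  · obtain ⟨y, hy, hy1, hy2⟩ := exists_pairing_direct (B := coef B) hD (mul_pos hκ hγ)
      (hdiss σ γ hγ)
      (G' := -tangentialSymbol (fun j => -coef (A j.castSucc)) (coef (A 0)) σ γ)
      (fun x y => by
        rw [coef_symbolG, neg_apply, neg_apply, inner_neg_left, inner_neg_right,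
          inner_tangentialSymbol (fun j => inner_coef_left (hA.isHermitian _))
          (inner_coef_left (hA.isHermitian _))])
      _ (hA.coef_symbolG_act σ hγ) hc hK
      (fun v hv => hcB σ γ hγ v (by rwa [stableSubspace_eq])) hBK a
    refine ⟨y, hy, hy1.trans ?_, hy2.trans ?_⟩
    · refine mul_le_mul_of_nonneg_right ?_ (norm_nonneg _)
      exact le_add_of_nonneg_right (by positivity)
    · refine mul_le_mul_of_nonneg_right ?_ (by positivity)
      exact le_add_of_nonneg_left (by positivity)

/-- `B` is injective on the stable subspace by the Kreiss–Sakamoto bound, and hence onto when the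
number of rows of `B` is the dimension of the stable subspace. -/
theorem exists_mem_stableSubspace {A : Fin (d + 1) → Matrix (Fin N) (Fin N) ℂ}
    {B : Matrix (Fin p) (Fin N) ℂ} (hA : SymmetricHyperbolic A)
    (hp : ∃ σ γ, (σ, γ) ∈ upperSphere d ∧ Module.finrank ℂ (stableSubspace A σ γ) = p)
    (hB : KreissSakamoto A B 0) (σ : Tangential d) {γ : ℝ} (hγ : 0 < γ) (b : CVec p) :
    ∃ v ∈ stableSubspace A σ γ, coef B v = b := by
  obtain ⟨κ, hκ, hdiss⟩ := hA.exists_dissipative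
  obtain ⟨c, hc, hcB⟩ := hB.exists_bound hA
  have hD := inner_coef_left (hA.isHermitian (Fin.last d))
  obtain ⟨σ', γ', ⟨-, hγ'⟩, hfr⟩ := hp
  have hfr' := (finrank_stableSubspace hA (σ := σ) (σ' := σ') hγ hγ').trans hfr
  have hi : Function.Injective ((coef B : CVec N →ₗ[ℂ] CVec p).domRestrict
      (stableSubspace A σ γ)) := by
    rw [injective_iff_map_eq_zero]
    intro v hv
    have hv' : coef B v = 0 := hv
    have h1 := hcB σ γ hγ v v.2
    rw [hv', norm_zero] at h1
    have h2 : ‖coef (A (Fin.last d)) v‖ ≤ 0 := by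
      by_contra hcon
      push Not at hcon
      nlinarith
    refine Subtype.ext (Submodule.disjoint_def.1 (disjoint_decayingData_ker hD (mul_pos hκ hγ)
      (hdiss σ γ hγ)) v ?_ (norm_le_zero_iff.1 h2))
    exact stablePart_le_decayingData _ _ _ (hA.coef_symbolG_act σ hγ)
      ((stableSubspace_eq A σ γ).le v.2)
  have hs := (LinearMap.injective_iff_surjective_of_finrank_eq_finrank
    (hfr'.trans (by simp))).1 hi
  obtain ⟨v, hv⟩ := hs b
  exact ⟨v, v.2, hv⟩

/-- The space `Z = D (ker B)` of the traces `D u` with `B u = 0`. The boundary condition of the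
adjoint problem is that the projection of `φ` onto `Z` vanishes. -/
def homogeneousTraces (A : Fin (d + 1) → Matrix (Fin N) (Fin N) ℂ) (B : Matrix (Fin p) (Fin N) ℂ) :
    Submodule ℂ (CVec N) :=
  (LinearMap.ker (coef B : CVec N →ₗ[ℂ] CVec p)).map (coef (A (Fin.last d)) : CVec N →ₗ[ℂ] CVec N)

/-- The estimate for the formal adjoint of `P`, after weighting with `e^{γt}`, with the projection
onto `Z` as boundary operator. -/
theorem exists_halfLineEstimate_adjoint {A : Fin (d + 1) → Matrix (Fin N) (Fin N) ℂ}
    {B : Matrix (Fin p) (Fin N) ℂ} (hA : SymmetricHyperbolic A)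
    (hp : ∃ σ γ, (σ, γ) ∈ upperSphere d ∧ Module.finrank ℂ (stableSubspace A σ γ) = p)
    (hB : KreissSakamoto A B 0) :
    ∃ C, 0 < C ∧ ∀ γ : ℝ, 0 < γ → HalfLineEstimate (fun j : Fin d => -coef (A j.castSucc))
      (-coef (A (Fin.last d))) (coef (A 0)) (homogeneousTraces A B).starProjection C γ := by
  obtain ⟨κ, hκ, hdiss⟩ := hA.exists_dissipative
  obtain ⟨c, hc, hcB⟩ := hB.exists_bound hA
  set D := coef (A (Fin.last d)) with hDdef
  have hD : ∀ x y, inner ℂ (D x) y = inner ℂ x (D y) :=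
    inner_coef_left (hA.isHermitian (Fin.last d))
  have hDn : ∀ x y, inner ℂ ((-D) x) y = inner ℂ x ((-D) y) := fun x y => by simp [hD]
  obtain ⟨K, hK, hBK⟩ := exists_bound_of_ker_le D (coef B) (fun x hx => hB.1 hx)
  obtain ⟨K', hK', hq⟩ := exists_quadratic_bound (-D) hDn
  obtain ⟨R, hR⟩ := exists_pseudoInverse D
  set C := K / c * ‖R‖ + ‖D‖ ^ 2 * (2 + (1 + K / c) ^ 2)
  have hC : 0 ≤ C := by positivity
  refine ⟨_, ?_, fun γ hγ => HalfLineEstimate.of_scaled hκ hγ ?_ fun σ χ X h1 h2 h3 =>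
    halfLine_estimate (G' := -tangentialSymbol (fun j => coef (A j.castSucc)) (coef (A 0)) σ γ)
      hK' hC hDn (fun x y => ?_) (mul_pos hκ hγ) (fun v => ?_) hq (fun a => ?_) h1 h2 h3⟩
  · positivity
  · positivity
  · rw [neg_apply, neg_apply, inner_neg_left, inner_neg_right, ← inner_tangentialSymbol
      (a := fun j => -coef (A j.castSucc)) (fun j x y => by
        simp [inner_coef_left (hA.isHermitian _)]) (inner_coef_left (hA.isHermitian _))]
    simp
  · have := tangentialSymbol_dissipative (a := fun j : Fin d => -coef (A j.castSucc))
      (S := coef (A 0)) (κ := κ) (fun j x y => by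
        simp [inner_coef_left (hA.isHermitian _)]) ?_ σ hγ v
    · exact this
    · intro w
      -- At `σ = 0`, `γ = 1` the symbol is `A⁰` alone.
      have h5 := hdiss 0 1 one_pos w
      rw [coef_symbolG] at h5
      simp [tangentialSymbol] at h5
      linarith
  · obtain ⟨y, hy, hy1, hy2⟩ := exists_pairing_adjoint (B := coef B) hD
      _ (hA.coef_symbolG_act σ hγ) hc hK
      (fun v hv => hcB σ γ hγ v (by rwa [stableSubspace_eq])) hBK
      (fun a => by
        rw [← stableSubspace_eq]; exact exists_mem_stableSubspace hA hp hB σ hγ (coef B a)) R hR a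
    rw [coef_symbolG] at hy
    rw [neg_neg]
    refine ⟨y, hy, ?_, ?_⟩
    · rw [neg_apply, neg_apply, norm_neg, norm_neg]
      refine hy1.trans (mul_le_mul_of_nonneg_right ?_ (norm_nonneg _))
      exact le_add_of_nonneg_right (by positivity)
    · rw [neg_apply, norm_neg, inner_neg_right, norm_neg]
      refine hy2.trans (mul_le_mul_of_nonneg_right ?_ (by positivity))
      exact le_add_of_nonneg_left (by positivity)

end Matrices

/-! ### Test functions -/

section TestFunctions

variable {V W F : Type*} [NormedAddCommGroup V] [NormedSpace ℝ V] [NormedAddCommGroup W]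
  [NormedSpace ℝ W] [NormedAddCommGroup F] [NormedSpace ℝ F]

theorem IsTestFunction.continuous {φ : V → F} (h : IsTestFunction φ) : Continuous φ :=
  h.1.continuous

theorem IsTestFunction.differentiable {φ : V → F} (h : IsTestFunction φ) : Differentiable ℝ φ :=
  h.1.differentiable (by simp)

theorem IsTestFunction.fderiv_apply {φ : V → F} (h : IsTestFunction φ) (v : V) :
    IsTestFunction fun q => fderiv ℝ φ q v :=
  ⟨(h.1.fderiv_right (m := ∞) (by simp)).clm_apply contDiff_const,
    (h.2.fderiv ℝ).comp_left (g := fun L : V →L[ℝ] F => L v) rfl⟩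

theorem IsTestFunction.clm_comp {G : Type*} [NormedAddCommGroup G] [NormedSpace ℝ G] {φ : V → F}
    (h : IsTestFunction φ) (L : F →L[ℝ] G) : IsTestFunction fun q => L (φ q) :=
  ⟨L.contDiff.comp h.1, h.2.comp_left (map_zero L)⟩

theorem IsTestFunction.add {φ ψ : V → F} (h : IsTestFunction φ) (h' : IsTestFunction ψ) :
    IsTestFunction fun q => φ q + ψ q := ⟨h.1.add h'.1, h.2.add h'.2⟩

theorem IsTestFunction.zero : IsTestFunction fun _ : V => (0 : F) :=
  ⟨contDiff_const, HasCompactSupport.zero⟩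

theorem IsTestFunction.sum {ι : Type*} (s : Finset ι) {φ : ι → V → F}
    (h : ∀ i, IsTestFunction (φ i)) : IsTestFunction fun q => ∑ i ∈ s, φ i q := by
  classical
  induction s using Finset.induction_on with
  | empty => simpa using IsTestFunction.zero
  | insert i s hi ih => simpa [Finset.sum_insert hi] using (h i).add ih

theorem IsTestFunction.smul {χ : V → ℝ} {φ : V → F} (hχ : ContDiff ℝ ∞ χ)
    (h : IsTestFunction φ) : IsTestFunction fun q => χ q • φ q :=
  ⟨hχ.smul h.1, h.2.smul_left⟩

theorem IsTestFunction.slice {φ : V × W → F} (h : IsTestFunction φ) (x : W) :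
    IsTestFunction fun z => φ (z, x) := by
  refine ⟨h.1.comp (contDiff_id.prodMk contDiff_const), ?_⟩
  refine HasCompactSupport.intro (h.2.image continuous_fst) fun z hz => ?_
  by_contra hne
  exact hz ⟨(z, x), subset_tsupport _ hne, rfl⟩

theorem IsTestFunction.memLp [MeasurableSpace V] [BorelSpace V] [SecondCountableTopology V]
    {μ : Measure V} [IsFiniteMeasureOnCompacts μ] {φ : V → F} (h : IsTestFunction φ)
    (p : ENNReal) : MemLp φ p μ := h.continuous.memLp_of_hasCompactSupport h.2

theorem IsTestFunction.exists_bound_snd {φ : V × ℝ → F} (h : IsTestFunction φ) :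
    ∃ X : ℝ, 0 < X ∧ ∀ z x, X ≤ |x| → φ (z, x) = 0 := by
  obtain ⟨X, hX⟩ := (h.2.image continuous_snd).isBounded.exists_norm_le
  refine ⟨|X| + 1, by positivity, fun z x hx => ?_⟩
  by_contra hne
  have := hX x ⟨(z, x), subset_tsupport _ hne, rfl⟩
  rw [Real.norm_eq_abs] at this
  linarith [le_abs_self X]

theorem fderiv_slice {φ : V × W → F} (h : Differentiable ℝ φ) (z v : V) (x : W) :
    fderiv ℝ (fun z => φ (z, x)) z v = fderiv ℝ φ (z, x) (v, 0) := by
  have h1 : HasFDerivAt (fun z : V => (z, x)) ((ContinuousLinearMap.id ℝ V).prod 0) z :=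
    (hasFDerivAt_id z).prodMk (hasFDerivAt_const x z)
  have h2 : HasFDerivAt (fun z => φ (z, x)) _ z :=
    HasFDerivAt.comp (f := fun z : V => (z, x)) z (h (z, x)).hasFDerivAt h1
  rw [h2.fderiv]
  simp

end TestFunctions

/-! ### Plancherel: a priori estimates for test functions -/

section PartialFourier

variable {E : Type*} [NormedAddCommGroup E] [InnerProductSpace ℂ E] {d : ℕ}

/-- The Fourier transform in the tangential variables, with Mathlib's kernel `e^{-2πi⟨z, ξ⟩}`: the
dual variable `σ` of the symbol is `2πξ`. -/
def partialFourier (v : SpaceTime d → E) (ξ : Tangential d) (x : ℝ) : E :=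
  𝓕 (fun z => v (z, x)) ξ

theorem partialFourier_eq_setIntegral {v : SpaceTime d → E} {K : Set (Tangential d)}
    (hK : ∀ z x, z ∉ K → v (z, x) = 0) (ξ : Tangential d) (x : ℝ) :
    partialFourier v ξ x = ∫ z in K, Real.fourierChar (-inner ℝ z ξ) • v (z, x) := by
  rw [partialFourier, Real.fourier_eq, setIntegral_eq_integral_of_forall_compl_eq_zero]
  intro z hz
  rw [hK z x hz, smul_zero]

theorem exists_compact_fst {E : Type*} [NormedAddCommGroup E]
    {v : SpaceTime d → E} (hv : HasCompactSupport v) :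
    ∃ K : Set (Tangential d), IsCompact K ∧ ∀ z x, z ∉ K → v (z, x) = 0 := by
  refine ⟨_, hv.image continuous_fst, fun z x hz => ?_⟩
  by_contra hne
  exact hz ⟨(z, x), subset_tsupport _ hne, rfl⟩

theorem continuous_partialFourier {v : SpaceTime d → E} (hc : Continuous v)
    (hv : HasCompactSupport v) :
    Continuous fun q : Tangential d × ℝ => partialFourier v q.1 q.2 := by
  obtain ⟨K, hK, h0⟩ := exists_compact_fst hv
  simp only [partialFourier_eq_setIntegral h0]
  refine continuous_parametric_integral_of_continuous (f := fun (q : Tangential d × ℝ) z =>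
    Real.fourierChar (-inner ℝ z q.1) • v (z, q.2)) ?_ hK
  simp only [Function.uncurry_def, Circle.smul_def]
  fun_prop

theorem continuous_partialFourier_right {v : SpaceTime d → E} (hc : Continuous v)
    (hv : HasCompactSupport v) (ξ : Tangential d) : Continuous (partialFourier v ξ) := by
  have h3 : Continuous fun x : ℝ => (ξ, x) := by fun_prop
  have h4 := (continuous_partialFourier hc hv).comp h3
  simp only [Function.comp_def] at h4
  exact h4

theorem hasDerivAt_partialFourier {v : SpaceTime d → E} (hv : IsTestFunction v)
    (ξ : Tangential d) (x : ℝ) :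
    HasDerivAt (partialFourier v ξ) (partialFourier (fun q => fderiv ℝ v q (0, 1)) ξ x) x := by
  have hv' := hv.fderiv_apply (0, 1)
  obtain ⟨K, hK, h0⟩ := exists_compact_fst hv.2
  obtain ⟨K', hK', h0'⟩ := exists_compact_fst hv'.2
  have e1 : partialFourier v ξ =
      fun x => ∫ z in K ∪ K', Real.fourierChar (-inner ℝ z ξ) • v (z, x) := funext fun x =>
    partialFourier_eq_setIntegral (fun z x hz => h0 z x fun h => hz (Or.inl h)) ξ x
  rw [e1, partialFourier_eq_setIntegral (K := K ∪ K') fun z x hz => h0' z x fun h => hz (Or.inr h)]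
  obtain ⟨M, hM⟩ := hv'.2.exists_bound_of_continuous hv'.continuous
  have hKK := hK.union hK'
  have : IsFiniteMeasure (volume.restrict (K ∪ K')) := ⟨by simpa using hKK.measure_lt_top⟩
  have hcont : ∀ {w : SpaceTime d → E}, Continuous w → ∀ x,
      Continuous fun z => Real.fourierChar (-inner ℝ z ξ) • w (z, x) := by
    intro w hw x
    simp only [Circle.smul_def]
    fun_prop
  refine (hasDerivAt_integral_of_dominated_loc_of_deriv_le (s := Set.univ) (bound := fun _ => M)
    (F' := fun x z => Real.fourierChar (-inner ℝ z ξ) • fderiv ℝ v (z, x) (0, 1))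
    (μ := volume.restrict (K ∪ K'))
    univ_mem
    (Eventually.of_forall fun y => (hcont hv.continuous y).aestronglyMeasurable)
    ((hcont hv.continuous x).continuousOn.integrableOn_compact hKK)
    (hcont hv'.continuous x).aestronglyMeasurable
    (Eventually.of_forall fun z y _ => ?_) (integrable_const M)
    (Eventually.of_forall fun z y _ => ?_)).2
  · rw [Circle.norm_smul]; exact hM _
  · have h1 := (hv.differentiable (z, y)).hasFDerivAt.comp_hasDerivAt y
      ((hasDerivAt_const y z).prodMk (hasDerivAt_id y))
    have h2 := h1.const_smul (Real.fourierChar (-inner ℝ z ξ) : ℂ)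
    exact h2

theorem contDiff_partialFourier {v : SpaceTime d → E} (hv : IsTestFunction v)
    (ξ : Tangential d) : ContDiff ℝ 1 (partialFourier v ξ) := by
  rw [contDiff_one_iff_deriv]
  refine ⟨fun x => (hasDerivAt_partialFourier hv ξ x).differentiableAt, ?_⟩
  have h1 : deriv (partialFourier v ξ) = partialFourier (fun q => fderiv ℝ v q (0, 1)) ξ :=
    funext fun x => (hasDerivAt_partialFourier hv ξ x).deriv
  rw [h1]
  exact continuous_partialFourier_right (hv.fderiv_apply (0, 1)).continuous
    (hv.fderiv_apply (0, 1)).2 ξ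

theorem partialFourier_clm [FiniteDimensional ℂ E] {E' : Type*} [NormedAddCommGroup E']
    [InnerProductSpace ℂ E'] [FiniteDimensional ℂ E'] (L : E →L[ℂ] E')
      {v : SpaceTime d → E} (hv : IsTestFunction v)
    (ξ : Tangential d) (x : ℝ) :
    partialFourier (fun q => L (v q)) ξ x = L (partialFourier v ξ x) := by
  simp only [partialFourier, Real.fourier_eq]
  have hint : Integrable fun z => Real.fourierChar (-inner ℝ z ξ) • v (z, x) := by
    have := memLp_one_iff_integrable.1 ((hv.slice x).memLp 1 (μ := volume))
    simpa using (Real.fourierIntegral_convergent_iff ξ).2 this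
  rw [← L.integral_comp_comm hint]
  simp [Circle.smul_def]

theorem partialFourier_add {v w : SpaceTime d → E} (hv : IsTestFunction v) (hw : IsTestFunction w)
    (ξ : Tangential d) (x : ℝ) :
    partialFourier (fun q => v q + w q) ξ x = partialFourier v ξ x + partialFourier w ξ x := by
  simp only [partialFourier, Real.fourier_eq, smul_add]
  have hint : ∀ {v : SpaceTime d → E}, IsTestFunction v →
      Integrable fun z => Real.fourierChar (-inner ℝ z ξ) • v (z, x) := by
    intro v hv
    have := memLp_one_iff_integrable.1 ((hv.slice x).memLp 1 (μ := volume))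
    simpa using (Real.fourierIntegral_convergent_iff ξ).2 this
  exact integral_add (hint hv) (hint hw)

theorem partialFourier_sum {ι : Type*} (s : Finset ι) {v : ι → SpaceTime d → E}
    (hv : ∀ i, IsTestFunction (v i)) (ξ : Tangential d) (x : ℝ) :
    partialFourier (fun q => ∑ i ∈ s, v i q) ξ x = ∑ i ∈ s, partialFourier (v i) ξ x := by
  classical
  induction s using Finset.induction_on with
  | empty => simp [partialFourier, Real.fourier_eq]
  | insert i s hi ih =>
    simp only [Finset.sum_insert hi]
    rw [partialFourier_add (hv i) (IsTestFunction.sum s hv), ih]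

theorem partialFourier_tangential {v : SpaceTime d → E} (hv : IsTestFunction v)
    (ξ w : Tangential d) (x : ℝ) :
    partialFourier (fun q => fderiv ℝ v q (w, 0)) ξ x =
      (Complex.I * ((2 * Real.pi * inner ℝ ξ w : ℝ) : ℂ)) • partialFourier v ξ x := by
  have hs := hv.slice x
  have h1 := SchwartzMap.fourier_lineDerivOp_eq (hs.2.toSchwartzMap hs.1) w
  have h2 := congrArg (fun f : SchwartzMap (Tangential d) E => f ξ) h1
  have ht : (inner ℝ · w : Tangential d → ℝ).HasTemperateGrowth :=
    ((innerSL ℝ).flip w).hasTemperateGrowth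
  simp only [SchwartzMap.fourier_coe, smul_apply,
    SchwartzMap.smulLeftCLM_apply_apply ht] at h2
  have h3 : partialFourier (fun q => fderiv ℝ v q (w, 0)) ξ x =
      𝓕 (⇑(LineDeriv.lineDerivOp w (hs.2.toSchwartzMap hs.1))) ξ := by
    refine congrArg (fun f : Tangential d → E => 𝓕 f ξ) (funext fun z => ?_)
    rw [SchwartzMap.lineDerivOp_apply_eq_fderiv]
    exact (fderiv_slice hv.differentiable z w x).symm
  rw [h3, h2, ← Complex.coe_smul, smul_smul]
  congr 1
  push_cast
  ring

theorem integral_norm_sq_partialFourier [FiniteDimensional ℂ E]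
    {v : SpaceTime d → E} (hv : IsTestFunction v) (x : ℝ) :
    Integrable (fun ξ => ‖partialFourier v ξ x‖ ^ 2) ∧
      ∫ ξ, ‖partialFourier v ξ x‖ ^ 2 = ∫ z, ‖v (z, x)‖ ^ 2 := by
  have hs := hv.slice x
  have : CompleteSpace E := FiniteDimensional.complete ℂ E
  refine ⟨?_, SchwartzMap.integral_norm_sq_fourier (hs.2.toSchwartzMap hs.1)⟩
  exact ((𝓕 (hs.2.toSchwartzMap hs.1)).memLp 2 volume).integrable_norm_pow two_ne_zero

theorem volume_restrict_halfSpace (d : ℕ) :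
    (volume.restrict (halfSpace d) : Measure (SpaceTime d)) =
      (volume : Measure (Tangential d)).prod (volume.restrict (Set.Ioi 0)) := by
  have h : halfSpace d = Set.univ ×ˢ Set.Ioi (0 : ℝ) := by ext; simp [halfSpace]
  rw [h, Measure.volume_eq_prod, ← Measure.prod_restrict, Measure.restrict_univ]

/-- Plancherel on the half space, for a function supported in `{|x| < X}`. -/
theorem integral_halfLine_partialFourier [FiniteDimensional ℂ E] {v : SpaceTime d → E}
    (hv : IsTestFunction v) {X : ℝ} (hX : 0 < X) (h0 : ∀ z x, X ≤ |x| → v (z, x) = 0) :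
    Integrable (fun ξ => ∫ x in (0 : ℝ)..X, ‖partialFourier v ξ x‖ ^ 2) ∧
      ∫ ξ, ∫ x in (0 : ℝ)..X, ‖partialFourier v ξ x‖ ^ 2 = ∫ q in halfSpace d, ‖v q‖ ^ 2 := by
  have hcont := continuous_partialFourier hv.continuous hv.2
  have hv2 : Integrable (fun q => ‖v q‖ ^ 2) (volume.restrict (halfSpace d)) :=
    (hv.memLp 2).integrable_norm_pow two_ne_zero
  have hint : Integrable (fun q : Tangential d × ℝ => ‖partialFourier v q.1 q.2‖ ^ 2)
      ((volume : Measure (Tangential d)).prod (volume.restrict (Set.Ioc 0 X))) := by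
    refine (integrable_prod_iff' (Continuous.aestronglyMeasurable (by fun_prop))).2 ?_
    refine ⟨Eventually.of_forall fun x => (integral_norm_sq_partialFourier hv x).1, ?_⟩
    simp only [norm_pow, norm_norm, (integral_norm_sq_partialFourier hv _).2]
    rw [volume_restrict_halfSpace] at hv2
    exact hv2.integral_prod_right.mono_measure (Measure.restrict_mono Set.Ioc_subset_Ioi_self
      le_rfl)
  simp only [intervalIntegral.integral_of_le hX.le]
  refine ⟨hint.integral_prod_left, ?_⟩
  rw [integral_integral_swap hint, volume_restrict_halfSpace, integral_prod_symm]
  · simp only [(integral_norm_sq_partialFourier hv _).2]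
    refine (setIntegral_eq_of_subset_of_forall_sdiff_eq_zero measurableSet_Ioi
      Set.Ioc_subset_Ioi_self fun x hx => ?_).symm
    have hx0 : X ≤ |x| := by
      rcases hx with ⟨h1, h2⟩
      rw [Set.mem_Ioi] at h1
      rw [abs_of_pos h1]
      by_contra hlt
      exact h2 ⟨h1, (not_le.1 hlt).le⟩
    simp [h0 _ x hx0]
  · rw [volume_restrict_halfSpace] at hv2
    exact hv2

/-- The operator `∑ a_j ∂_j + D ∂_x + γ S`. With `S = a_0` it is the conjugate of
`∑ a_j ∂_j + D ∂_x` by `e^{γt}`. For symmetric coefficients its formal adjoint is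
`diffOp (-a) (-D) S γ`. -/
def diffOp (a : Fin d → E →L[ℂ] E) (D S : E →L[ℂ] E) (γ : ℝ) (v : SpaceTime d → E)
    (q : SpaceTime d) : E :=
  (∑ j : Fin d, a j (fderiv ℝ v q (EuclideanSpace.single j (1 : ℝ), 0))) +
    D (fderiv ℝ v q (0, 1)) + (γ : ℂ) • S (v q)

theorem IsTestFunction.diffOp {v : SpaceTime d → E} (hv : IsTestFunction v)
    (a : Fin d → E →L[ℂ] E) (D S : E →L[ℂ] E) (γ : ℝ) : IsTestFunction (diffOp a D S γ v) :=
  ((IsTestFunction.sum Finset.univ fun j => (hv.fderiv_apply _).clm_comp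
    ((a j).restrictScalars ℝ)).add ((hv.fderiv_apply (0, 1)).clm_comp (D.restrictScalars ℝ))).add
    (hv.clm_comp (((γ : ℂ) • S).restrictScalars ℝ))

theorem partialFourier_diffOp [FiniteDimensional ℂ E] {v : SpaceTime d → E}
    (hv : IsTestFunction v) (a : Fin d → E →L[ℂ] E) (D S : E →L[ℂ] E) (γ : ℝ) (ξ : Tangential d)
    (x : ℝ) : partialFourier (diffOp a D S γ v) ξ x =
      D (deriv (partialFourier v ξ) x) +
        tangentialSymbol a S ((2 * Real.pi) • ξ) γ (partialFourier v ξ x) := by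
  have h1 : ∀ j, IsTestFunction fun q =>
      a j (fderiv ℝ v q (EuclideanSpace.single j (1 : ℝ), 0)) := fun j =>
    (hv.fderiv_apply _).clm_comp ((a j).restrictScalars ℝ)
  have h2 : IsTestFunction fun q => D (fderiv ℝ v q (0, 1)) :=
    (hv.fderiv_apply (0, 1)).clm_comp (D.restrictScalars ℝ)
  have h3 : IsTestFunction fun q => ((γ : ℂ) • S) (v q) :=
    hv.clm_comp (((γ : ℂ) • S).restrictScalars ℝ)
  have e1 := partialFourier_add ((IsTestFunction.sum Finset.univ h1).add h2) h3 ξ x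
  rw [partialFourier_add (IsTestFunction.sum Finset.univ h1) h2,
    partialFourier_sum Finset.univ h1, partialFourier_clm _ hv,
    partialFourier_clm D (hv.fderiv_apply (0, 1)), ← (hasDerivAt_partialFourier hv ξ x).deriv] at e1
  refine e1.trans ?_
  simp only [partialFourier_clm _ (hv.fderiv_apply _), partialFourier_tangential hv]
  simp only [tangentialSymbol, add_apply, sum_apply, smul_apply, map_smul]
  rw [add_comm (∑ j, _), add_assoc]
  congr 2
  refine Finset.sum_congr rfl fun j _ => ?_
  simp [EuclideanSpace.inner_single_right]

theorem integrable_slice_norm_sq {F : Type*} [NormedAddCommGroup F] [NormedSpace ℝ F]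
    {v : SpaceTime d → F} (hv : IsTestFunction v) (x : ℝ) :
    Integrable fun z => ‖v (z, x)‖ ^ 2 :=
  ((hv.slice x).memLp 2).integrable_norm_pow two_ne_zero

theorem integral_weighted_le {α : Type*} [MeasurableSpace α] {μ : Measure α} (s t C : ℝ)
    {f₁ f₂ f₃ f₄ : α → ℝ} (h₁ : Integrable f₁ μ) (h₂ : Integrable f₂ μ) (h₃ : Integrable f₃ μ)
    (h₄ : Integrable f₄ μ) (h : ∀ x, s * f₁ x + f₂ x ≤ C * (t * f₃ x + f₄ x)) :
    s * (∫ x, f₁ x ∂μ) + ∫ x, f₂ x ∂μ ≤ C * (t * (∫ x, f₃ x ∂μ) + ∫ x, f₄ x ∂μ) := by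
  have := integral_mono ((h₁.const_mul s).add h₂) (((h₃.const_mul t).add h₄).const_mul C) h
  simp only [Pi.add_apply] at this
  rwa [integral_add (h₁.const_mul s) h₂, integral_const_mul, integral_const_mul,
    integral_add (h₃.const_mul t) h₄, integral_const_mul] at this

/-- The half-line estimate at each frequency gives, by Plancherel, the a priori estimate for
functions that are smooth up to the boundary. No boundary condition is imposed on `v`. -/
theorem HalfLineEstimate.energy_estimate [FiniteDimensional ℂ E] {E' : Type*}
    [NormedAddCommGroup E'] [InnerProductSpace ℂ E'] [FiniteDimensional ℂ E']
    {a : Fin d → E →L[ℂ] E} {D S : E →L[ℂ] E} {T : E →L[ℂ] E'} {C γ : ℝ}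
    (h : HalfLineEstimate a D S T C γ) {v : SpaceTime d → E} (hv : IsTestFunction v) :
    γ * (∫ q in halfSpace d, ‖v q‖ ^ 2) + ∫ z, ‖D (v (z, 0))‖ ^ 2 ≤
      C * (γ⁻¹ * (∫ q in halfSpace d, ‖diffOp a D S γ v q‖ ^ 2) + ∫ z, ‖T (v (z, 0))‖ ^ 2) := by
  have hL := hv.diffOp a D S γ
  obtain ⟨X₁, hX₁, h01⟩ := hv.exists_bound_snd
  obtain ⟨X₂, hX₂, h02⟩ := hL.exists_bound_snd
  set X := max X₁ X₂
  have hX : 0 < X := lt_max_of_lt_left hX₁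
  have h0 : ∀ z x, X ≤ |x| → v (z, x) = 0 := fun z x hx => h01 z x ((le_max_left _ _).trans hx)
  have i1 := integral_halfLine_partialFourier hv hX h0
  have i2 := integral_halfLine_partialFourier hL hX
    fun z x hx => h02 z x ((le_max_right _ _).trans hx)
  have i3 := integral_norm_sq_partialFourier (hv.clm_comp (D.restrictScalars ℝ)) 0
  have i4 : Integrable (fun ξ => ‖T (partialFourier v ξ 0)‖ ^ 2) ∧
      ∫ ξ, ‖T (partialFourier v ξ 0)‖ ^ 2 = ∫ z, ‖T (v (z, 0))‖ ^ 2 := by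
    simpa only [ContinuousLinearMap.coe_restrictScalars', partialFourier_clm T hv] using
      integral_norm_sq_partialFourier (hv.clm_comp (T.restrictScalars ℝ)) 0
  have hest : ∀ ξ, γ * (∫ x in (0 : ℝ)..X, ‖partialFourier v ξ x‖ ^ 2) +
      ‖partialFourier (fun q => (D.restrictScalars ℝ) (v q)) ξ 0‖ ^ 2 ≤
      C * (γ⁻¹ * (∫ x in (0 : ℝ)..X, ‖partialFourier (diffOp a D S γ v) ξ x‖ ^ 2) +
        ‖T (partialFourier v ξ 0)‖ ^ 2) := by
    intro ξ
    have hXz : partialFourier v ξ X = 0 := by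
      rw [partialFourier, Real.fourier_eq]
      simp only [h0 _ X (le_abs_self X), smul_zero, integral_zero]
    have := h ((2 * Real.pi) • ξ) (partialFourier v ξ) X (contDiff_partialFourier hv ξ) hX.le hXz
    simp only [partialFourier_diffOp hv]
    have e := partialFourier_clm D hv ξ 0
    rw [← e] at this
    exact this
  have key := integral_weighted_le γ γ⁻¹ C i1.1 i3.1 i2.1 i4.1 hest
  rw [i1.2, i2.2, i3.2, i4.2] at key
  exact key

end PartialFourier

open scoped ENNReal

/-! ### Mollification and the weak formulation -/

section Mollification

variable {G F : Type*} [NormedAddCommGroup G] [MeasurableSpace G] [BorelSpace G]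
  [SecondCountableTopology G] [LocallyCompactSpace G] {μ : Measure G} [μ.IsAddHaarMeasure]
  [NormedAddCommGroup F]

theorem eLpNorm_two_sq {α F : Type*} [MeasurableSpace α] [NormedAddCommGroup F] (ν : Measure α)
    (f : α → F) : eLpNorm f 2 ν ^ 2 = ∫⁻ x, ‖f x‖ₑ ^ 2 ∂ν := by
  rw [eLpNorm_eq_lintegral_rpow_enorm_toReal (by norm_num) (by norm_num), ← ENNReal.rpow_natCast,
    ← ENNReal.rpow_mul]
  simp

theorem exists_eLpNorm_translate_sub_le {v : G → F} (hv : MemLp v 2 μ) {ε : ℝ} (hε : 0 < ε) :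
    ∃ δ > 0, ∀ s : G, ‖s‖ < δ → eLpNorm (fun q => v (q - s) - v q) 2 μ ≤ ENNReal.ofReal ε := by
  have h0 : Tendsto (fun s : G => DomAddAct.mk (-s) +ᵥ hv.toLp v) (𝓝 0) (𝓝 (hv.toLp v)) := by
    have : Fact ((2 : ℝ≥0∞) ≠ ⊤) := ⟨by norm_num⟩
    have hneg : Continuous fun s : G => DomAddAct.mk (-s) :=
      DomAddAct.continuous_mk.comp continuous_neg
    have h1 : Continuous fun s : G => DomAddAct.mk (-s) +ᵥ hv.toLp v :=
      hneg.vadd continuous_const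
    have h2 := h1.tendsto 0
    simpa using h2
  have h1 := (EMetric.tendsto_nhds.1 h0) (ENNReal.ofReal ε) (by simpa using hε)
  obtain ⟨δ, hδ, hball⟩ := Metric.eventually_nhds_iff.1 h1
  refine ⟨δ, hδ, fun s hs => ?_⟩
  have h2 := hball (y := s) (by simpa using hs)
  rw [DomAddAct.mk_vadd_toLp, Lp.edist_toLp_toLp] at h2
  refine le_trans (le_of_eq ?_) h2.le
  congr 1
  funext q
  simp [sub_eq_add_neg, add_comm]

variable [NormedSpace ℝ F]

theorem enorm_integral_sq_le {α : Type*} [MeasurableSpace α] {ν : Measure α}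
    [IsProbabilityMeasure ν] {f : α → F} (hf : AEStronglyMeasurable f ν) :
    ‖∫ x, f x ∂ν‖ₑ ^ 2 ≤ ∫⁻ x, ‖f x‖ₑ ^ 2 ∂ν := by
  have h1 : ‖∫ x, f x ∂ν‖ₑ ≤ eLpNorm f 2 ν := by
    refine (enorm_integral_le_lintegral_enorm f).trans ?_
    rw [← eLpNorm_one_eq_lintegral_enorm]
    exact eLpNorm_le_eLpNorm_of_exponent_le (by norm_num) hf
  rw [← eLpNorm_two_sq]
  gcongr

/-- Convolution with a probability density supported near zero is close to the identity in `L²`. The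
density is otherwise arbitrary; in particular its support may lie on one side of a hyperplane. -/
theorem eLpNorm_mollify_sub_le [CompleteSpace F] {v : G → F} (hv : MemLp v 2 μ)
    {ε : ℝ} (hε : 0 < ε) :
    ∃ δ > 0, ∀ ρ : G → ℝ, Continuous ρ → HasCompactSupport ρ → (∀ s, 0 ≤ ρ s) →
      ∫ s, ρ s ∂μ = 1 → (∀ s, δ ≤ ‖s‖ → ρ s = 0) →
      eLpNorm (fun q => (∫ s, ρ s • v (q - s) ∂μ) - v q) 2 μ ≤ ENNReal.ofReal ε := by
  obtain ⟨δ, hδ, h⟩ := exists_eLpNorm_translate_sub_le hv hε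
  refine ⟨δ, hδ, fun ρ hρc hρs hρ0 hρ1 hρδ => ?_⟩
  have hρi : Integrable ρ μ := hρc.integrable_of_hasCompactSupport hρs
  set ν : Measure G := μ.withDensity fun s => ENNReal.ofReal (ρ s) with hν
  have hmeas : Measurable fun s => ENNReal.ofReal (ρ s) :=
    ENNReal.measurable_ofReal.comp hρc.measurable
  have hprob : IsProbabilityMeasure ν := by
    refine ⟨?_⟩
    rw [hν, withDensity_apply _ MeasurableSet.univ, Measure.restrict_univ,
      ← ofReal_integral_eq_lintegral_ofReal hρi (Eventually.of_forall hρ0), hρ1, ENNReal.ofReal_one]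
  have hac : ν ≪ μ := withDensity_absolutelyContinuous _ _
  have hvm : AEStronglyMeasurable v μ := hv.aestronglyMeasurable
  have hjm : AEStronglyMeasurable (fun p : G × G => v (p.1 - p.2) - v p.1) (μ.prod ν) := by
    refine AEStronglyMeasurable.sub ?_ hvm.comp_fst
    exact (hvm.comp_quasiMeasurePreserving
      (quasiMeasurePreserving_sub_of_right_invariant μ μ)).mono_ac
      (Measure.AbsolutelyContinuous.rfl.prod hac)
  have hsm : ∀ q, AEStronglyMeasurable (fun s => v (q - s) - v q) ν := fun q =>
    ((hvm.comp_quasiMeasurePreserving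
      (quasiMeasurePreserving_sub_left_of_right_invariant μ q)).mono_ac hac).sub
      aestronglyMeasurable_const
  have hI : ∀ q, ∫ s, v (q - s) - v q ∂ν = (∫ s, ρ s • v (q - s) ∂μ) - v q := by
    intro q
    rw [hν, integral_withDensity_eq_integral_toReal_smul hmeas (by simp)]
    simp only [ENNReal.toReal_ofReal (hρ0 _), smul_sub]
    rw [integral_sub, integral_smul_const, hρ1, one_smul]
    · exact hρs.convolutionExists_left (ContinuousLinearMap.lsmul ℝ ℝ) hρc
        (hv.locallyIntegrable (by norm_num)) q
    · exact hρi.smul_const _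
  have hνs : ∀ᵐ s ∂ν, ‖s‖ < δ := by
    rw [hν, ae_withDensity_iff hmeas]
    refine Eventually.of_forall fun s hs => ?_
    by_contra hcon
    exact hs (by rw [hρδ s (not_lt.1 hcon), ENNReal.ofReal_zero])
  rw [← ENNReal.pow_le_pow_left_iff two_ne_zero, eLpNorm_two_sq]
  calc ∫⁻ q, ‖(∫ s, ρ s • v (q - s) ∂μ) - v q‖ₑ ^ 2 ∂μ
      ≤ ∫⁻ q, ∫⁻ s, ‖v (q - s) - v q‖ₑ ^ 2 ∂ν ∂μ := by
        refine lintegral_mono fun q => ?_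
        rw [← hI]
        exact enorm_integral_sq_le (hsm q)
    _ = ∫⁻ s, ∫⁻ q, ‖v (q - s) - v q‖ₑ ^ 2 ∂μ ∂ν :=
        lintegral_lintegral_swap (hjm.enorm.pow_const 2)
    _ ≤ ∫⁻ _, ENNReal.ofReal ε ^ 2 ∂ν := by
        refine lintegral_mono_ae (hνs.mono fun s hs => ?_)
        rw [← eLpNorm_two_sq]
        gcongr
        exact h s hs
    _ = ENNReal.ofReal ε ^ 2 := by simp

end Mollification

instance (d : ℕ) : (volume : Measure (SpaceTime d)).IsAddHaarMeasure := by
  rw [Measure.volume_eq_prod]; infer_instance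

section SmoothKernel

variable {E : Type*} [NormedAddCommGroup E] [InnerProductSpace ℂ E] {d : ℕ}

/-- The convolution of `w` with the kernel `ρ`. -/
def mollify (ρ : SpaceTime d → ℝ) (w : SpaceTime d → E) (q : SpaceTime d) : E :=
  ∫ q', ρ (q - q') • w q'

theorem mollify_eq_convolution (ρ : SpaceTime d → ℝ) (w : SpaceTime d → E) :
    mollify ρ w = convolution ρ w (ContinuousLinearMap.lsmul ℝ ℝ) volume := by
  funext q
  rw [convolution_eq_swap]
  rfl

theorem mollify_eq (ρ : SpaceTime d → ℝ) (w : SpaceTime d → E) (q : SpaceTime d) :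
    mollify ρ w q = ∫ s, ρ s • w (q - s) := by
  rw [mollify_eq_convolution]; rfl

theorem integrable_mollify {ρ : SpaceTime d → ℝ} (hc : Continuous ρ) (hρ : HasCompactSupport ρ)
    {w : SpaceTime d → E} (hw : LocallyIntegrable w) (q : SpaceTime d) :
    Integrable fun q' => ρ (q - q') • w q' := by
  refine hw.integrable_smul_left_of_hasCompactSupport (by fun_prop) ?_
  exact hρ.comp_homeomorph (Homeomorph.subLeft q)

theorem IsTestFunction.mollify [CompleteSpace E] {ρ : SpaceTime d → ℝ} (hρ : IsTestFunction ρ)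
    {w : SpaceTime d → E} (hw : LocallyIntegrable w) (hws : HasCompactSupport w) :
    IsTestFunction (mollify ρ w) := by
  rw [mollify_eq_convolution]
  exact ⟨hρ.2.contDiff_convolution_left _ hρ.1 hw, hρ.2.convolution _ hws⟩

theorem fderiv_mollify [CompleteSpace E] {ρ : SpaceTime d → ℝ} (hρ : IsTestFunction ρ)
    {w : SpaceTime d → E}
    (hw : LocallyIntegrable w) (q v : SpaceTime d) :
    fderiv ℝ (HyperbolicBVP.mollify ρ w) q v =
      HyperbolicBVP.mollify (fun s => fderiv ℝ ρ s v) w q := by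
  have h := hρ.2.hasFDerivAt_convolution_left (ContinuousLinearMap.lsmul ℝ ℝ)
    (hρ.1.of_le (by simp)) hw q
  rw [mollify_eq_convolution, h.fderiv, mollify_eq]
  rw [convolution_def, ContinuousLinearMap.integral_apply]
  · rfl
  · exact (hρ.2.fderiv ℝ).convolutionExists_left _ (hρ.1.continuous_fderiv (by simp)) hw q

theorem inner_mollify [CompleteSpace E] {ρ : SpaceTime d → ℝ} (hρ : IsTestFunction ρ)
    {w : SpaceTime d → E}
    (hw : LocallyIntegrable w) (q : SpaceTime d) (b : E) :
    inner ℂ b (HyperbolicBVP.mollify ρ w q) = ∫ q', inner ℂ (ρ (q - q') • b) (w q') := by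
  rw [HyperbolicBVP.mollify, ← integral_inner (integrable_mollify hρ.continuous hρ.2 hw q)]
  refine integral_congr_ae (Eventually.of_forall fun q' => ?_)
  simp only [← Complex.coe_smul, inner_smul_left, inner_smul_right, Complex.conj_ofReal]

end SmoothKernel

section WeakSolutions

variable {E : Type*} [NormedAddCommGroup E] [InnerProductSpace ℂ E]
  {E' : Type*} [NormedAddCommGroup E'] [InnerProductSpace ℂ E'] {d : ℕ}

/-- `w` is a weak solution of `(∑ a_j ∂_j + D ∂_x + γ S) w = F` in the half space, with the
homogeneous boundary condition `β D w = 0`. The condition on the pair `(φ, b)` is `D φ = (β D)ᴴ b`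
on the boundary, written without adjoints. The boundary operator is factored through `D`, which is
possible since `ker D ≤ ker B`. -/
def IsWeakSolutionOn (a : Fin d → E →L[ℂ] E) (D S : E →L[ℂ] E) (γ : ℝ) (β : E →L[ℂ] E')
    (F w : SpaceTime d → E) : Prop :=
  ∀ (φ : SpaceTime d → E) (b : Tangential d → E'), IsTestFunction φ → IsTestFunction b →
    (∀ z y, inner ℂ (D (φ (z, 0))) y = inner ℂ (b z) (β (D y))) →
    ∫ q in halfSpace d, inner ℂ (φ q) (F q) =
      ∫ q in halfSpace d, inner ℂ (diffOp (fun j => -a j) (-D) S γ φ q) (w q)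

theorem diffOp_smul_const {θ : SpaceTime d → ℝ} (hθ : Differentiable ℝ θ)
    (a : Fin d → E →L[ℂ] E) (D S : E →L[ℂ] E) (γ : ℝ) (b : E) (q : SpaceTime d) :
    diffOp a D S γ (fun q => θ q • b) q =
      (∑ j : Fin d, (fderiv ℝ θ q (EuclideanSpace.single j (1 : ℝ), 0)) • a j b) +
        (fderiv ℝ θ q (0, 1)) • D b + θ q • (γ : ℂ) • S b := by
  have h : ∀ v, fderiv ℝ (fun q => θ q • b) q v = fderiv ℝ θ q v • b := by
    intro v
    rw [fderiv_smul_const (hθ q)]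
    rfl
  simp only [diffOp, h]
  simp only [← Complex.coe_smul, map_smul]
  rw [smul_comm (γ : ℂ)]

/-- Mollification with a kernel supported in `{x < 0}` commutes with the operator up to the
boundary: for `q` in the closed half space, `ρ (q - ·)` vanishes on `{x ≤ 0}` and so is an
admissible test function. -/
theorem diffOp_mollify [FiniteDimensional ℂ E] {a : Fin d → E →L[ℂ] E} {D S : E →L[ℂ] E} {γ : ℝ}
    {β : E →L[ℂ] E'}
    (ha : ∀ j x y, inner ℂ (a j x) y = inner ℂ x (a j y))
    (hD : ∀ x y, inner ℂ (D x) y = inner ℂ x (D y))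
    (hS : ∀ x y, inner ℂ (S x) y = inner ℂ x (S y))
    {F w : SpaceTime d → E} (h : IsWeakSolutionOn a D S γ β F w)
    (hw : LocallyIntegrable w) (hF : LocallyIntegrable F)
    (hw0 : ∀ q, q ∉ halfSpace d → w q = 0) (hF0 : ∀ q, q ∉ halfSpace d → F q = 0)
    {ρ : SpaceTime d → ℝ} (hρ : IsTestFunction ρ) (hρ0 : ∀ z x, 0 ≤ x → ρ (z, x) = 0)
    {q : SpaceTime d} (hq : 0 ≤ q.2) :
    diffOp a D S γ (mollify ρ w) q = mollify ρ F q := by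
  have : CompleteSpace E := FiniteDimensional.complete ℂ E
  refine ext_inner_left ℂ fun b => ?_
  set θ : SpaceTime d → ℝ := fun q' => ρ (q - q') with hθ
  have hθt : IsTestFunction θ := ⟨hρ.1.comp (contDiff_const.sub contDiff_id),
    hρ.2.comp_homeomorph (Homeomorph.subLeft q)⟩
  have hθd : ∀ q' v, fderiv ℝ θ q' v = -fderiv ℝ ρ (q - q') v := by
    intro q' v
    have h1 : HasFDerivAt (fun q' => q - q') (-ContinuousLinearMap.id ℝ (SpaceTime d)) q' := by
      simpa using (hasFDerivAt_id q').const_sub q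
    have h2 : HasFDerivAt θ _ q' := HasFDerivAt.comp (f := fun q' => q - q') q'
      (hρ.differentiable (q - q')).hasFDerivAt h1
    rw [h2.fderiv]
    simp
  have key := h (fun q' => θ q' • b) (fun _ => 0)
    ⟨hθt.1.smul contDiff_const, hθt.2.smul_right⟩ IsTestFunction.zero (fun z y => by
      have : θ (z, 0) = 0 := hρ0 _ _ (by simpa using hq)
      simp [this])
  rw [setIntegral_eq_integral_of_forall_compl_eq_zero (fun q' hq' => by simp [hF0 q' hq']),
    setIntegral_eq_integral_of_forall_compl_eq_zero (fun q' hq' => by simp [hw0 q' hq'])] at key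
  rw [inner_mollify hρ hF, key]
  simp only [diffOp_smul_const hθt.differentiable, hθd, neg_apply, neg_smul_neg]
  simp only [diffOp, fderiv_mollify hρ hw, inner_add_right, inner_sum, inner_smul_right, ← ha,
    ← hD, ← hS]
  have hi : ∀ {κ : SpaceTime d → ℝ}, IsTestFunction κ → ∀ b : E,
      Integrable fun q' => inner ℂ (κ (q - q') • b) (w q') := by
    intro κ hκ b
    have := (integrable_mollify hκ.continuous hκ.2 hw q).const_inner (𝕜 := ℂ) b
    refine this.congr (Eventually.of_forall fun q' => ?_)
    simp only [← Complex.coe_smul, inner_smul_left, inner_smul_right, Complex.conj_ofReal]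
  simp only [inner_mollify (hρ.fderiv_apply _) hw, inner_mollify hρ hw, inner_add_left, sum_inner]
  rw [integral_add, integral_add, integral_finsetSum, ← integral_const_mul]
  · congr 2
    funext q'
    simp only [hθ, ← Complex.coe_smul, inner_smul_left, Complex.conj_ofReal]
    ring
  · exact fun j _ => hi (hρ.fderiv_apply _) _
  · exact integrable_finsetSum _ fun j _ => hi (hρ.fderiv_apply _) _
  · exact hi (hρ.fderiv_apply _) _
  · exact (integrable_finsetSum _ fun j _ => hi (hρ.fderiv_apply _) _).add
      (hi (hρ.fderiv_apply _) _)
  · exact hi hρ _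

end WeakSolutions

/-! ### Boundary values of one-sided mollifications -/

/-- A smooth cutoff `η` with `η 0 = 1` that vanishes for `x ≥ ε`, and whose derivative on the half
line is the negative of a mollifier `r` supported in `[0, ε]`. -/
theorem exists_boundary_cutoff {ε : ℝ} (hε : 0 < ε) (hε1 : ε ≤ 1) :
    ∃ η r : ℝ → ℝ, IsTestFunction η ∧ IsTestFunction r ∧ (∀ x, 0 ≤ r x) ∧ ∫ x, r x = 1 ∧
      η 0 = 1 ∧ (∀ x, |η x| ≤ 1) ∧ (∀ x, ε ≤ x → η x = 0) ∧ (∀ x, x ≤ 0 → r x = 0) ∧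
      (∀ x, ε ≤ x → r x = 0) ∧ ∀ x, 0 < x → deriv η x = -r x := by
  let f : ContDiffBump (ε / 2) := ⟨ε / 4, ε / 2, by linarith, by linarith⟩
  set r : ℝ → ℝ := f.normed volume with hr
  have hrt : IsTestFunction r := ⟨f.contDiff_normed, f.hasCompactSupport_normed⟩
  have hsupp : ∀ x, (x ≤ 0 ∨ ε ≤ x) → r x = 0 := by
    intro x hx
    have : x ∉ Function.support r := by
      rw [hr, f.support_normed_eq, Real.ball_eq_Ioo]
      simp only [Set.mem_Ioo, not_and, not_lt, f]
      rintro h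
      rcases hx with hx | hx <;> linarith
    simpa using this
  have hint : Integrable r := hrt.continuous.integrable_of_hasCompactSupport hrt.2
  have hone : ∫ x, r x = 1 := f.integral_normed
  set R : ℝ → ℝ := fun x => ∫ s in (0 : ℝ)..x, r s with hR
  have hRd : ∀ x, HasDerivAt R (r x) x := fun x =>
    intervalIntegral.integral_hasDerivAt_right (hrt.continuous.intervalIntegrable _ _)
      (hrt.continuous.stronglyMeasurableAtFilter _ _) hrt.continuous.continuousAt
  have hRs : ContDiff ℝ ∞ R := by
    rw [contDiff_infty_iff_deriv]
    refine ⟨fun x => (hRd x).differentiableAt, ?_⟩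
    rw [funext fun x => (hRd x).deriv]
    exact hrt.1
  have hR0 : ∀ x, x ≤ 0 → R x = 0 := fun x hx => by
    rw [hR]
    simp only
    rw [intervalIntegral.integral_of_ge hx, setIntegral_eq_zero_of_forall_eq_zero, neg_zero]
    exact fun s hs => hsupp s (Or.inl hs.2)
  have hR1 : ∀ x, ε ≤ x → R x = 1 := fun x hx => by
    rw [hR]
    simp only
    rw [intervalIntegral.integral_of_le (hε.le.trans hx), ← hone,
      setIntegral_eq_integral_of_forall_compl_eq_zero]
    intro s hs
    refine hsupp s ?_
    by_contra hcon
    push Not at hcon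
    exact hs ⟨hcon.1, by linarith⟩
  have hRm : Monotone R := monotone_of_deriv_nonneg (fun x => (hRd x).differentiableAt) fun x => by
    rw [(hRd x).deriv]; exact f.nonneg_normed x
  have hRb : ∀ x, 0 ≤ R x ∧ R x ≤ 1 := fun x => by
    constructor
    · rw [← hR0 (min x 0) (min_le_right _ _)]; exact hRm (min_le_left _ _)
    · rw [← hR1 (max x ε) (le_max_right _ _)]; exact hRm (le_max_left _ _)
  -- For `x ≥ 0` the first term is constant; it makes the support compact on the left.
  refine ⟨fun x => R (x + 2) - R x, r, ⟨?_, ?_⟩, hrt, fun x => f.nonneg_normed x, hone, ?_, ?_, ?_,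
    fun x hx => hsupp x (Or.inl hx), fun x hx => hsupp x (Or.inr hx), ?_⟩
  · exact (hRs.comp (contDiff_id.add contDiff_const)).sub hRs
  · refine HasCompactSupport.intro (isCompact_Icc (a := -2) (b := ε)) fun x hx => ?_
    rw [Set.mem_Icc, not_and_or, not_le, not_le] at hx
    rcases hx with hx | hx
    · rw [hR0 x (by linarith), hR0 (x + 2) (by linarith), sub_zero]
    · rw [hR1 x (by linarith), hR1 (x + 2) (by linarith), sub_self]
  · simp only
    rw [hR0 0 le_rfl, hR1 (0 + 2) (by linarith), sub_zero]
  · intro x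
    have h1 := hRb x
    have h2 := hRb (x + 2)
    exact abs_le.2 ⟨by linarith, by linarith⟩
  · intro x hx
    simp only
    rw [hR1 x hx, hR1 (x + 2) (by linarith), sub_self]
  · intro x hx
    have h1 := ((hRd (x + 2)).comp_add_const x 2).sub (hRd x)
    refine h1.deriv.trans ?_
    rw [hsupp (x + 2) (Or.inr (by linarith)), zero_sub]

section WeakSolutions

variable {E : Type*} [NormedAddCommGroup E] [InnerProductSpace ℂ E] [FiniteDimensional ℂ E]
  {E' : Type*} [NormedAddCommGroup E'] [InnerProductSpace ℂ E'] [FiniteDimensional ℂ E'] {d : ℕ}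

/-- The product kernel `(z, x) ↦ k z * r (-x)`, supported in `{x < 0}` when `r` is in `{x > 0}`. -/
def tensorKernel (k : Tangential d → ℝ) (r : ℝ → ℝ) (q : SpaceTime d) : ℝ := k q.1 * r (-q.2)

theorem IsTestFunction.tensorKernel {k : Tangential d → ℝ} {r : ℝ → ℝ} (hk : IsTestFunction k)
    (hr : IsTestFunction r) : IsTestFunction (tensorKernel k r) := by
  refine ⟨(hk.1.comp contDiff_fst).mul (hr.1.comp contDiff_snd.neg), ?_⟩
  refine HasCompactSupport.intro (hk.2.prod (hr.2.comp_homeomorph (Homeomorph.neg ℝ))) ?_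
  rintro ⟨z, x⟩ hq
  rw [Set.mem_prod, not_and_or] at hq
  rcases hq with h | h
  · have := image_eq_zero_of_notMem_tsupport h
    simp only at this
    simp [HyperbolicBVP.tensorKernel, this]
  · have := image_eq_zero_of_notMem_tsupport h
    simp only [Function.comp_apply, Homeomorph.coe_neg] at this
    simp [HyperbolicBVP.tensorKernel, this]

/-- The boundary values `β D (ρ * w)` of a one-sided mollification are small: the bound involves
only `F` and `w` within distance `ε` of the boundary, and no derivative of the normal kernel `r`.
The test function is the boundary layer `k (z - ·) η b`, where the normal derivative `-r` of `η`
reproduces the mollified boundary value. -/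
theorem IsWeakSolutionOn.norm_boundary_mollify_le {a : Fin d → E →L[ℂ] E} {D S : E →L[ℂ] E}
    {γ : ℝ} (hγ : 0 < γ)
    {β : E →L[ℂ] E'}
    (hD : ∀ x y, inner ℂ (D x) y = inner ℂ x (D y))
    {F w : SpaceTime d → E} (h : IsWeakSolutionOn a D S γ β F w)
    (hw : Integrable w) (hF : Integrable F)
    (hw0 : ∀ q, q ∉ halfSpace d → w q = 0)
    {k : Tangential d → ℝ} (hk : IsTestFunction k) {M : ℝ} (hM : ∀ z, |k z| ≤ M)
    (hM' : ∀ z, ‖fderiv ℝ k z‖ ≤ M) {ε : ℝ} {η r : ℝ → ℝ}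
    (hη : IsTestFunction η) (hr : IsTestFunction r) (hη0 : η 0 = 1) (hη1 : ∀ x, |η x| ≤ 1)
    (hηε : ∀ x, ε ≤ x → η x = 0) (hr0 : ∀ x, 0 < x → deriv η x = -r x) (z : Tangential d) :
    ‖β (D (mollify (tensorKernel k r) w (z, 0)))‖ ≤
      ‖β‖ * M * (1 + ∑ j, ‖a j‖ + γ * ‖S‖) *
        ∫ q in {q : SpaceTime d | 0 < q.2 ∧ q.2 < ε}, (‖F q‖ + ‖w q‖) := by
  have : CompleteSpace E := FiniteDimensional.complete ℂ E
  have : CompleteSpace E' := FiniteDimensional.complete ℂ E'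
  have hM0 : 0 ≤ M := (abs_nonneg _).trans (hM 0)
  set L := 1 + ∑ j, ‖a j‖ + γ * ‖S‖ with hL
  set I := ∫ q in {q : SpaceTime d | 0 < q.2 ∧ q.2 < ε}, (‖F q‖ + ‖w q‖) with hI
  have hI0 : 0 ≤ I := integral_nonneg fun q => by positivity
  have hL0 : 0 ≤ L := by positivity
  set c := β (D (mollify (tensorKernel k r) w (z, 0))) with hc
  set b := ContinuousLinearMap.adjoint β c with hb
  have hbc : ‖b‖ ≤ ‖β‖ * ‖c‖ := by
    refine ((ContinuousLinearMap.adjoint β).le_opNorm c).trans_eq ?_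
    rw [LinearIsometryEquiv.norm_map]
  set θ : SpaceTime d → ℝ := fun q => k (z - q.1) * η q.2 with hθ
  have hθt : IsTestFunction θ := by
    have h1 : IsTestFunction fun z' => k (z - z') :=
      ⟨hk.1.comp (contDiff_const.sub contDiff_id), hk.2.comp_homeomorph (Homeomorph.subLeft z)⟩
    refine ⟨(h1.1.comp contDiff_fst).mul (hη.1.comp contDiff_snd),
      HasCompactSupport.intro (h1.2.prod hη.2) ?_⟩
    rintro ⟨z', x⟩ hq
    rw [Set.mem_prod, not_and_or] at hq
    rcases hq with h | h <;> have := image_eq_zero_of_notMem_tsupport h <;>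
      simp only at this <;> simp [hθ, this]
  have hθd : ∀ q v, fderiv ℝ θ q v =
      -fderiv ℝ k (z - q.1) v.1 * η q.2 + k (z - q.1) * (deriv η q.2 * v.2) := by
    intro q v
    have h1 : HasFDerivAt (fun q : SpaceTime d => z - q.1)
        (-ContinuousLinearMap.fst ℝ (Tangential d) ℝ) q := by
      simpa using (hasFDerivAt_fst (𝕜 := ℝ) (p := q)).const_sub z
    have h2 := HasFDerivAt.comp (f := fun q : SpaceTime d => z - q.1) q
      (hk.differentiable (z - q.1)).hasFDerivAt h1
    have h3 := (hη.differentiable q.2).hasDerivAt.comp_hasFDerivAt q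
      (hasFDerivAt_snd (𝕜 := ℝ) (p := q))
    have h4 := (h2.mul h3).fderiv
    change fderiv ℝ θ q = _ at h4
    rw [h4]
    simp
    ring
  have key := h (fun q => θ q • b) (fun z' => k (z - z') • c)
    ⟨hθt.1.smul contDiff_const, hθt.2.smul_right⟩
    ⟨(hk.1.comp (contDiff_const.sub contDiff_id)).smul contDiff_const,
      (hk.2.comp_homeomorph (Homeomorph.subLeft z)).smul_right⟩ (fun z' y => by
      simp only [hθ, hη0, mul_one, ← Complex.coe_smul, map_smul, inner_smul_left,
        Complex.conj_ofReal]
      rw [hD, hb, ContinuousLinearMap.adjoint_inner_left])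
  -- the normal derivative of the cutoff reproduces the mollified boundary value
  set Φ : SpaceTime d → ℂ := fun q => inner ℂ (θ q • b) (F q) -
    inner ℂ ((∑ j, -(fderiv ℝ k (z - q.1) (EuclideanSpace.single j 1) * η q.2) • (-a j) b) +
      (θ q * γ) • S b) (w q) with hΦ
  have hsplit : ∀ q ∈ halfSpace d,
      inner ℂ (diffOp (fun j => -a j) (-D) S γ (fun q => θ q • b) q) (w q) =
      inner ℂ (θ q • b) (F q) - Φ q + inner ℂ (tensorKernel k r ((z, 0) - q) • D b) (w q) := by
    intro q hq
    rw [hΦ]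
    simp only [diffOp_smul_const hθt.differentiable, hθd, hr0 q.2 hq]
    rw [sub_sub_cancel, ← inner_add_left]
    congr 1
    simp only [tensorKernel, Prod.fst_sub, Prod.snd_sub, zero_sub, neg_neg, mul_one, mul_zero,
      add_zero, map_zero, neg_apply, neg_mul, zero_mul, neg_zero, mul_neg]
    rw [Complex.coe_smul, zero_add, neg_smul_neg, smul_smul]
    abel
  have hkr : ∀ q : SpaceTime d, |θ q| ≤ M := fun q => by
    rw [hθ]
    simp only [abs_mul]
    calc |k (z - q.1)| * |η q.2| ≤ M * 1 :=
          mul_le_mul (hM _) (hη1 _) (abs_nonneg _) hM0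
      _ = M := mul_one M
  have hΦb : ∀ q, ‖Φ q‖ ≤ ‖β‖ * M * L * ‖c‖ * (‖F q‖ + ‖w q‖) := by
    intro q
    have e1 : ‖inner ℂ (θ q • b) (F q)‖ ≤ M * ‖b‖ * ‖F q‖ := by
      refine (norm_inner_le_norm _ _).trans ?_
      rw [norm_smul, Real.norm_eq_abs]
      gcongr
      exact hkr q
    have e2 : ‖(∑ j, -(fderiv ℝ k (z - q.1) (EuclideanSpace.single j 1) * η q.2) • (-a j) b) +
      (θ q * γ) • S b‖ ≤ M * (L - 1) * ‖b‖ := by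
      have e3 : ∀ j, ‖-(fderiv ℝ k (z - q.1) (EuclideanSpace.single j 1) * η q.2) • (-a j) b‖ ≤
          M * ‖a j‖ * ‖b‖ := by
        intro j
        rw [norm_smul, neg_apply, norm_neg, norm_neg, mul_assoc]
        refine mul_le_mul ?_ ((a j).le_opNorm b) (norm_nonneg _) hM0
        have e4 : ‖fderiv ℝ k (z - q.1) (EuclideanSpace.single j 1)‖ ≤ M := by
          refine ((fderiv ℝ k (z - q.1)).le_opNorm _).trans ?_
          simpa using hM' (z - q.1)
        rw [norm_mul]
        calc _ ≤ M * 1 := mul_le_mul e4 (hη1 _) (abs_nonneg _) hM0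
          _ = M := mul_one M
      refine (norm_add_le _ _).trans ?_
      refine (add_le_add (d := M * γ * (‖S‖ * ‖b‖))
        ((norm_sum_le _ _).trans (Finset.sum_le_sum fun j _ => e3 j)) ?_).trans_eq ?_
      · rw [norm_smul, norm_mul, Real.norm_eq_abs, Real.norm_eq_abs, abs_of_pos hγ]
        gcongr
        · exact hkr q
        · exact S.le_opNorm b
      · rw [hL, ← Finset.sum_mul, ← Finset.mul_sum]
        ring
    have e5 : 1 ≤ L := by
      have : 0 ≤ ∑ j, ‖a j‖ + γ * ‖S‖ := by positivity
      linarith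
    have e6 : ‖Φ q‖ ≤ M * ‖b‖ * ‖F q‖ + M * (L - 1) * ‖b‖ * ‖w q‖ := by
      refine (norm_sub_le _ _).trans (add_le_add e1 ((norm_inner_le_norm _ _).trans ?_))
      gcongr
    have e7 : M * ‖b‖ * ‖F q‖ + M * (L - 1) * ‖b‖ * ‖w q‖ ≤ M * L * ‖b‖ * (‖F q‖ + ‖w q‖) := by
      have h1 : 0 ≤ M * ‖b‖ * ‖w q‖ := by positivity
      have h2 : 0 ≤ M * ‖b‖ * ‖F q‖ * (L - 1) :=
        mul_nonneg (by positivity) (by linarith)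
      nlinarith
    refine e6.trans (e7.trans ?_)
    calc M * L * ‖b‖ * (‖F q‖ + ‖w q‖) ≤ M * L * (‖β‖ * ‖c‖) * (‖F q‖ + ‖w q‖) := by gcongr
      _ = _ := by ring
  have hmeas : MeasurableSet {q : SpaceTime d | 0 < q.2 ∧ q.2 < ε} :=
    (measurableSet_lt measurable_const measurable_snd).inter
      (measurableSet_lt measurable_snd measurable_const)
  have hθL : ∀ {κ : SpaceTime d → ℝ}, IsTestFunction κ → ∀ (b : E) {v : SpaceTime d → E},
      Integrable v → Integrable fun q => inner ℂ (κ q • b) (v q) := by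
    intro κ hκ b v hv
    have := (hv.locallyIntegrable.integrable_smul_left_of_hasCompactSupport hκ.continuous
      hκ.2).const_inner (𝕜 := ℂ) b
    refine this.congr (Eventually.of_forall fun q' => ?_)
    simp only [← Complex.coe_smul, inner_smul_left, inner_smul_right, Complex.conj_ofReal]
  have hk3 : IsTestFunction fun q' => tensorKernel k r ((z, 0) - q') :=
    ⟨(hk.tensorKernel hr).1.comp (contDiff_const.sub contDiff_id),
      (hk.tensorKernel hr).2.comp_homeomorph (Homeomorph.subLeft ((z, 0) : SpaceTime d))⟩
  have hΦi : Integrable Φ := by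
    refine ((hF.norm.add hw.norm).const_mul _).mono' ?_ (Eventually.of_forall hΦb)
    have h1 : Continuous (fderiv ℝ k) := hk.1.continuous_fderiv (by simp)
    have h2 := hη.continuous
    have h3 := hθt.continuous
    exact ((h3.smul continuous_const).aestronglyMeasurable.inner hF.1).sub
      (Continuous.aestronglyMeasurable (by fun_prop) |>.inner hw.1)
  have hH : MeasurableSet (halfSpace d) := measurableSet_lt measurable_const measurable_snd
  rw [setIntegral_congr_fun hH hsplit,
    integral_add, integral_sub] at key
  · have h5 : ∫ q in halfSpace d, inner ℂ (tensorKernel k r ((z, 0) - q) • D b) (w q) =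
        ((‖c‖ ^ 2 : ℝ) : ℂ) := by
      rw [setIntegral_eq_integral_of_forall_compl_eq_zero (fun q' hq' => by simp [hw0 q' hq']),
        ← inner_mollify (hk.tensorKernel hr) hw.locallyIntegrable, hD, hb,
        ContinuousLinearMap.adjoint_inner_left, ← hc, inner_self_eq_norm_sq_to_K]
      simp
    rw [h5] at key
    have h6 : ((‖c‖ ^ 2 : ℝ) : ℂ) = ∫ q in halfSpace d, Φ q := by linear_combination -key
    have h7 : ‖c‖ ^ 2 ≤ ‖β‖ * M * L * ‖c‖ * I := by
      have h8 := congrArg norm h6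
      rw [Complex.norm_real, Real.norm_eq_abs, abs_of_nonneg (by positivity)] at h8
      rw [h8, setIntegral_eq_of_subset_of_forall_sdiff_eq_zero
        hH (s := {q : SpaceTime d | 0 < q.2 ∧ q.2 < ε}) (fun q hq => hq.1)]
      · refine (norm_integral_le_integral_norm _).trans ?_
        rw [hI, ← integral_const_mul]
        exact integral_mono hΦi.norm.integrableOn
          ((hF.norm.add hw.norm).const_mul _).integrableOn hΦb
      · rintro q ⟨h1, h2⟩
        have : η q.2 = 0 := hηε _ (by
          by_contra hcon
          exact h2 ⟨h1, not_le.1 hcon⟩)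
        simp [hΦ, hθ, this]
    rcases eq_or_lt_of_le (norm_nonneg c) with h9 | h9
    · rw [← h9]; positivity
    · nlinarith
  · exact (hθL hθt b hF).integrableOn
  · exact hΦi.integrableOn
  · exact ((hθL hθt b hF).sub hΦi).integrableOn
  · exact (hθL hk3 (D b) hw).integrableOn

end WeakSolutions

/-! ### Weak solutions are strong, and the energy estimate for them -/

theorem measurableSet_halfSpace (d : ℕ) : MeasurableSet (halfSpace d) :=
  measurableSet_lt measurable_const measurable_snd

theorem MemLp.integrable_of_hasCompactSupport {X F : Type*} [TopologicalSpace X] [T2Space X]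
    [MeasurableSpace X] [OpensMeasurableSpace X] {μ : Measure X} [IsFiniteMeasureOnCompacts μ]
    [NormedAddCommGroup F] {v : X → F} (hv : MemLp v 2 μ) (hc : HasCompactSupport v) :
    Integrable v μ := by
  have hfin : IsFiniteMeasure (μ.restrict (tsupport v)) :=
    ⟨by simpa using (show IsCompact (tsupport v) from hc).measure_lt_top⟩
  rw [← integrableOn_iff_integrable_of_support_subset (subset_tsupport v)]
  exact (hv.restrict _).integrable (by norm_num)

theorem integral_norm_sq_eq {α F : Type*} [MeasurableSpace α] [NormedAddCommGroup F]
    {ν : Measure α} {f : α → F} (hf : MemLp f 2 ν) :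
    ∫ x, ‖f x‖ ^ 2 ∂ν = (eLpNorm f 2 ν).toReal ^ 2 := by
  rw [← ENNReal.toReal_pow, eLpNorm_two_sq, integral_eq_lintegral_of_nonneg_ae
    (f := fun x => ‖f x‖ ^ 2)
    (Eventually.of_forall fun x => sq_nonneg _) (hf.1.norm.pow 2)]
  congr 1
  refine lintegral_congr fun x => ?_
  rw [ENNReal.ofReal_pow (norm_nonneg _), ofReal_norm]

theorem tendsto_integral_boundary_strip {d : ℕ} {f : SpaceTime d → ℝ} (hf : Integrable f) :
    Tendsto (fun n : ℕ => ∫ q in {q : SpaceTime d | 0 < q.2 ∧ q.2 < 1 / ((n : ℝ) + 1)}, f q)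
      atTop (𝓝 0) := by
  have h1 := tendsto_setIntegral_of_antitone (μ := volume) (f := f)
    (s := fun n : ℕ => {q : SpaceTime d | 0 < q.2 ∧ q.2 < 1 / ((n : ℝ) + 1)})
    (fun n => (measurableSet_lt measurable_const measurable_snd).inter
      (measurableSet_lt measurable_snd measurable_const)) (fun m n hmn q hq =>
        ⟨hq.1, hq.2.trans_le (Nat.one_div_le_one_div hmn)⟩) ⟨0, hf.integrableOn⟩
  have h2 : ⋂ n : ℕ, {q : SpaceTime d | 0 < q.2 ∧ q.2 < 1 / ((n : ℝ) + 1)} = ∅ := by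
    refine Set.eq_empty_iff_forall_notMem.2 fun q hq => ?_
    rw [Set.mem_iInter] at hq
    obtain ⟨n, hn⟩ := exists_nat_one_div_lt (hq 0).1
    exact absurd (hq n).2 (not_lt.2 hn.le)
  rwa [h2, setIntegral_empty] at h1

section WeakSolutions

variable {E : Type*} [NormedAddCommGroup E] [InnerProductSpace ℂ E] [FiniteDimensional ℂ E]
  {E' : Type*} [NormedAddCommGroup E'] [InnerProductSpace ℂ E'] [FiniteDimensional ℂ E'] {d : ℕ}

/-- A compactly supported weak solution is the limit of test functions `v`, with convergence of the
source and with `β D v → 0` on the boundary. The tangential kernel `k` is fixed by the accuracy in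
the interior; the normal kernel is then made thin enough for the boundary values, whose bound
depends on `k` but not on the thickness. -/
theorem IsWeakSolutionOn.exists_approx {a : Fin d → E →L[ℂ] E} {D S : E →L[ℂ] E} {γ : ℝ}
    (hγ : 0 < γ) {β : E →L[ℂ] E'}
    (ha : ∀ j x y, inner ℂ (a j x) y = inner ℂ x (a j y))
    (hD : ∀ x y, inner ℂ (D x) y = inner ℂ x (D y))
    (hS : ∀ x y, inner ℂ (S x) y = inner ℂ x (S y))
    {F w : SpaceTime d → E} (h : IsWeakSolutionOn a D S γ β F w)
    (hw : MemLp w 2 volume) (hF : MemLp F 2 volume)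
    (hw0 : ∀ q, q ∉ halfSpace d → w q = 0) (hF0 : ∀ q, q ∉ halfSpace d → F q = 0)
    (hwc : HasCompactSupport w) (hFc : HasCompactSupport F) {ε : ℝ} (hε : 0 < ε) :
    ∃ v, IsTestFunction v ∧
      eLpNorm (fun q => v q - w q) 2 (volume.restrict (halfSpace d)) ≤ ENNReal.ofReal ε ∧
      eLpNorm (fun q => diffOp a D S γ v q - F q) 2 (volume.restrict (halfSpace d)) ≤
        ENNReal.ofReal ε ∧
      ∫ z, ‖β (D (v (z, 0)))‖ ^ 2 ≤ ε := by
  have : CompleteSpace E := FiniteDimensional.complete ℂ E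
  have hwi := MemLp.integrable_of_hasCompactSupport hw hwc
  have hFi := MemLp.integrable_of_hasCompactSupport hF hFc
  obtain ⟨δ₁, hδ₁, h1⟩ := eLpNorm_mollify_sub_le hw hε
  obtain ⟨δ₂, hδ₂, h2⟩ := eLpNorm_mollify_sub_le hF hε
  set δ := min (min δ₁ δ₂) 1 with hδ
  have hδ0 : 0 < δ := lt_min (lt_min hδ₁ hδ₂) one_pos
  let f : ContDiffBump (0 : Tangential d) := ⟨δ / 2, δ, by linarith, by linarith⟩
  set k : Tangential d → ℝ := f.normed volume with hk
  have hkt : IsTestFunction k := ⟨f.contDiff_normed, f.hasCompactSupport_normed⟩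
  have hk0 : ∀ z, δ ≤ ‖z‖ → k z = 0 := by
    intro z hz
    have : z ∉ Function.support k := by
      rw [hk, f.support_normed_eq, mem_ball_zero_iff]
      exact not_lt.2 hz
    simpa using this
  obtain ⟨M₁, hM₁⟩ := hkt.2.exists_bound_of_continuous hkt.continuous
  obtain ⟨M₂, hM₂⟩ := (hkt.2.fderiv ℝ).exists_bound_of_continuous
    (hkt.1.continuous_fderiv (by simp))
  set M := max M₁ M₂
  obtain ⟨R, hR⟩ := hwc.isBounded.exists_norm_le
  set V := (volume (Metric.closedBall (0 : Tangential d) (R + 1))).toReal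
  set L := ‖β‖ * M * (1 + ∑ j, ‖a j‖ + γ * ‖S‖)
  have hlim : Tendsto (fun n : ℕ => V * (L *
      ∫ q in {q : SpaceTime d | 0 < q.2 ∧ q.2 < 1 / ((n : ℝ) + 1)}, (‖F q‖ + ‖w q‖)) ^ 2)
      atTop (𝓝 0) := by
    have := (((tendsto_integral_boundary_strip (hFi.norm.add hwi.norm)).const_mul L).pow
      2).const_mul V
    simpa using this
  obtain ⟨n, hn, hnδ⟩ := ((hlim.eventually_le_const hε).and
    (tendsto_one_div_add_atTop_nhds_zero_nat.eventually_le_const hδ0)).exists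
  obtain ⟨η, r, hη, hr, hr0, hr1, hη0, hη1, hηε, hrn, hrε, hηr⟩ :=
    exists_boundary_cutoff (ε := 1 / ((n : ℝ) + 1)) (by positivity)
      (hnδ.trans (min_le_right _ _))
  set ρ := tensorKernel k r with hρ
  have hρt : IsTestFunction ρ := hkt.tensorKernel hr
  have hρ0 : ∀ s, 0 ≤ ρ s := fun s => mul_nonneg (f.nonneg_normed _) (hr0 _)
  have hρ1 : ∫ s, ρ s = 1 := by
    have : ∫ s, ρ s = (∫ z, k z) * ∫ x, r (-x) :=
      integral_prod_mul (μ := volume) (ν := volume) k fun x => r (-x)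
    rw [this, integral_neg_eq_self, hr1, f.integral_normed, one_mul]
  have hρδ : ∀ s, δ ≤ ‖s‖ → ρ s = 0 := by
    rintro ⟨z, x⟩ hs
    rw [Prod.norm_def, le_max_iff] at hs
    rcases hs with hs | hs
    · simp [hρ, tensorKernel, hk0 z hs]
    · have : r (-x) = 0 := by
        rcases le_or_gt 0 x with hx | hx
        · exact hrn _ (by linarith)
        · simp only [Real.norm_eq_abs, abs_of_neg hx] at hs
          exact hrε _ (hnδ.trans hs)
      simp [hρ, tensorKernel, this]
  have hδ12 : δ ≤ δ₁ ∧ δ ≤ δ₂ := le_min_iff.1 (min_le_left _ _)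
  have hρx : ∀ z x, 0 ≤ x → ρ (z, x) = 0 := fun z x hx => by
    simp [hρ, tensorKernel, hrn (-x) (by linarith)]
  have e1 := h1 ρ hρt.continuous hρt.2 hρ0 hρ1 fun s hs => hρδ s (hδ12.1.trans hs)
  have e2 := h2 ρ hρt.continuous hρt.2 hρ0 hρ1 fun s hs => hρδ s (hδ12.2.trans hs)
  simp only [← mollify_eq] at e1 e2
  refine ⟨mollify ρ w, hρt.mollify hwi.locallyIntegrable hwc,
    (eLpNorm_mono_measure _ Measure.restrict_le_self).trans e1, ?_, ?_⟩
  · refine (le_of_eq ?_).trans ((eLpNorm_mono_measure _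
      (Measure.restrict_le_self (s := halfSpace d))).trans e2)
    refine eLpNorm_congr_ae ?_
    filter_upwards [ae_restrict_mem (measurableSet_halfSpace d)] with q hq
    rw [diffOp_mollify ha hD hS h hwi.locallyIntegrable hFi.locallyIntegrable hw0 hF0 hρt hρx
      (le_of_lt hq)]
  · have hb : ∀ z, ‖β (D (mollify ρ w (z, 0)))‖ ≤ L *
        ∫ q in {q : SpaceTime d | 0 < q.2 ∧ q.2 < 1 / ((n : ℝ) + 1)}, (‖F q‖ + ‖w q‖) := fun z =>
      h.norm_boundary_mollify_le hγ hD hwi hFi hw0 hkt (fun z => (hM₁ z).trans (le_max_left _ _))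
        (fun z => (hM₂ z).trans (le_max_right _ _)) hη hr hη0 hη1 hηε hηr z
    have hz : ∀ z, z ∉ Metric.closedBall (0 : Tangential d) (R + 1) →
        ‖β (D (mollify ρ w (z, 0)))‖ ^ 2 = 0 := by
      intro z hz
      rw [mem_closedBall_zero_iff, not_le] at hz
      have : mollify ρ w (z, 0) = 0 := by
        refine integral_eq_zero_of_ae (Eventually.of_forall fun q => ?_)
        simp only [Pi.zero_apply]
        by_cases hq : w q = 0
        · rw [hq, smul_zero]
        · have h3 := (norm_fst_le q).trans (hR q (subset_tsupport _ hq))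
          have h4 : ‖z‖ ≤ ‖z - q.1‖ + ‖q.1‖ := by simpa using norm_add_le (z - q.1) q.1
          have h5 : δ ≤ 1 := min_le_right _ _
          have h6 : k (z - q.1) = 0 := hk0 _ (by linarith)
          simp [hρ, tensorKernel, h6]
      simp [this]
    refine le_trans ?_ hn
    rw [← setIntegral_eq_integral_of_forall_compl_eq_zero hz]
    have hfin : IsFiniteMeasure (volume.restrict (Metric.closedBall (0 : Tangential d) (R + 1))) :=
      ⟨by simpa using measure_closedBall_lt_top⟩
    have hvt : IsTestFunction (mollify ρ w) := hρt.mollify hwi.locallyIntegrable hwc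
    have hvs := integrable_slice_norm_sq (hvt.clm_comp ((β ∘L D).restrictScalars ℝ)) 0
    refine (integral_mono hvs.integrableOn (integrable_const _) fun z =>
      pow_le_pow_left₀ (norm_nonneg _) (hb z) 2).trans_eq ?_
    rw [integral_const, smul_eq_mul, measureReal_restrict_apply_univ]
    rfl

/-- The a priori estimate for compactly supported weak solutions with zero boundary data. -/
theorem IsWeakSolutionOn.energy_estimate {a : Fin d → E →L[ℂ] E} {D S : E →L[ℂ] E} {C γ : ℝ}
    (hγ : 0 < γ) (hC : 0 ≤ C) {β : E →L[ℂ] E'}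
    (ha : ∀ j x y, inner ℂ (a j x) y = inner ℂ x (a j y))
    (hD : ∀ x y, inner ℂ (D x) y = inner ℂ x (D y))
    (hS : ∀ x y, inner ℂ (S x) y = inner ℂ x (S y))
    (hest : HalfLineEstimate a D S (β ∘L D) C γ)
    {F w : SpaceTime d → E} (h : IsWeakSolutionOn a D S γ β F w)
    (hw : MemLp w 2 volume) (hF : MemLp F 2 volume)
    (hw0 : ∀ q, q ∉ halfSpace d → w q = 0) (hF0 : ∀ q, q ∉ halfSpace d → F q = 0)
    (hwc : HasCompactSupport w) (hFc : HasCompactSupport F) :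
    γ * (∫ q in halfSpace d, ‖w q‖ ^ 2) ≤ C * (γ⁻¹ * ∫ q in halfSpace d, ‖F q‖ ^ 2) := by
  set ν := (volume : Measure (SpaceTime d)).restrict (halfSpace d) with hν
  have hwν : MemLp w 2 ν := hw.restrict _
  have hFν : MemLp F 2 ν := hF.restrict _
  rw [integral_norm_sq_eq hwν, integral_norm_sq_eq hFν]
  set W := (eLpNorm w 2 ν).toReal with hW
  set Φ := (eLpNorm F 2 ν).toReal with hΦ
  have hkey : ∀ ε > 0, W ≤ √(γ⁻¹ * (C * (γ⁻¹ * (Φ + ε) ^ 2 + ε))) + ε := by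
    intro ε hε
    obtain ⟨v, hv, h1, h2, h3⟩ := h.exists_approx hγ ha hD hS hw hF hw0 hF0 hwc hFc hε
    have hvν : MemLp v 2 ν := hv.memLp 2
    have hLν : MemLp (diffOp a D S γ v) 2 ν := (hv.diffOp a D S γ).memLp 2
    have h4 := hest.energy_estimate hv
    rw [← hν, integral_norm_sq_eq hvν, integral_norm_sq_eq hLν] at h4
    have h5 : W ≤ (eLpNorm v 2 ν).toReal + ε := by
      have e1 : eLpNorm w 2 ν ≤ eLpNorm v 2 ν + ENNReal.ofReal ε := by
        calc eLpNorm w 2 ν = eLpNorm (v - fun q => v q - w q) 2 ν := by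
              congr 1; funext q; simp
          _ ≤ eLpNorm v 2 ν + eLpNorm (fun q => v q - w q) 2 ν :=
              eLpNorm_sub_le hvν.1 (hvν.1.sub hwν.1) (by norm_num)
          _ ≤ _ := by gcongr
      have e2 := ENNReal.toReal_mono (by finiteness [hvν.2.ne]) e1
      rwa [ENNReal.toReal_add hvν.2.ne ENNReal.ofReal_ne_top, ENNReal.toReal_ofReal hε.le] at e2
    have h6 : (eLpNorm (diffOp a D S γ v) 2 ν).toReal ≤ Φ + ε := by
      have e1 : eLpNorm (diffOp a D S γ v) 2 ν ≤ eLpNorm F 2 ν + ENNReal.ofReal ε := by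
        calc eLpNorm (diffOp a D S γ v) 2 ν =
              eLpNorm (F + fun q => diffOp a D S γ v q - F q) 2 ν := by
              congr 1; funext q; simp
          _ ≤ eLpNorm F 2 ν + eLpNorm (fun q => diffOp a D S γ v q - F q) 2 ν :=
              eLpNorm_add_le hFν.1 (hLν.1.sub hFν.1) (by norm_num)
          _ ≤ _ := by gcongr
      have e2 := ENNReal.toReal_mono (by finiteness [hFν.2.ne]) e1
      rwa [ENNReal.toReal_add hFν.2.ne ENNReal.ofReal_ne_top, ENNReal.toReal_ofReal hε.le] at e2
    have h7 : (eLpNorm v 2 ν).toReal ≤ √(γ⁻¹ * (C * (γ⁻¹ * (Φ + ε) ^ 2 + ε))) := by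
      refine Real.le_sqrt_of_sq_le ?_
      rw [← div_eq_inv_mul, le_div_iff₀' hγ]
      have h8 : 0 ≤ ∫ z, ‖D (v (z, 0))‖ ^ 2 := integral_nonneg fun z => by positivity
      have h9 : (eLpNorm (diffOp a D S γ v) 2 ν).toReal ^ 2 ≤ (Φ + ε) ^ 2 :=
        pow_le_pow_left₀ ENNReal.toReal_nonneg h6 2
      calc γ * (eLpNorm v 2 ν).toReal ^ 2 ≤ C * (γ⁻¹ *
            (eLpNorm (diffOp a D S γ v) 2 ν).toReal ^ 2 + ∫ z, ‖β (D (v (z, 0)))‖ ^ 2) :=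
            (le_add_of_nonneg_right h8).trans h4
        _ ≤ _ := by gcongr
    linarith
  have hlim : Tendsto (fun ε : ℝ => √(γ⁻¹ * (C * (γ⁻¹ * (Φ + ε) ^ 2 + ε))) + ε) (𝓝[>] 0)
      (𝓝 (√(γ⁻¹ * (C * (γ⁻¹ * (Φ + 0) ^ 2 + 0))) + 0)) :=
    (Continuous.tendsto (by fun_prop) 0).mono_left nhdsWithin_le_nhds
  have h1 : W ≤ √(γ⁻¹ * (C * (γ⁻¹ * (Φ + 0) ^ 2 + 0))) + 0 :=
    ge_of_tendsto hlim (by filter_upwards [self_mem_nhdsWithin] with ε hε using hkey ε hε)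
  rw [add_zero, add_zero, add_zero] at h1
  have h3 : W ^ 2 ≤ γ⁻¹ * (C * (γ⁻¹ * Φ ^ 2)) := by
    have h4 := pow_le_pow_left₀ ENNReal.toReal_nonneg h1 2
    rwa [Real.sq_sqrt (by positivity)] at h4
  rwa [← div_eq_inv_mul, le_div_iff₀' hγ] at h3

end WeakSolutions

/-! ### Locally square integrable functions -/

section LocallySquareIntegrable

variable {X F : Type*} [TopologicalSpace X]
  [MeasurableSpace X] [NormedAddCommGroup F] {μ : Measure X}

theorem MemL2loc.sub {v w : X → F} (hv : MemL2loc v μ) (hw : MemL2loc w μ) :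
    MemL2loc (fun x => v x - w x) μ := fun K hK => (hv K hK).sub (hw K hK)

variable [LocallyCompactSpace X]

theorem MemL2loc.locallyIntegrable_norm_sq {v : X → F} (hv : MemL2loc v μ) :
    LocallyIntegrable (fun x => ‖v x‖ ^ 2) μ :=
  locallyIntegrable_iff.2 fun K hK => (hv K hK).integrable_norm_pow two_ne_zero

theorem MemL2loc.locallyIntegrable [IsFiniteMeasureOnCompacts μ] {v : X → F}
    (hv : MemL2loc v μ) : LocallyIntegrable v μ := by
  refine locallyIntegrable_iff.2 fun K hK => ?_
  have : IsFiniteMeasure (μ.restrict K) := ⟨by simpa using hK.measure_lt_top⟩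
  exact (hv K hK).integrable (by norm_num)

theorem MemL2loc.aestronglyMeasurable [SecondCountableTopology X] [IsFiniteMeasureOnCompacts μ]
    {v : X → F} (hv : MemL2loc v μ) : AEStronglyMeasurable v μ :=
  hv.locallyIntegrable.aestronglyMeasurable

theorem MemL2loc.memLp_clm_apply [T2Space X] [OpensMeasurableSpace X] [SecondCountableTopology X]
    [IsFiniteMeasureOnCompacts μ] {E G : Type*}
    [NormedAddCommGroup E] [NormedSpace ℂ E] [NormedAddCommGroup G] [NormedSpace ℂ G]
    {v : X → E} (hv : MemL2loc v μ) {L : X → E →L[ℂ] G} (hL : Continuous L)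
    (hc : HasCompactSupport L) : MemLp (fun x => L x (v x)) 2 μ := by
  obtain ⟨M, hM⟩ := hc.exists_bound_of_continuous hL
  have hm : AEStronglyMeasurable (fun x => L x (v x)) μ := by
    have hb : Continuous fun p : (E →L[ℂ] G) × E => p.1 p.2 := isBoundedBilinearMap_apply.continuous
    exact hb.comp_aestronglyMeasurable (hL.aestronglyMeasurable.prodMk hv.aestronglyMeasurable)
  have hK : MeasurableSet (tsupport L) := (isClosed_tsupport L).measurableSet
  have h1 : MemLp (fun x => L x (v x)) 2 (μ.restrict (tsupport L)) :=
    (hv _ hc).of_le_mul (c := M) hm.restrict (Eventually.of_forall fun x =>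
      ((L x).le_opNorm _).trans (by gcongr; exact hM x))
  rw [← memLp_indicator_iff_restrict hK] at h1
  refine h1.congr_norm hm (Eventually.of_forall fun x => ?_)
  by_cases hx : x ∈ tsupport L
  · rw [Set.indicator_of_mem hx]
  · rw [Set.indicator_of_notMem hx, image_eq_zero_of_notMem_tsupport hx]
    simp

theorem MemL2loc.integrable_inner [T2Space X] [OpensMeasurableSpace X]
    [SecondCountableTopology X] [IsFiniteMeasureOnCompacts μ] {E : Type*}
    [NormedAddCommGroup E] [InnerProductSpace ℂ E] {v φ : X → E} (hv : MemL2loc v μ)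
    (hφ : Continuous φ) (hc : HasCompactSupport φ) :
    Integrable (fun x => inner ℂ (φ x) (v x)) μ := by
  have hn : LocallyIntegrable (fun x => ‖v x‖) μ := fun x => (hv.locallyIntegrable x).norm
  have h1 := hn.integrable_smul_left_of_hasCompactSupport hφ.norm hc.norm
  refine h1.mono' (hφ.aestronglyMeasurable.inner hv.aestronglyMeasurable)
    (Eventually.of_forall fun x => norm_inner_le_norm _ _)

end LocallySquareIntegrable

/-! ### Weighted estimates for homogeneous weak solutions -/

section WeakSolutions

variable {E : Type*} [NormedAddCommGroup E] [InnerProductSpace ℂ E]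
  {E' : Type*} [NormedAddCommGroup E'] [InnerProductSpace ℂ E'] {d : ℕ}

/-- The principal symbol `∑ ℓ_j a_j + ℓ_x D` at the real covector `ℓ`. -/
def principalPart (a : Fin d → E →L[ℂ] E) (D : E →L[ℂ] E) (l : SpaceTime d →L[ℝ] ℝ) :
    E →L[ℂ] E :=
  (∑ j, ((l (EuclideanSpace.single j (1 : ℝ), 0) : ℝ) : ℂ) • a j) + ((l (0, 1) : ℝ) : ℂ) • D

theorem principalPart_sub (a : Fin d → E →L[ℂ] E) (D : E →L[ℂ] E) (l m : SpaceTime d →L[ℝ] ℝ) :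
    principalPart a D (l - m) = principalPart a D l - principalPart a D m := by
  simp only [principalPart, sub_apply, Complex.ofReal_sub, sub_smul, Finset.sum_sub_distrib]
  abel

theorem principalPart_smul (a : Fin d → E →L[ℂ] E) (D : E →L[ℂ] E) (c : ℝ)
    (l : SpaceTime d →L[ℝ] ℝ) :
    principalPart a D (c • l) = (c : ℂ) • principalPart a D l := by
  simp only [principalPart, smul_apply, smul_eq_mul, Complex.ofReal_mul, mul_smul, smul_add,
    Finset.smul_sum]

theorem norm_principalPart_le (a : Fin d → E →L[ℂ] E) (D : E →L[ℂ] E)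
    (l : SpaceTime d →L[ℝ] ℝ) :
    ‖principalPart a D l‖ ≤ (∑ j, ‖a j‖ + ‖D‖) * ‖l‖ := by
  have h1 : ∀ j, ‖l (EuclideanSpace.single j (1 : ℝ), 0)‖ ≤ ‖l‖ := fun j => by
    refine (l.le_opNorm _).trans ?_
    simp [Prod.norm_def]
  have h2 : ‖l (0, 1)‖ ≤ ‖l‖ := by
    refine (l.le_opNorm _).trans ?_
    simp [Prod.norm_def]
  refine (norm_add_le _ _).trans ?_
  rw [add_mul, Finset.sum_mul]
  refine add_le_add ((norm_sum_le _ _).trans (Finset.sum_le_sum fun j _ => ?_)) ?_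
  · rw [norm_smul, Complex.norm_real, mul_comm]
    gcongr
    exact h1 j
  · rw [norm_smul, Complex.norm_real, mul_comm]
    gcongr

theorem continuous_principalPart (a : Fin d → E →L[ℂ] E) (D : E →L[ℂ] E) :
    Continuous (principalPart a D) := by
  unfold principalPart
  fun_prop

theorem diffOp_smul {θ : SpaceTime d → ℝ} (hθ : Differentiable ℝ θ) {φ : SpaceTime d → E}
    (hφ : Differentiable ℝ φ) (a : Fin d → E →L[ℂ] E) (D S : E →L[ℂ] E) (γ : ℝ)
    (q : SpaceTime d) :
    diffOp a D S γ (fun q => θ q • φ q) q =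
      (θ q : ℂ) • diffOp a D S γ φ q + principalPart a D (fderiv ℝ θ q) (φ q) := by
  have h : ∀ v, fderiv ℝ (fun q => θ q • φ q) q v =
      (θ q : ℂ) • fderiv ℝ φ q v + ((fderiv ℝ θ q v : ℝ) : ℂ) • φ q := by
    intro v
    have h1 := (((hθ q).hasFDerivAt).smul (hφ q).hasFDerivAt).fderiv
    rw [show fderiv ℝ (fun q => θ q • φ q) q = _ from h1]
    simp [Complex.coe_smul]
  simp only [diffOp, h, principalPart, map_add, map_smul, Finset.sum_add_distrib, add_apply,
    sum_apply, smul_apply, smul_add, ← Finset.smul_sum, ← Complex.coe_smul (θ q)]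
  rw [smul_comm (γ : ℂ)]
  abel

theorem IsWeakSolutionOn.indicator {a : Fin d → E →L[ℂ] E} {D S : E →L[ℂ] E} {γ : ℝ}
    {β : E →L[ℂ] E'} {F w : SpaceTime d → E} (h : IsWeakSolutionOn a D S γ β F w) :
    IsWeakSolutionOn a D S γ β ((halfSpace d).indicator F) ((halfSpace d).indicator w) := by
  intro φ b hφ hb hφb
  have e1 := setIntegral_congr_fun (μ := volume) (measurableSet_halfSpace d)
    (f := fun q => inner ℂ (φ q) ((halfSpace d).indicator F q))
    (g := fun q => inner ℂ (φ q) (F q)) fun q hq => by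
      simp only [Set.indicator_of_mem hq]
  have e2 := setIntegral_congr_fun (μ := volume) (measurableSet_halfSpace d)
    (f := fun q => inner ℂ (diffOp (fun j => -a j) (-D) S γ φ q) ((halfSpace d).indicator w q))
    (g := fun q => inner ℂ (diffOp (fun j => -a j) (-D) S γ φ q) (w q)) fun q hq => by
      simp only [Set.indicator_of_mem hq]
  rw [e1, e2]
  exact h φ b hφ hb hφb

/-- If `w` is a homogeneous weak solution with `γ = 0`, then `θ w` is a weak solution for the weight
`γ` with a source that involves `w` only: the derivatives fall on `θ`. -/
theorem IsWeakSolutionOn.localize {a : Fin d → E →L[ℂ] E} {D S : E →L[ℂ] E}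
    {β : E →L[ℂ] E'}
    (ha : ∀ j x y, inner ℂ (a j x) y = inner ℂ x (a j y))
    (hD : ∀ x y, inner ℂ (D x) y = inner ℂ x (D y))
    (hS : ∀ x y, inner ℂ (S x) y = inner ℂ x (S y))
    {w : SpaceTime d → E} (h : IsWeakSolutionOn a D S 0 β 0 w)
    (hw : MemL2loc w (volume.restrict (halfSpace d))) {θ : SpaceTime d → ℝ}
    (hθ : IsTestFunction θ) (γ : ℝ) :
    IsWeakSolutionOn a D S γ β
      (fun q => (principalPart a D (fderiv ℝ θ q) + ((γ * θ q : ℝ) : ℂ) • S) (w q))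
      (fun q => (θ q : ℂ) • w q) := by
  intro φ b hφ hb hφb
  have h1 : IsTestFunction fun q => θ q • φ q := IsTestFunction.smul hθ.1 hφ
  have hb' : IsTestFunction fun z => θ (z, 0) • b z := IsTestFunction.smul (hθ.slice 0).1 hb
  have key := h _ _ h1 hb' fun z y => by
    simp only [← Complex.coe_smul, map_smul, inner_smul_left, hφb]
  have hL := hφ.diffOp (fun j => -a j) (-D) S γ
  have hL0 := h1.diffOp (fun j => -a j) (-D) S 0
  have hθL : IsTestFunction fun q => θ q • diffOp (fun j => -a j) (-D) S γ φ q :=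
    IsTestFunction.smul hθ.1 hL
  have hpt : ∀ q, inner ℂ (φ q)
      ((principalPart a D (fderiv ℝ θ q) + ((γ * θ q : ℝ) : ℂ) • S) (w q)) =
      inner ℂ (θ q • diffOp (fun j => -a j) (-D) S γ φ q) (w q) -
        inner ℂ (diffOp (fun j => -a j) (-D) S 0 (fun q => θ q • φ q) q) (w q) := by
    intro q
    have h2 : diffOp (fun j => -a j) (-D) S γ φ q =
        diffOp (fun j => -a j) (-D) S 0 φ q + (γ : ℂ) • S (φ q) := by
      simp [diffOp]
    have h3 : principalPart (fun j => -a j) (-D) (fderiv ℝ θ q) (φ q) =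
        -principalPart a D (fderiv ℝ θ q) (φ q) := by
      simp only [principalPart, add_apply, sum_apply, smul_apply, neg_apply, smul_neg,
        Finset.sum_neg_distrib, neg_add]
    have h4 : inner ℂ (principalPart a D (fderiv ℝ θ q) (φ q)) (w q) =
        inner ℂ (φ q) (principalPart a D (fderiv ℝ θ q) (w q)) := by
      simp only [principalPart, add_apply, sum_apply, smul_apply, inner_add_left, inner_add_right,
        sum_inner, inner_sum, inner_smul_left, inner_smul_right, Complex.conj_ofReal, ha, hD]
    rw [diffOp_smul hθ.differentiable hφ.differentiable, h2, h3, add_apply, inner_add_right,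
      inner_add_left, inner_neg_left, h4, ← Complex.coe_smul, smul_add, inner_add_left]
    simp only [smul_apply, inner_smul_left, inner_smul_right, Complex.conj_ofReal, hS,
      Complex.ofReal_mul]
    ring
  rw [integral_congr_ae (Eventually.of_forall hpt), integral_sub
    (hw.integrable_inner hθL.continuous hθL.2) (hw.integrable_inner hL0.continuous hL0.2), ← key]
  simp only [Pi.zero_apply, inner_zero_right, integral_zero, sub_zero]
  refine integral_congr_ae (Eventually.of_forall fun q => ?_)
  simp only [← Complex.coe_smul, inner_smul_left, inner_smul_right, Complex.conj_ofReal]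

/-- For `θ = χ e^{-ψ}` the source is `e^{-ψ} p(∇χ) w - χ e^{-ψ} (p(∇ψ) - γ S) w`, with `p` the
principal part. The second term is small when `∇ψ` is close to `γ dt` and `S = a_0 = p(dt)`. -/
theorem norm_localized_source_sq_le {a : Fin d → E →L[ℂ] E} {D S : E →L[ℂ] E} {γ κ : ℝ}
    {χ ψ : SpaceTime d → ℝ} (hχ : Differentiable ℝ χ) (hψ : Differentiable ℝ ψ)
    (hκ : ∀ q, ‖principalPart a D (fderiv ℝ ψ q) - (γ : ℂ) • S‖ ≤ κ * γ) (q : SpaceTime d)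
    (x : E) :
    ‖(principalPart a D (fderiv ℝ (fun q => χ q * Real.exp (-ψ q)) q) +
        ((γ * (χ q * Real.exp (-ψ q)) : ℝ) : ℂ) • S) x‖ ^ 2 ≤
      2 * (∑ j, ‖a j‖ + ‖D‖) ^ 2 * ((Real.exp (-ψ q) * ‖fderiv ℝ χ q‖) ^ 2 * ‖x‖ ^ 2) +
        2 * (κ * γ) ^ 2 * ((χ q * Real.exp (-ψ q)) ^ 2 * ‖x‖ ^ 2) := by
  set m := ∑ j, ‖a j‖ + ‖D‖
  set e := Real.exp (-ψ q) with he
  have h1 : fderiv ℝ (fun q => χ q * Real.exp (-ψ q)) q =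
      e • fderiv ℝ χ q - (χ q * e) • fderiv ℝ ψ q := by
    have h2 := (hχ q).hasFDerivAt.mul (hψ q).hasFDerivAt.neg.exp
    rw [show fderiv ℝ (fun q => χ q * Real.exp (-ψ q)) q = _ from h2.fderiv]
    ext v <;> simp [← he] <;> ring
  have h2 : principalPart a D (fderiv ℝ (fun q => χ q * Real.exp (-ψ q)) q) +
      ((γ * (χ q * e) : ℝ) : ℂ) • S = (e : ℂ) • principalPart a D (fderiv ℝ χ q) -
        ((χ q * e : ℝ) : ℂ) • (principalPart a D (fderiv ℝ ψ q) - (γ : ℂ) • S) := by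
    rw [h1, principalPart_sub, principalPart_smul, principalPart_smul, smul_sub, smul_smul,
      Complex.ofReal_mul γ, mul_comm (γ : ℂ)]
    abel
  have h3 : ‖(principalPart a D (fderiv ℝ (fun q => χ q * Real.exp (-ψ q)) q) +
      ((γ * (χ q * e) : ℝ) : ℂ) • S) x‖ ≤ m * (e * ‖fderiv ℝ χ q‖ * ‖x‖) +
      κ * γ * (|χ q * e| * ‖x‖) := by
    rw [h2, sub_apply]
    refine (norm_sub_le _ _).trans (add_le_add ?_ ?_)
    · rw [smul_apply, norm_smul, Complex.norm_real, Real.norm_of_nonneg (Real.exp_pos _).le]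
      have := ((principalPart a D (fderiv ℝ χ q)).le_opNorm x).trans
        (mul_le_mul_of_nonneg_right (norm_principalPart_le a D _) (norm_nonneg _))
      calc _ ≤ e * (m * ‖fderiv ℝ χ q‖ * ‖x‖) :=
            mul_le_mul_of_nonneg_left this (Real.exp_pos _).le
        _ = _ := by ring
    · rw [smul_apply, norm_smul, Complex.norm_real, Real.norm_eq_abs]
      have := ((principalPart a D (fderiv ℝ ψ q) - (γ : ℂ) • S).le_opNorm x).trans
        (mul_le_mul_of_nonneg_right (hκ q) (norm_nonneg _))
      calc _ ≤ |χ q * e| * (κ * γ * ‖x‖) := mul_le_mul_of_nonneg_left this (abs_nonneg _)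
        _ = _ := by ring
  refine (pow_le_pow_left₀ (norm_nonneg _) h3 2).trans ((add_sq_le).trans_eq ?_)
  rw [← sq_abs (χ q * e)]
  ring

theorem IsTestFunction.memLp_localized_source {a : Fin d → E →L[ℂ] E} {D S : E →L[ℂ] E} {γ : ℝ}
    {w : SpaceTime d → E} (hw : MemL2loc w (volume.restrict (halfSpace d)))
    {θ : SpaceTime d → ℝ} (hθ : IsTestFunction θ) :
    MemLp (fun q => (principalPart a D (fderiv ℝ θ q) + ((γ * θ q : ℝ) : ℂ) • S) (w q)) 2
      (volume.restrict (halfSpace d)) := by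
  refine hw.memLp_clm_apply ?_ ?_
  · have hcθ : Continuous (fderiv ℝ θ) := hθ.1.continuous_fderiv (by simp)
    have hc := hθ.continuous
    have := continuous_principalPart a D
    fun_prop
  · refine HasCompactSupport.add ?_ ?_
    · exact (hθ.2.fderiv ℝ).comp_left (g := principalPart a D) (by simp [principalPart])
    · exact hθ.2.comp_left (g := fun t : ℝ => ((γ * t : ℝ) : ℂ) • S) (by simp)

theorem IsWeakSolutionOn.localized_energy_estimate [FiniteDimensional ℂ E]
    [FiniteDimensional ℂ E'] {a : Fin d → E →L[ℂ] E} {D S : E →L[ℂ] E} {C γ : ℝ}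
    (hγ : 0 < γ) (hC : 0 ≤ C) {β : E →L[ℂ] E'}
    (ha : ∀ j x y, inner ℂ (a j x) y = inner ℂ x (a j y))
    (hD : ∀ x y, inner ℂ (D x) y = inner ℂ x (D y))
    (hS : ∀ x y, inner ℂ (S x) y = inner ℂ x (S y))
    (hest : HalfLineEstimate a D S (β ∘L D) C γ)
    {w : SpaceTime d → E} (h : IsWeakSolutionOn a D S 0 β 0 w)
    (hw : MemL2loc w (volume.restrict (halfSpace d))) {θ : SpaceTime d → ℝ}
    (hθ : IsTestFunction θ) :
    γ ^ 2 * (∫ q in halfSpace d, θ q ^ 2 * ‖w q‖ ^ 2) ≤ C * ∫ q in halfSpace d,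
      ‖(principalPart a D (fderiv ℝ θ q) + ((γ * θ q : ℝ) : ℂ) • S) (w q)‖ ^ 2 := by
  have hsol := (h.localize ha hD hS hw hθ γ).indicator
  have hm1 := hθ.memLp_localized_source (a := a) (D := D) (S := S) (γ := γ) hw
  set F : SpaceTime d → E :=
    fun q => (principalPart a D (fderiv ℝ θ q) + ((γ * θ q : ℝ) : ℂ) • S) (w q) with hF
  have hθc := hθ.continuous
  have hm2 : MemLp (fun q => (θ q : ℂ) • w q) 2 (volume.restrict (halfSpace d)) :=
    hw.memLp_clm_apply (L := fun q => (θ q : ℂ) • ContinuousLinearMap.id ℂ E) (by fun_prop)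
      (hθ.2.comp_left (g := fun t : ℝ => (t : ℂ) • ContinuousLinearMap.id ℂ E) (by simp))
  have hc1 : HasCompactSupport ((halfSpace d).indicator fun q => (θ q : ℂ) • w q) := by
    refine HasCompactSupport.intro hθ.2 fun q hq => ?_
    refine Set.indicator_apply_eq_zero.2 fun _ => ?_
    rw [image_eq_zero_of_notMem_tsupport hq, Complex.ofReal_zero, zero_smul]
  have hc2 : HasCompactSupport ((halfSpace d).indicator F) := by
    refine HasCompactSupport.intro hθ.2 fun q hq => ?_
    have h2 : fderiv ℝ θ q = 0 := by
      by_contra h3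
      exact hq (support_fderiv_subset ℝ h3)
    refine Set.indicator_apply_eq_zero.2 fun _ => ?_
    simp [hF, image_eq_zero_of_notMem_tsupport hq, h2, principalPart]
  have key := hsol.energy_estimate hγ hC ha hD hS hest
    ((memLp_indicator_iff_restrict (measurableSet_halfSpace d)).2 hm2)
    ((memLp_indicator_iff_restrict (measurableSet_halfSpace d)).2 hm1)
    (fun q hq => Set.indicator_of_notMem hq _) (fun q hq => Set.indicator_of_notMem hq _) hc1 hc2
  have e1 := setIntegral_congr_fun (μ := volume) (measurableSet_halfSpace d)
    (f := fun q => ‖(halfSpace d).indicator (fun q => (θ q : ℂ) • w q) q‖ ^ 2)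
    (g := fun q => θ q ^ 2 * ‖w q‖ ^ 2) fun q hq => by
      simp only [Set.indicator_of_mem hq]
      rw [norm_smul, Complex.norm_real, mul_pow, Real.norm_eq_abs, sq_abs]
  have e2 := setIntegral_congr_fun (μ := volume) (measurableSet_halfSpace d)
    (f := fun q => ‖(halfSpace d).indicator F q‖ ^ 2)
    (g := fun q => ‖F q‖ ^ 2) fun q hq => by
      simp only [Set.indicator_of_mem hq]
  rw [e1, e2] at key
  calc γ ^ 2 * _ = γ * (γ * _) := by rw [sq, mul_assoc]
    _ ≤ _ := mul_le_mul_of_nonneg_left key hγ.le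
    _ = C * ∫ q in halfSpace d, ‖F q‖ ^ 2 := by field_simp

theorem MemL2loc.integrable_mul_norm_sq {E : Type*} [NormedAddCommGroup E] {w : SpaceTime d → E}
    (hw : MemL2loc w (volume.restrict (halfSpace d))) {g : SpaceTime d → ℝ} (hg : Continuous g)
    (hc : HasCompactSupport g) :
    Integrable (fun q => g q * ‖w q‖ ^ 2) (volume.restrict (halfSpace d)) :=
  hw.locallyIntegrable_norm_sq.integrable_smul_left_of_hasCompactSupport hg hc

/-- The weighted estimate for homogeneous weak solutions: if `∇ψ` is close to `γ dt` in the sense of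
`hκ`, then `χ e^{-ψ} w` is controlled by `w` on the support of `∇χ`. The remaining part of the
source is absorbed by `hκC`. -/
theorem IsWeakSolutionOn.weighted_estimate [FiniteDimensional ℂ E] [FiniteDimensional ℂ E']
    {a : Fin d → E →L[ℂ] E} {D S : E →L[ℂ] E} {C γ κ : ℝ}
    (hγ : 0 < γ) (hC : 0 ≤ C) {β : E →L[ℂ] E'}
    (ha : ∀ j x y, inner ℂ (a j x) y = inner ℂ x (a j y))
    (hD : ∀ x y, inner ℂ (D x) y = inner ℂ x (D y))
    (hS : ∀ x y, inner ℂ (S x) y = inner ℂ x (S y))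
    (hest : HalfLineEstimate a D S (β ∘L D) C γ)
    {w : SpaceTime d → E} (h : IsWeakSolutionOn a D S 0 β 0 w)
    (hw : MemL2loc w (volume.restrict (halfSpace d))) {χ ψ : SpaceTime d → ℝ}
    (hχ : IsTestFunction χ) (hψ : ContDiff ℝ ∞ ψ)
    (hκ : ∀ q, ‖principalPart a D (fderiv ℝ ψ q) - (γ : ℂ) • S‖ ≤ κ * γ)
    (hκC : 4 * C * κ ^ 2 ≤ 1) :
    γ ^ 2 * (∫ q in halfSpace d, (χ q * Real.exp (-ψ q)) ^ 2 * ‖w q‖ ^ 2) ≤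
      4 * C * (∑ j, ‖a j‖ + ‖D‖) ^ 2 *
        ∫ q in halfSpace d, (Real.exp (-ψ q) * ‖fderiv ℝ χ q‖) ^ 2 * ‖w q‖ ^ 2 := by
  set m := ∑ j, ‖a j‖ + ‖D‖
  have hexp : ContDiff ℝ ∞ fun q => Real.exp (-ψ q) := Real.contDiff_exp.comp hψ.neg
  have hθ : IsTestFunction fun q => χ q * Real.exp (-ψ q) :=
    ⟨hχ.1.mul hexp, hχ.2.mul_right⟩
  have hFb := fun q => norm_localized_source_sq_le (S := S) hχ.differentiable
    (hψ.differentiable (by simp)) hκ q (w q)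
  have hcχ : Continuous (fderiv ℝ χ) := hχ.1.continuous_fderiv (by simp)
  have hce := hexp.continuous
  have hcθ := hθ.continuous
  have i1 := hw.integrable_mul_norm_sq (g := fun q => (Real.exp (-ψ q) * ‖fderiv ℝ χ q‖) ^ 2)
    (by fun_prop) (HasCompactSupport.intro (hχ.2.fderiv ℝ) fun q hq => by
      simp [image_eq_zero_of_notMem_tsupport hq])
  have i2 := hw.integrable_mul_norm_sq (g := fun q => (χ q * Real.exp (-ψ q)) ^ 2)
    (by fun_prop) (HasCompactSupport.intro hχ.2 fun q hq => by
      simp [image_eq_zero_of_notMem_tsupport hq])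
  have hm1 := hθ.memLp_localized_source (a := a) (D := D) (S := S) (γ := γ) hw
  have key := h.localized_energy_estimate hγ hC ha hD hS hest hw hθ
  have h5 := integral_mono (hm1.integrable_norm_pow two_ne_zero)
      ((i1.const_mul _).add (i2.const_mul _)) hFb
  simp only [Pi.add_apply] at h5
  rw [integral_add (i1.const_mul _) (i2.const_mul _), integral_const_mul,
    integral_const_mul] at h5
  set I := ∫ q in halfSpace d, (χ q * Real.exp (-ψ q)) ^ 2 * ‖w q‖ ^ 2
  set J := ∫ q in halfSpace d, (Real.exp (-ψ q) * ‖fderiv ℝ χ q‖) ^ 2 * ‖w q‖ ^ 2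
  have hI : 0 ≤ I := integral_nonneg fun q => by positivity
  have h8 := key.trans (mul_le_mul_of_nonneg_left h5 hC)
  have h9 : 4 * C * κ ^ 2 * (γ ^ 2 * I) ≤ 1 * (γ ^ 2 * I) := by gcongr
  linarith

end WeakSolutions

/-! ### Uniqueness -/

/-- The covector `dt`. -/
def timeForm (d : ℕ) [NeZero d] : SpaceTime d →L[ℝ] ℝ :=
  (EuclideanSpace.proj (0 : Fin d)).comp (ContinuousLinearMap.fst ℝ (Tangential d) ℝ)

theorem timeForm_apply {d : ℕ} [NeZero d] (q : SpaceTime d) : timeForm d q = q.1 0 := rfl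

/-- Compactly supported cutoffs that tend to `1` pointwise and whose gradients tend to zero
uniformly. -/
theorem exists_cutoff_sequence {V : Type*} [NormedAddCommGroup V] [NormedSpace ℝ V]
    [FiniteDimensional ℝ V] :
    ∃ (χ : ℕ → V → ℝ) (c : ℝ), (∀ n, IsTestFunction (χ n)) ∧ (∀ n q, |χ n q| ≤ 1) ∧
      (∀ n q, ‖fderiv ℝ (χ n) q‖ ≤ c * (1 / ((n : ℝ) + 1))) ∧
      ∀ q, Tendsto (fun n => χ n q) atTop (𝓝 1) := by
  let f : ContDiffBump (0 : V) := ⟨1, 2, one_pos, one_lt_two⟩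
  have hf : IsTestFunction f := ⟨f.contDiff, f.hasCompactSupport⟩
  obtain ⟨c, hc⟩ := (hf.2.fderiv ℝ).exists_bound_of_continuous (hf.1.continuous_fderiv (by simp))
  have hn : ∀ n : ℕ, (1 : ℝ) / ((n : ℝ) + 1) ≠ 0 := fun n => by positivity
  refine ⟨fun n q => f ((1 / ((n : ℝ) + 1)) • q), c, fun n => ⟨hf.1.comp (contDiff_const_smul _),
    hf.2.comp_homeomorph (Homeomorph.smulOfNeZero _ (hn n))⟩, fun n q => ?_, fun n q => ?_,
    fun q => ?_⟩
  · rw [abs_of_nonneg f.nonneg]; exact f.le_one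
  · have h1 : HasFDerivAt (fun q : V => (1 / ((n : ℝ) + 1)) • q)
        ((1 / ((n : ℝ) + 1)) • ContinuousLinearMap.id ℝ V) q := (hasFDerivAt_id q).const_smul _
    have h2 := (HasFDerivAt.comp (f := fun q : V => (1 / ((n : ℝ) + 1)) • q) q
      (hf.differentiable _).hasFDerivAt h1).fderiv
    rw [show fderiv ℝ (fun q => f ((1 / ((n : ℝ) + 1)) • q)) q = _ from h2]
    rw [ContinuousLinearMap.comp_smul, ContinuousLinearMap.comp_id, norm_smul, mul_comm,
      Real.norm_of_nonneg (by positivity)]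
    gcongr
    exact hc _
  · have h1 : Tendsto (fun n : ℕ => (1 / ((n : ℝ) + 1)) • q) atTop (𝓝 ((0 : ℝ) • q)) :=
      tendsto_one_div_add_atTop_nhds_zero_nat.smul_const q
    rw [zero_smul] at h1
    have h2 := (f.continuous.tendsto 0).comp h1
    rwa [f.one_of_mem_closedBall (by simp [f])] at h2

/-- The function `√(1 + |z|² + x²)`: smooth, proper, with bounded gradient. -/
def properWeight {d : ℕ} (q : SpaceTime d) : ℝ := √(1 + ‖q.1‖ ^ 2 + q.2 ^ 2)

theorem contDiff_properWeight {d : ℕ} : ContDiff ℝ ∞ (properWeight (d := d)) := by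
  refine ContDiff.sqrt ?_ fun q => by positivity
  exact (contDiff_const.add (contDiff_fst.norm_sq ℝ)).add (contDiff_snd.pow 2)

theorem norm_le_properWeight {d : ℕ} (q : SpaceTime d) : ‖q‖ ≤ properWeight q := by
  rw [Prod.norm_def]
  refine max_le (Real.le_sqrt_of_sq_le ?_) (Real.le_sqrt_of_sq_le ?_)
  · nlinarith [sq_nonneg q.2]
  · rw [Real.norm_eq_abs, sq_abs]
    nlinarith [sq_nonneg ‖q.1‖]

theorem norm_fderiv_properWeight_le {d : ℕ} (q : SpaceTime d) :
    ‖fderiv ℝ properWeight q‖ ≤ 2 := by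
  have h0 : 0 < properWeight q := Real.sqrt_pos.2 (by positivity)
  refine ContinuousLinearMap.opNorm_le_bound _ (by norm_num) fun v => ?_
  have h1 : HasFDerivAt (fun q : SpaceTime d => 1 + ‖q.1‖ ^ 2 + q.2 ^ 2) _ q :=
    ((hasFDerivAt_fst (𝕜 := ℝ) (p := q)).norm_sq.const_add 1).add
      ((hasFDerivAt_snd (𝕜 := ℝ) (p := q)).pow 2)
  have h2 := (h1.sqrt (by positivity)).fderiv
  rw [show fderiv ℝ properWeight q = _ from h2]
  have h3 : ‖q.1‖ ≤ properWeight q := (norm_fst_le q).trans (norm_le_properWeight q)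
  have h4 : |q.2| ≤ properWeight q := (norm_snd_le q).trans (norm_le_properWeight q)
  have h5 : ‖v.1‖ ≤ ‖v‖ := norm_fst_le v
  have h6 : |v.2| ≤ ‖v‖ := norm_snd_le v
  have h7 : |inner ℝ q.1 v.1 + q.2 * v.2| ≤ properWeight q * (2 * ‖v‖) := by
    refine (abs_add_le _ _).trans ?_
    rw [abs_mul]
    have e1 := abs_real_inner_le_norm q.1 v.1
    have e2 : ‖q.1‖ * ‖v.1‖ ≤ properWeight q * ‖v‖ := by gcongr
    have e3 : |q.2| * |v.2| ≤ properWeight q * ‖v‖ := by gcongr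
    linarith
  rw [Real.norm_eq_abs]
  have h8 : ∀ L : SpaceTime d →L[ℝ] ℝ, L v = 2 * (inner ℝ q.1 v.1 + q.2 * v.2) →
      |((1 / (2 * √(1 + ‖q.1‖ ^ 2 + q.2 ^ 2))) • L) v| ≤ 2 * ‖v‖ := by
    intro L hL
    have e : ((1 / (2 * √(1 + ‖q.1‖ ^ 2 + q.2 ^ 2))) • L) v =
        (inner ℝ q.1 v.1 + q.2 * v.2) / properWeight q := by
      rw [smul_apply, hL, properWeight, smul_eq_mul]
      field_simp
    rw [e, abs_div, abs_of_pos h0, div_le_iff₀' h0]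
    exact h7
  refine h8 _ ?_
  simp
  ring

section Uniqueness

variable {E : Type*} [NormedAddCommGroup E] [InnerProductSpace ℂ E] [FiniteDimensional ℂ E]
  {E' : Type*} [NormedAddCommGroup E'] [InnerProductSpace ℂ E'] [FiniteDimensional ℂ E'] {d : ℕ}
  [NeZero d]

theorem principalPart_timeForm {E : Type*} [NormedAddCommGroup E] [InnerProductSpace ℂ E]
    (a : Fin d → E →L[ℂ] E) (D : E →L[ℂ] E) :
    principalPart a D (timeForm d) = a 0 := by
  simp only [principalPart, timeForm_apply]
  rw [Finset.sum_eq_single 0]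
  · simp
  · intro j _ hj
    simp [hj.symm]
  · simp

theorem norm_principalPart_sub_le {E : Type*} [NormedAddCommGroup E] [InnerProductSpace ℂ E]
    (a : Fin d → E →L[ℂ] E) (D : E →L[ℂ] E) {γ δ : ℝ} {l : SpaceTime d →L[ℝ] ℝ}
    (hl : ‖l - γ • timeForm d‖ ≤ δ * γ) :
    ‖principalPart a D l - (γ : ℂ) • a 0‖ ≤ (∑ j, ‖a j‖ + ‖D‖) * δ * γ := by
  rw [← principalPart_timeForm a D, ← principalPart_smul, ← principalPart_sub, mul_assoc]
  exact (norm_principalPart_le a D _).trans (by gcongr)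

theorem ae_eq_zero_of_integral_mul_norm_sq_le {E : Type*} [NormedAddCommGroup E]
    {α : Type*} [MeasurableSpace α] {ν : Measure α}
    {w : α → E} {g : α → ℝ} (hg : ∀ x, 0 ≤ g x)
    (hi : Integrable (fun x => g x * ‖w x‖ ^ 2) ν) (h : ∫ x, g x * ‖w x‖ ^ 2 ∂ν ≤ 0) :
    ∀ᵐ x ∂ν, g x ≠ 0 → w x = 0 := by
  have h0 : 0 ≤ fun x => g x * ‖w x‖ ^ 2 := fun x => mul_nonneg (hg x) (sq_nonneg _)
  have h1 := (integral_eq_zero_iff_of_nonneg h0 hi).1 (le_antisymm h (integral_nonneg h0))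
  filter_upwards [h1] with x hx hgx
  simpa [hgx] using hx

/-- A homogeneous weak solution that is square integrable with weight `e^{-ψ}` vanishes, if `∇ψ` is
close to `γ dt`: the cutoffs in the weighted estimate are sent to `1`. -/
theorem IsWeakSolutionOn.eq_zero_of_integrable {a : Fin d → E →L[ℂ] E} {D : E →L[ℂ] E}
    {C γ δ : ℝ} (hγ : 0 < γ) (hC : 0 ≤ C) {β : E →L[ℂ] E'}
    (ha : ∀ j x y, inner ℂ (a j x) y = inner ℂ x (a j y))
    (hD : ∀ x y, inner ℂ (D x) y = inner ℂ x (D y))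
    (hest : HalfLineEstimate a D (a 0) (β ∘L D) C γ)
    {w : SpaceTime d → E} (h : IsWeakSolutionOn a D (a 0) 0 β 0 w)
    (hw : MemL2loc w (volume.restrict (halfSpace d))) {ψ : SpaceTime d → ℝ}
    (hψ : ContDiff ℝ ∞ ψ) (hψδ : ∀ q, ‖fderiv ℝ ψ q - γ • timeForm d‖ ≤ δ * γ)
    (hδ : 4 * C * ((∑ j, ‖a j‖ + ‖D‖) * δ) ^ 2 ≤ 1)
    (hint : Integrable (fun q => Real.exp (-ψ q) ^ 2 * ‖w q‖ ^ 2)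
      (volume.restrict (halfSpace d))) :
    ∀ᵐ q ∂(volume.restrict (halfSpace d)), w q = 0 := by
  obtain ⟨χ, c, hχ, hχ1, hχc, hχlim⟩ := exists_cutoff_sequence (V := SpaceTime d)
  set ν := (volume : Measure (SpaceTime d)).restrict (halfSpace d)
  set J := ∫ q, Real.exp (-ψ q) ^ 2 * ‖w q‖ ^ 2 ∂ν
  set K := 4 * C * (∑ j, ‖a j‖ + ‖D‖) ^ 2
  have hK : 0 ≤ K := by positivity
  have hce : Continuous fun q => Real.exp (-ψ q) := by
    have := hψ.continuous
    fun_prop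
  have h1 : ∀ n : ℕ, γ ^ 2 * (∫ q, (χ n q * Real.exp (-ψ q)) ^ 2 * ‖w q‖ ^ 2 ∂ν) ≤
      K * ((c * (1 / ((n : ℝ) + 1))) ^ 2 * J) := by
    intro n
    refine (h.weighted_estimate hγ hC ha hD (ha 0) hest hw (hχ n) hψ
      (fun q => norm_principalPart_sub_le a D (hψδ q)) hδ).trans ?_
    refine mul_le_mul_of_nonneg_left ?_ hK
    rw [← integral_const_mul]
    refine integral_mono_of_nonneg (Eventually.of_forall fun q => by positivity)
      (hint.const_mul _) (Eventually.of_forall fun q => ?_)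
    simp only
    rw [mul_pow, mul_comm (Real.exp (-ψ q) ^ 2), mul_assoc]
    have := pow_le_pow_left₀ (norm_nonneg _) (hχc n q) 2
    gcongr
  have h2 : Tendsto (fun n => γ ^ 2 * (∫ q, (χ n q * Real.exp (-ψ q)) ^ 2 * ‖w q‖ ^ 2 ∂ν)) atTop
      (𝓝 (γ ^ 2 * J)) := by
    refine Tendsto.const_mul _ ?_
    refine tendsto_integral_of_dominated_convergence
      (fun q => Real.exp (-ψ q) ^ 2 * ‖w q‖ ^ 2) (fun n => ?_) hint (fun n => ?_) ?_
    · have := (hχ n).continuous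
      exact (Continuous.aestronglyMeasurable (by fun_prop)).mul
        (hw.aestronglyMeasurable.norm.pow 2)
    · refine Eventually.of_forall fun q => ?_
      rw [Real.norm_of_nonneg (by positivity), mul_pow, ← sq_abs (χ n q)]
      have := pow_le_one₀ (n := 2) (abs_nonneg _) (hχ1 n q)
      calc |χ n q| ^ 2 * Real.exp (-ψ q) ^ 2 * ‖w q‖ ^ 2 ≤
          1 * Real.exp (-ψ q) ^ 2 * ‖w q‖ ^ 2 := by gcongr
        _ = _ := by rw [one_mul]
    · refine Eventually.of_forall fun q => ?_
      have := (((hχlim q).mul_const (Real.exp (-ψ q))).pow 2).mul_const (‖w q‖ ^ 2)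
      simpa using this
  have h3 : Tendsto (fun n : ℕ => K * ((c * (1 / ((n : ℝ) + 1))) ^ 2 * J)) atTop (𝓝 0) := by
    have := (((tendsto_one_div_add_atTop_nhds_zero_nat (𝕜 := ℝ)).const_mul c).pow
      2).mul_const J |>.const_mul K
    simpa using this
  have h4 : γ ^ 2 * J ≤ 0 := le_of_tendsto_of_tendsto' h2 h3 h1
  have h5 : J ≤ 0 := by
    by_contra hJ
    rw [not_le] at hJ
    have : 0 < γ ^ 2 * J := by positivity
    linarith
  filter_upwards [ae_eq_zero_of_integral_mul_norm_sq_le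
    (g := fun q => Real.exp (-ψ q) ^ 2) (fun q => by positivity) hint h5] with q hq
  exact hq (by positivity)

/-- A causal homogeneous weak solution vanishes, without any bound at infinity. With
`s = t + δ √(1 + |z|² + x²)`, the set `{t ≥ 0, s ≤ T}` is compact. In the weighted estimate with
`ψ = γ s` the gradient of the cutoff matters only where `s ≥ T`, so that `γ → ∞` gives `w = 0` where
`s ≤ T`. -/
theorem IsWeakSolutionOn.eq_zero_of_causal {a : Fin d → E →L[ℂ] E} {D : E →L[ℂ] E}
    {C : ℝ} (hC : 0 ≤ C) {β : E →L[ℂ] E'}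
    (ha : ∀ j x y, inner ℂ (a j x) y = inner ℂ x (a j y))
    (hD : ∀ x y, inner ℂ (D x) y = inner ℂ x (D y))
    (hest : ∀ γ, 0 < γ → HalfLineEstimate a D (a 0) (β ∘L D) C γ)
    {w : SpaceTime d → E} (h : IsWeakSolutionOn a D (a 0) 0 β 0 w)
    (hw : MemL2loc w (volume.restrict (halfSpace d)))
    (hcausal : ∀ᵐ q ∂(volume.restrict (halfSpace d)), q.1 0 < 0 → w q = 0) :
    ∀ᵐ q ∂(volume.restrict (halfSpace d)), w q = 0 := by
  set ν := (volume : Measure (SpaceTime d)).restrict (halfSpace d)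
  set m := ∑ j, ‖a j‖ + ‖D‖
  have hm : 0 ≤ m := by positivity
  -- The factor `2` bounds the gradient of `properWeight`.
  obtain ⟨δ, hδ0, hδ⟩ : ∃ δ > 0, 4 * C * (m * (δ * 2)) ^ 2 ≤ 1 := by
    have hlim : Tendsto (fun δ : ℝ => 4 * C * (m * (δ * 2)) ^ 2) (𝓝[>] 0)
        (𝓝 (4 * C * (m * (0 * 2)) ^ 2)) :=
      (Continuous.tendsto (by fun_prop) 0).mono_left nhdsWithin_le_nhds
    have h1 : (4 * C * (m * (0 * 2)) ^ 2 : ℝ) < 1 := by norm_num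
    obtain ⟨δ, h2, h3⟩ := ((hlim.eventually_le_const h1).and self_mem_nhdsWithin).exists
    exact ⟨δ, h3, h2⟩
  set s : SpaceTime d → ℝ := fun q => q.1 0 + δ * properWeight q with hs
  have htc : ContDiff ℝ ∞ fun q : SpaceTime d => q.1 0 := (timeForm d).contDiff
  have hsc : ContDiff ℝ ∞ s := htc.add (contDiff_const.mul contDiff_properWeight)
  have hsd : ∀ q, fderiv ℝ s q = timeForm d + δ • fderiv ℝ properWeight q := by
    intro q
    have h1 := ((timeForm d).hasFDerivAt (x := q)).add
      (((contDiff_properWeight.differentiable (by simp)) q).hasFDerivAt.const_mul δ)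
    exact h1.fderiv
  have hT : ∀ T : ℕ, ∀ᵐ q ∂ν, s q ≤ T → w q = 0 := by
    intro T
    set χ : SpaceTime d → ℝ :=
      fun q => Real.smoothTransition (T + 1 - s q) * Real.smoothTransition (q.1 0 + 2) with hχ
    have hχt : IsTestFunction χ := by
      refine ⟨(Real.smoothTransition.contDiff.comp (contDiff_const.sub hsc)).mul
        (Real.smoothTransition.contDiff.comp (htc.add contDiff_const)), ?_⟩
      refine HasCompactSupport.intro
        (isCompact_closedBall (0 : SpaceTime d) ((T + 3) / δ)) fun q hq => ?_
      rw [mem_closedBall_zero_iff, not_le, div_lt_iff₀ hδ0] at hq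
      by_contra hne
      rw [hχ] at hne
      have h1 : 0 < T + 1 - s q := by
        by_contra hcon
        exact hne (by simp only [Real.smoothTransition.zero_of_nonpos (not_lt.1 hcon), zero_mul])
      have h2 : 0 < q.1 0 + 2 := by
        by_contra hcon
        exact hne (by simp only [Real.smoothTransition.zero_of_nonpos (not_lt.1 hcon), mul_zero])
      have h3 := mul_le_mul_of_nonneg_left (norm_le_properWeight q) hδ0.le
      simp only [hs] at h1
      linarith
    -- The cutoff in `t` acts in `-2 < t < -1` only, where `w` vanishes.
    have hχ1 : ∀ q, -1 < q.1 0 → s q < T → χ q = 1 := by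
      intro q h1 h2
      simp only [hχ]
      rw [Real.smoothTransition.one_of_one_le (by linarith),
        Real.smoothTransition.one_of_one_le (by linarith), one_mul]
    have hdχ : ∀ q, 0 ≤ q.1 0 → s q < T → fderiv ℝ χ q = 0 := by
      intro q h1 h2
      have h3 : χ =ᶠ[𝓝 q] fun _ => 1 := by
        filter_upwards [(isOpen_lt continuous_const htc.continuous).mem_nhds
          (show (-1 : ℝ) < q.1 0 by linarith),
          (isOpen_lt hsc.continuous continuous_const).mem_nhds h2] with q' h4 h5
        exact hχ1 q' h4 h5
      rw [h3.fderiv_eq]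
      simp
    have hcχ := hχt.continuous
    have hcs := hsc.continuous
    have hcd : Continuous (fderiv ℝ χ) := hχt.1.continuous_fderiv (by simp)
    set g : SpaceTime d → ℝ := {q | s q ≤ T}.indicator fun q => χ q ^ 2 with hg
    have hmeas : MeasurableSet {q | s q ≤ T} := measurableSet_le hcs.measurable measurable_const
    have i0 := hw.integrable_mul_norm_sq (g := fun q => χ q ^ 2) (by fun_prop)
      (HasCompactSupport.intro hχt.2 fun q hq => by
        simp [image_eq_zero_of_notMem_tsupport hq])
    have i1 : Integrable (fun q => g q * ‖w q‖ ^ 2) ν := by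
      refine (i0.indicator hmeas).congr (Eventually.of_forall fun q => ?_)
      by_cases hq : q ∈ {q | s q ≤ T}
      · simp only [hg, Set.indicator_of_mem hq]
      · simp only [hg, Set.indicator_of_notMem hq, zero_mul]
    have i2 := hw.integrable_mul_norm_sq (g := fun q => ‖fderiv ℝ χ q‖ ^ 2) (by fun_prop)
      (HasCompactSupport.intro (hχt.2.fderiv ℝ) fun q hq => by
        simp [image_eq_zero_of_notMem_tsupport hq])
    set I := ∫ q, g q * ‖w q‖ ^ 2 ∂ν
    set J := ∫ q, ‖fderiv ℝ χ q‖ ^ 2 * ‖w q‖ ^ 2 ∂ν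
    have hkey : ∀ γ : ℝ, 0 < γ → γ ^ 2 * I ≤ 4 * C * m ^ 2 * J := by
      intro γ hγ
      have h1 := h.weighted_estimate hγ hC ha hD (ha 0) (hest γ hγ) hw hχt
        (ψ := fun q => γ * s q) (contDiff_const.mul hsc) (fun q => norm_principalPart_sub_le a D
          (δ := δ * 2) ?_) hδ
      · have e1 : Real.exp (-(γ * T)) ^ 2 * I ≤
            ∫ q, (χ q * Real.exp (-(γ * s q))) ^ 2 * ‖w q‖ ^ 2 ∂ν := by
          rw [← integral_const_mul]
          refine integral_mono (i1.const_mul _) (hw.integrable_mul_norm_sq (by fun_prop)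
            (HasCompactSupport.intro hχt.2 fun q hq => by
              simp [image_eq_zero_of_notMem_tsupport hq])) fun q => ?_
          by_cases hq : q ∈ {q | s q ≤ T}
          · simp only [hg, Set.indicator_of_mem hq]
            have h3 : Real.exp (-(γ * T)) ≤ Real.exp (-(γ * s q)) :=
              Real.exp_le_exp.2 (neg_le_neg (mul_le_mul_of_nonneg_left hq hγ.le))
            rw [← mul_assoc, mul_pow (χ q), mul_comm (χ q ^ 2)]
            gcongr
          · simp only [hg, Set.indicator_of_notMem hq, zero_mul, mul_zero]
            positivity
        have e2 : ∫ q, (Real.exp (-(γ * s q)) * ‖fderiv ℝ χ q‖) ^ 2 * ‖w q‖ ^ 2 ∂ν ≤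
            Real.exp (-(γ * T)) ^ 2 * J := by
          rw [← integral_const_mul]
          refine integral_mono_ae (hw.integrable_mul_norm_sq (by fun_prop)
            (HasCompactSupport.intro (hχt.2.fderiv ℝ) fun q hq => by
              simp [image_eq_zero_of_notMem_tsupport hq])) (i2.const_mul _) ?_
          filter_upwards [hcausal] with q hq
          rcases lt_or_ge (q.1 0) 0 with h3 | h3
          · simp [hq h3]
          · rcases lt_or_ge (s q) T with h4 | h4
            · simp [hdχ q h3 h4]
            · have h5 : Real.exp (-(γ * s q)) ≤ Real.exp (-(γ * T)) :=
                Real.exp_le_exp.2 (neg_le_neg (mul_le_mul_of_nonneg_left h4 hγ.le))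
              rw [← mul_assoc, mul_pow]
              gcongr
        have h6 : 0 < Real.exp (-(γ * T)) ^ 2 := by positivity
        have h7 : Real.exp (-(γ * T)) ^ 2 * (γ ^ 2 * I) ≤
            Real.exp (-(γ * T)) ^ 2 * (4 * C * m ^ 2 * J) := by
          calc _ = γ ^ 2 * (Real.exp (-(γ * T)) ^ 2 * I) := by ring
            _ ≤ γ ^ 2 * ∫ q, (χ q * Real.exp (-(γ * s q))) ^ 2 * ‖w q‖ ^ 2 ∂ν := by gcongr
            _ ≤ _ := h1
            _ ≤ 4 * C * m ^ 2 * (Real.exp (-(γ * T)) ^ 2 * J) := by gcongr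
            _ = _ := by ring
        exact le_of_mul_le_mul_left h7 h6
      · have h3 := (((hsc.differentiable (by simp)) q).hasFDerivAt.const_mul γ).fderiv
        rw [h3, hsd, smul_add, add_sub_cancel_left, norm_smul, norm_smul,
          Real.norm_of_nonneg hγ.le, Real.norm_of_nonneg hδ0.le, mul_comm]
        gcongr
        exact norm_fderiv_properWeight_le q
    have hI : I ≤ 0 := by
      by_contra hI
      rw [not_le] at hI
      have hlim : Tendsto (fun γ : ℝ => γ ^ 2 * I) atTop atTop :=
        (tendsto_pow_atTop two_ne_zero).atTop_mul_const hI
      obtain ⟨γ, h1, h2⟩ := ((hlim.eventually_gt_atTop (4 * C * m ^ 2 * J)).and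
        (eventually_gt_atTop 0)).exists
      exact absurd (hkey γ h2) (not_le.2 h1)
    have h9 := ae_eq_zero_of_integral_mul_norm_sq_le (w := w) (g := g)
      (fun q => Set.indicator_nonneg (fun q _ => sq_nonneg _) q) i1 hI
    filter_upwards [h9, hcausal] with q h1 h2 h3
    rcases lt_or_ge (q.1 0) 0 with h4 | h4
    · exact h2 h4
    · refine h1 ?_
      rw [hg, Set.indicator_of_mem (show q ∈ {q | s q ≤ T} from h3), hχ]
      simp only
      rw [Real.smoothTransition.one_of_one_le (by linarith),
        Real.smoothTransition.one_of_one_le (by linarith)]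
      norm_num
  filter_upwards [ae_all_iff.2 hT] with q hq
  obtain ⟨T, hT⟩ := exists_nat_ge (s q)
  exact hq T hT

end Uniqueness

/-! ### Existence for a fixed weight -/

/-- A functional that is bounded by a pair of maps into Hilbert spaces is represented by a pair of
vectors: the functional factors through the range of `(J₁, J₂)` in `H₁ × H₂`, to which the theorems
of Hahn–Banach and Riesz apply. -/
theorem exists_inner_eq_of_le {V H₁ H₂ : Type*} [AddCommGroup V] [Module ℂ V]
    [NormedAddCommGroup H₁] [InnerProductSpace ℂ H₁] [CompleteSpace H₁]
    [NormedAddCommGroup H₂] [InnerProductSpace ℂ H₂] [CompleteSpace H₂]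
    (J₁ : V →ₗ[ℂ] H₁) (J₂ : V →ₗ[ℂ] H₂) (l : V →ₗ[ℂ] ℂ) {M : ℝ} (hM : 0 ≤ M)
    (h : ∀ v, ‖l v‖ ^ 2 ≤ M ^ 2 * (‖J₁ v‖ ^ 2 + ‖J₂ v‖ ^ 2)) :
    ∃ (U₁ : H₁) (U₂ : H₂), ‖U₁‖ ^ 2 + ‖U₂‖ ^ 2 ≤ M ^ 2 ∧
      ∀ v, l v = inner ℂ U₁ (J₁ v) + inner ℂ U₂ (J₂ v) := by
  set J : V →ₗ[ℂ] WithLp 2 (H₁ × H₂) :=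
    (WithLp.linearEquiv 2 ℂ (H₁ × H₂)).symm.toLinearMap ∘ₗ J₁.prod J₂ with hJ
  have hJn : ∀ v, ‖J v‖ ^ 2 = ‖J₁ v‖ ^ 2 + ‖J₂ v‖ ^ 2 := fun v =>
    WithLp.prod_norm_sq_eq_of_L2 (J v)
  have hl : ∀ v, ‖l v‖ ≤ M * ‖J v‖ := fun v => by
    refine abs_le_of_sq_le_sq' (a := ‖l v‖) ?_ (by positivity) |>.2
    rw [mul_pow, hJn]
    exact h v
  have hker : LinearMap.ker J ≤ LinearMap.ker l := fun v hv => by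
    rw [LinearMap.mem_ker] at hv ⊢
    have := hl v
    rw [hv, norm_zero, mul_zero] at this
    exact norm_le_zero_iff.1 this
  set l₀ : LinearMap.range J →ₗ[ℂ] ℂ :=
    (Submodule.liftQ _ l hker) ∘ₗ J.quotKerEquivRange.symm.toLinearMap with hl₀
  have hl₀v : ∀ v, l₀ ⟨J v, v, rfl⟩ = l v := by
    intro v
    have : J.quotKerEquivRange.symm ⟨J v, v, rfl⟩ = Submodule.Quotient.mk v := by
      rw [LinearEquiv.symm_apply_eq]
      rfl
    rw [hl₀]
    simp [this]
  obtain ⟨g, hg, hgn⟩ := exists_extension_norm_eq (LinearMap.range J)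
    (l₀.mkContinuous M (by
      rintro ⟨_, v, rfl⟩
      rw [hl₀v]
      exact hl v))
  have hgM : ‖g‖ ≤ M := hgn.trans_le (LinearMap.mkContinuous_norm_le _ hM _)
  set U := (InnerProductSpace.toDual ℂ (WithLp 2 (H₁ × H₂))).symm g with hU
  have hUn : ‖U‖ ≤ M := by rwa [hU, LinearIsometryEquiv.norm_map]
  refine ⟨U.fst, U.snd, ?_, fun v => ?_⟩
  · rw [← WithLp.prod_norm_sq_eq_of_L2]
    exact pow_le_pow_left₀ (norm_nonneg _) hUn 2
  · have h1 : inner ℂ U (J v) = g (J v) := InnerProductSpace.toDual_symm_apply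
    have h2 := hg ⟨J v, v, rfl⟩
    rw [LinearMap.mkContinuous_apply, hl₀v] at h2
    rw [← h2, ← h1, WithLp.prod_inner_apply]
    rfl

/-- A linear map into square integrable functions, as a map into `L²`. -/
def linearMapToLp {V X E : Type*} [AddCommGroup V] [Module ℂ V] [MeasurableSpace X]
    [NormedAddCommGroup E] [NormedSpace ℂ E] {μ : Measure X} (L : V →ₗ[ℂ] X → E)
    (h : ∀ v, MemLp (L v) 2 μ) : V →ₗ[ℂ] Lp E 2 μ where
  toFun v := (h v).toLp (L v)
  map_add' v w := by
    rw [← MemLp.toLp_add]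
    congr 1
    exact map_add L v w
  map_smul' c v := by
    rw [RingHom.id_apply, ← MemLp.toLp_const_smul]
    congr 1
    exact map_smul L c v

theorem norm_toLp_sq {X E : Type*} [MeasurableSpace X] [NormedAddCommGroup E] {μ : Measure X}
    {f : X → E} (hf : MemLp f 2 μ) : ‖hf.toLp f‖ ^ 2 = ∫ x, ‖f x‖ ^ 2 ∂μ := by
  rw [Lp.norm_toLp, integral_norm_sq_eq hf]

theorem inner_toLp {X E : Type*} [MeasurableSpace X] [NormedAddCommGroup E]
    [InnerProductSpace ℂ E] {μ : Measure X} {f g : X → E} (hf : MemLp f 2 μ) (hg : MemLp g 2 μ) :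
    inner ℂ (hf.toLp f) (hg.toLp g) = ∫ x, inner ℂ (f x) (g x) ∂μ := by
  rw [L2.inner_def]
  refine integral_congr_ae ?_
  filter_upwards [hf.coeFn_toLp, hg.coeFn_toLp] with x h1 h2
  rw [h1, h2]

theorem integrable_inner_of_memLp {X E : Type*} [MeasurableSpace X] [NormedAddCommGroup E]
    [InnerProductSpace ℂ E] {μ : Measure X} {f g : X → E} (hf : MemLp f 2 μ) (hg : MemLp g 2 μ) :
    Integrable (fun x => inner ℂ (f x) (g x)) μ := by
  refine (L2.integrable_inner (𝕜 := ℂ) (hf.toLp f) (hg.toLp g)).congr ?_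
  filter_upwards [hf.coeFn_toLp, hg.coeFn_toLp] with x h1 h2
  rw [h1, h2]

section Existence

variable {E : Type*} [NormedAddCommGroup E] [InnerProductSpace ℂ E] {d : ℕ}

variable (E d) in
/-- The space of test functions, with values in `E`. -/
def testFunctions : Submodule ℂ (SpaceTime d → E) where
  carrier := {φ | IsTestFunction φ}
  add_mem' h h' := h.add h'
  zero_mem' := IsTestFunction.zero
  smul_mem' c _ h := h.clm_comp ((c • ContinuousLinearMap.id ℂ E).restrictScalars ℝ)

/-- The operator `diffOp` on test functions, as a linear map. -/
def testDiffOp (a : Fin d → E →L[ℂ] E) (D S : E →L[ℂ] E) (γ : ℝ) :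
    testFunctions E d →ₗ[ℂ] SpaceTime d → E where
  toFun φ := diffOp a D S γ φ.1
  map_add' φ χ := by
    funext q
    have h : fderiv ℝ (φ.1 + χ.1) q = fderiv ℝ φ.1 q + fderiv ℝ χ.1 q :=
      fderiv_add (φ.2.differentiable q) (χ.2.differentiable q)
    simp only [diffOp, Submodule.coe_add, h, Pi.add_apply, add_apply, map_add, smul_add,
      Finset.sum_add_distrib]
    abel
  map_smul' c φ := by
    funext q
    have h : ∀ v, fderiv ℝ (c • φ.1) q v = c • fderiv ℝ φ.1 q v := fun v => by
      rw [fderiv_const_smul (φ.2.differentiable q)]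
      rfl
    simp only [diffOp, SetLike.val_smul, h, Pi.smul_apply, map_smul, smul_add, Finset.smul_sum,
      RingHom.id_apply]
    rw [smul_comm c]

/-- The boundary values `L φ(z, 0)` of test functions, as a linear map. -/
def testTrace (L : E →L[ℂ] E) : testFunctions E d →ₗ[ℂ] Tangential d → E where
  toFun φ z := L (φ.1 (z, 0))
  map_add' φ χ := by funext z; simp
  map_smul' c φ := by funext z; simp

theorem memLp_testTrace (L : E →L[ℂ] E) (φ : testFunctions E d) :
    MemLp (testTrace L φ) 2 volume :=
  (IsTestFunction.slice (φ.2.clm_comp (L.restrictScalars ℝ)) 0).memLp 2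

/-- Existence by duality. The estimate for the formal adjoint with boundary operator the projection
onto `Z` gives, for the source `F` and boundary value `b`, a function `u` whose trace is `D b - k`,
with `k` in `Z`. For `Z = D (ker B)` this means that `u` satisfies `B u = B b`. -/
theorem HalfLineEstimate.exists_solution [FiniteDimensional ℂ E] {a : Fin d → E →L[ℂ] E}
    {D S : E →L[ℂ] E} {Z : Submodule ℂ E} {C γ : ℝ} (hC : 0 ≤ C) (hγ : 0 < γ)
    (hD : ∀ x y, inner ℂ (D x) y = inner ℂ x (D y))
    (hest : HalfLineEstimate (fun j => -a j) (-D) S Z.starProjection C γ)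
    {F : SpaceTime d → E} {b : Tangential d → E}
    (hF : MemLp F 2 (volume.restrict (halfSpace d))) (hb : MemLp b 2 volume) :
    ∃ (u : SpaceTime d → E) (k : Tangential d → E), MemLp u 2 (volume.restrict (halfSpace d)) ∧
      MemLp k 2 volume ∧ (∀ z, k z ∈ Z) ∧
      (∀ φ : SpaceTime d → E, IsTestFunction φ → ∫ q in halfSpace d, inner ℂ (φ q) (F q) =
        (∫ q in halfSpace d, inner ℂ (diffOp (fun j => -a j) (-D) S γ φ q) (u q)) -
          ∫ z, inner ℂ (φ (z, 0)) (D (b z) - k z)) ∧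
      γ * (∫ q in halfSpace d, ‖u q‖ ^ 2) + ∫ z, ‖k z‖ ^ 2 ≤
        C * (γ⁻¹ * (∫ q in halfSpace d, ‖F q‖ ^ 2) + ∫ z, ‖b z‖ ^ 2) := by
  have : CompleteSpace E := FiniteDimensional.complete ℂ E
  set ν := (volume : Measure (SpaceTime d)).restrict (halfSpace d) with hν
  set Q := Z.starProjection
  have hLm : ∀ φ : testFunctions E d, MemLp (testDiffOp (fun j => -a j) (-D) S γ φ) 2 ν :=
    fun φ => (IsTestFunction.diffOp φ.2 (fun j => -a j) (-D) S γ).memLp 2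
  have hIm : ∀ φ : testFunctions E d, MemLp ((testFunctions E d).subtype φ) 2 ν :=
    fun φ => IsTestFunction.memLp φ.2 2
  set I := linearMapToLp (testFunctions E d).subtype hIm with hI
  set L := linearMapToLp (testDiffOp (fun j => -a j) (-D) S γ) hLm with hL
  set P := linearMapToLp (testTrace (d := d) Q) (memLp_testTrace Q) with hP
  set T := linearMapToLp (testTrace (d := d) D) (memLp_testTrace D) with hT
  set F' := hF.toLp F
  set b' := hb.toLp b
  have hγs : √γ ^ 2 = γ := Real.sq_sqrt hγ.le
  have hγs0 : 0 < √γ := Real.sqrt_pos.2 hγ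
  have hen : ∀ φ, γ * ‖I φ‖ ^ 2 + ‖T φ‖ ^ 2 ≤ C * (γ⁻¹ * ‖L φ‖ ^ 2 + ‖P φ‖ ^ 2) := by
    intro φ
    have h1 := hest.energy_estimate (v := φ.1) φ.2
    have e1 : ‖I φ‖ ^ 2 = ∫ q in halfSpace d, ‖φ.1 q‖ ^ 2 := norm_toLp_sq (hIm φ)
    have e2 : ‖L φ‖ ^ 2 = ∫ q in halfSpace d, ‖diffOp (fun j => -a j) (-D) S γ φ.1 q‖ ^ 2 :=
      norm_toLp_sq (hLm φ)
    have e3 : ‖P φ‖ ^ 2 = ∫ z, ‖Q (φ.1 (z, 0))‖ ^ 2 := norm_toLp_sq (memLp_testTrace Q φ)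
    have e4 : ‖T φ‖ ^ 2 = ∫ z, ‖(-D) (φ.1 (z, 0))‖ ^ 2 := by
      refine (norm_toLp_sq (memLp_testTrace D φ)).trans ?_
      simp only [neg_apply, norm_neg]
      rfl
    rwa [e1, e2, e3, e4]
  set M := √(C * (γ⁻¹ * ‖F'‖ ^ 2 + ‖b'‖ ^ 2)) with hM
  have hM2 : M ^ 2 = C * (γ⁻¹ * ‖F'‖ ^ 2 + ‖b'‖ ^ 2) := Real.sq_sqrt (by positivity)
  -- Scaling the operator by `γ ^ (-1/2)` makes the right hand side of the a priori estimate a norm.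
  obtain ⟨U, k, hUk, hrep⟩ := exists_inner_eq_of_le ((((√γ)⁻¹ : ℝ) : ℂ) • L) P
    ((innerSL ℂ F').toLinearMap ∘ₗ I + (innerSL ℂ b').toLinearMap ∘ₗ T) (M := M)
    (Real.sqrt_nonneg _) (fun φ => by
      have e1 : ‖((innerSL ℂ F').toLinearMap ∘ₗ I + (innerSL ℂ b').toLinearMap ∘ₗ T) φ‖ ≤
          ‖F'‖ * ‖I φ‖ + ‖b'‖ * ‖T φ‖ :=
        (norm_add_le _ _).trans (add_le_add (norm_inner_le_norm (𝕜 := ℂ) F' (I φ))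
          (norm_inner_le_norm (𝕜 := ℂ) b' (T φ)))
      have e2 : (‖F'‖ * ‖I φ‖ + ‖b'‖ * ‖T φ‖) ^ 2 ≤
          (γ⁻¹ * ‖F'‖ ^ 2 + ‖b'‖ ^ 2) * (γ * ‖I φ‖ ^ 2 + ‖T φ‖ ^ 2) := by
        have h1 : 0 ≤ ((√γ)⁻¹ * ‖F'‖ * ‖T φ‖ - √γ * ‖b'‖ * ‖I φ‖) ^ 2 := sq_nonneg _
        have h2 : (√γ)⁻¹ ^ 2 = γ⁻¹ := by rw [inv_pow, hγs]
        have h3 : (√γ)⁻¹ * √γ = 1 := inv_mul_cancel₀ hγs0.ne'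
        have h4 : γ⁻¹ * γ = 1 := inv_mul_cancel₀ hγ.ne'
        have h5 : ((√γ)⁻¹ * ‖F'‖ * ‖T φ‖ - √γ * ‖b'‖ * ‖I φ‖) ^ 2 =
            γ⁻¹ * ‖F'‖ ^ 2 * ‖T φ‖ ^ 2 + γ * ‖b'‖ ^ 2 * ‖I φ‖ ^ 2 -
              2 * (‖F'‖ * ‖T φ‖ * ‖b'‖ * ‖I φ‖) := by
          linear_combination (‖F'‖ ^ 2 * ‖T φ‖ ^ 2) * h2 + (‖b'‖ ^ 2 * ‖I φ‖ ^ 2) * hγs -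
            2 * (‖F'‖ * ‖T φ‖ * ‖b'‖ * ‖I φ‖) * h3
        rw [h5] at h1
        have h6 : (γ⁻¹ * ‖F'‖ ^ 2 + ‖b'‖ ^ 2) * (γ * ‖I φ‖ ^ 2 + ‖T φ‖ ^ 2) =
            ‖F'‖ ^ 2 * ‖I φ‖ ^ 2 + ‖b'‖ ^ 2 * ‖T φ‖ ^ 2 + (γ⁻¹ * ‖F'‖ ^ 2 * ‖T φ‖ ^ 2 +
              γ * ‖b'‖ ^ 2 * ‖I φ‖ ^ 2) := by
          linear_combination (‖F'‖ ^ 2 * ‖I φ‖ ^ 2) * h4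
        rw [h6]
        linarith
      have e3 : ‖((((√γ)⁻¹ : ℝ) : ℂ) • L) φ‖ ^ 2 = γ⁻¹ * ‖L φ‖ ^ 2 := by
        rw [LinearMap.smul_apply, norm_smul, Complex.norm_real, mul_pow, Real.norm_eq_abs, sq_abs,
          inv_pow, hγs]
      rw [e3, hM2]
      calc _ ≤ (‖F'‖ * ‖I φ‖ + ‖b'‖ * ‖T φ‖) ^ 2 := pow_le_pow_left₀ (norm_nonneg _) e1 2
        _ ≤ (γ⁻¹ * ‖F'‖ ^ 2 + ‖b'‖ ^ 2) * (γ * ‖I φ‖ ^ 2 + ‖T φ‖ ^ 2) := e2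
        _ ≤ (γ⁻¹ * ‖F'‖ ^ 2 + ‖b'‖ ^ 2) * (C * (γ⁻¹ * ‖L φ‖ ^ 2 + ‖P φ‖ ^ 2)) := by
            gcongr
            exact hen φ
        _ = _ := by ring)
  rw [hM2] at hUk
  have hUm : MemLp (fun q => (((√γ)⁻¹ : ℝ) : ℂ) • U q) 2 ν := (Lp.memLp U).const_smul _
  have hkm : MemLp (fun z => Q (k z)) 2 volume := Q.comp_memLp' (Lp.memLp k)
  have hDb : MemLp (fun z => D (b z)) 2 volume := D.comp_memLp' hb
  refine ⟨fun q => (((√γ)⁻¹ : ℝ) : ℂ) • U q, fun z => Q (k z), hUm, hkm,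
    fun z => Z.starProjection_apply_mem _, ?_, ?_⟩
  · intro φ hφ
    have h1 := congrArg (starRingEnd ℂ) (hrep ⟨φ, hφ⟩)
    have h2 : ((innerSL ℂ F').toLinearMap ∘ₗ I + (innerSL ℂ b').toLinearMap ∘ₗ T) ⟨φ, hφ⟩ =
        inner ℂ F' (I ⟨φ, hφ⟩) + inner ℂ b' (T ⟨φ, hφ⟩) := rfl
    rw [h2, map_add, map_add, inner_conj_symm, inner_conj_symm, inner_conj_symm, inner_conj_symm,
      LinearMap.smul_apply, inner_smul_left, Complex.conj_ofReal] at h1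
    have e1 : inner ℂ (I ⟨φ, hφ⟩) F' = ∫ q in halfSpace d, inner ℂ (φ q) (F q) :=
      inner_toLp (hIm ⟨φ, hφ⟩) hF
    have e2 : inner ℂ (T ⟨φ, hφ⟩) b' = ∫ z, inner ℂ (φ (z, 0)) (D (b z)) := by
      refine (inner_toLp (memLp_testTrace D ⟨φ, hφ⟩) hb).trans ?_
      exact integral_congr_ae (Eventually.of_forall fun z => hD _ _)
    have e3 : inner ℂ (L ⟨φ, hφ⟩) U = ∫ q in halfSpace d,
        inner ℂ (diffOp (fun j => -a j) (-D) S γ φ q) (U q) := by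
      have h3 := inner_toLp (hLm ⟨φ, hφ⟩) (Lp.memLp U)
      rw [Lp.toLp_coeFn] at h3
      exact h3
    have e4 : inner ℂ (P ⟨φ, hφ⟩) k = ∫ z, inner ℂ (φ (z, 0)) (Q (k z)) := by
      have h3 := inner_toLp (memLp_testTrace Q ⟨φ, hφ⟩) (Lp.memLp k)
      rw [Lp.toLp_coeFn] at h3
      refine h3.trans ?_
      exact integral_congr_ae (Eventually.of_forall fun z =>
        Z.inner_starProjection_left_eq_right _ _)
    have hφ0 : MemLp (fun z => φ (z, 0)) 2 volume := (hφ.slice 0).memLp 2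
    have e5 : ∫ z, inner ℂ (φ (z, 0)) (D (b z) - Q (k z)) =
        (∫ z, inner ℂ (φ (z, 0)) (D (b z))) - ∫ z, inner ℂ (φ (z, 0)) (Q (k z)) := by
      simp only [inner_sub_right]
      exact integral_sub (integrable_inner_of_memLp hφ0 hDb) (integrable_inner_of_memLp hφ0 hkm)
    simp only [inner_smul_right]
    rw [e5, integral_const_mul, ← e1, ← e2, ← e3, ← e4]
    linear_combination h1
  · have e1 : ∫ q, ‖(((√γ)⁻¹ : ℝ) : ℂ) • U q‖ ^ 2 ∂ν = γ⁻¹ * ‖U‖ ^ 2 := by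
      have h1 := norm_toLp_sq (Lp.memLp U)
      rw [Lp.toLp_coeFn] at h1
      rw [h1, ← integral_const_mul]
      refine integral_congr_ae (Eventually.of_forall fun q => ?_)
      simp only
      rw [norm_smul, Complex.norm_real, mul_pow, Real.norm_eq_abs, sq_abs, inv_pow, hγs]
    have e2 : ∫ z, ‖Q (k z)‖ ^ 2 ≤ ‖k‖ ^ 2 := by
      have h1 := norm_toLp_sq (Lp.memLp k)
      rw [Lp.toLp_coeFn] at h1
      rw [h1]
      exact integral_mono (hkm.integrable_norm_pow two_ne_zero)
        ((Lp.memLp k).integrable_norm_pow two_ne_zero) fun z =>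
        pow_le_pow_left₀ (norm_nonneg _) (Z.norm_starProjection_apply_le _) 2
    rw [e1, ← mul_assoc, mul_inv_cancel₀ hγ.ne', one_mul, ← norm_toLp_sq hF, ← norm_toLp_sq hb]
    exact (add_le_add_right e2 _).trans hUk

end Existence

/-! ### Exponential weights -/

section Weights

theorem lintegral_enorm_sq {α F : Type*} [MeasurableSpace α] [NormedAddCommGroup F]
    {ν : Measure α} {f : α → F} (hf : MemLp f 2 ν) :
    ∫⁻ x, ‖f x‖ₑ ^ 2 ∂ν = ENNReal.ofReal (∫ x, ‖f x‖ ^ 2 ∂ν) := by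
  rw [integral_norm_sq_eq hf, ← eLpNorm_two_sq, ← ENNReal.toReal_pow, ENNReal.ofReal_toReal]
  exact ENNReal.pow_ne_top hf.2.ne

theorem exp_mul_enorm_sq {F : Type*} [NormedAddCommGroup F] [NormedSpace ℝ F] (γ t : ℝ) (v : F) :
    ENNReal.ofReal (Real.exp (-2 * γ * t)) * ‖v‖ₑ ^ 2 = ‖Real.exp (-(γ * t)) • v‖ₑ ^ 2 := by
  rw [enorm_smul, mul_pow, Real.enorm_of_nonneg (Real.exp_pos _).le,
    ← ENNReal.ofReal_pow (Real.exp_pos _).le, ← Real.exp_nat_mul]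
  congr 3
  push_cast
  ring_nf

theorem memL2loc_smul {X F : Type*} [TopologicalSpace X] [MeasurableSpace X]
    [OpensMeasurableSpace X] [T2Space X] [SecondCountableTopology X] [NormedAddCommGroup F]
    [NormedSpace ℝ F] {μ : Measure X} {v : X → F} (hv : MemLp v 2 μ) {ρ : X → ℝ}
    (hρ : Continuous ρ) : MemL2loc (fun x => ρ x • v x) μ := by
  intro K hK
  obtain ⟨M, hM⟩ := hK.exists_bound_of_continuousOn hρ.continuousOn
  refine (hv.restrict K).of_le_mul (c := M)
    (hρ.aestronglyMeasurable.smul hv.1.restrict) ?_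
  filter_upwards [ae_restrict_mem hK.measurableSet] with x hx
  rw [norm_smul]
  gcongr
  exact hM x hx

/-- Multiplication by the decaying weight keeps causal `L²` functions in `L²`. -/
theorem memLp_exp_smul {X F : Type*} [TopologicalSpace X] [MeasurableSpace X]
    [OpensMeasurableSpace X] [SecondCountableTopology X] [NormedAddCommGroup F]
    [NormedSpace ℝ F] {μ : Measure X} {v : X → F} (hv : MemLp v 2 μ) {t : X → ℝ}
    (ht : Continuous t) (h0 : ∀ᵐ x ∂μ, t x < 0 → v x = 0) {γ : ℝ} (hγ : 0 ≤ γ) :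
    MemLp (fun x => Real.exp (-(γ * t x)) • v x) 2 μ ∧
      ∀ᵐ x ∂μ, ‖Real.exp (-(γ * t x)) • v x‖ ≤ ‖v x‖ := by
  have h1 : ∀ᵐ x ∂μ, ‖Real.exp (-(γ * t x)) • v x‖ ≤ ‖v x‖ := by
    filter_upwards [h0] with x hx
    rcases lt_or_ge (t x) 0 with h | h
    · simp [hx h]
    · rw [norm_smul, Real.norm_of_nonneg (Real.exp_pos _).le]
      refine mul_le_of_le_one_left (norm_nonneg _) (Real.exp_le_one_iff.2 ?_)
      have := mul_nonneg hγ h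
      linarith
  exact ⟨hv.of_le ((Continuous.aestronglyMeasurable (by fun_prop)).smul hv.1) h1, h1⟩

theorem interiorEnergy_eq {d m : ℕ} [NeZero d] {γ : ℝ} {v : SpaceTime d → CVec m}
    (hv : MemLp (fun q => Real.exp (-(γ * q.1 0)) • v q) 2 (volume.restrict (halfSpace d))) :
    interiorEnergy γ v =
      ENNReal.ofReal (∫ q in halfSpace d, ‖Real.exp (-(γ * q.1 0)) • v q‖ ^ 2) := by
  rw [interiorEnergy, ← lintegral_enorm_sq hv]
  simp only [exp_mul_enorm_sq]

theorem boundaryEnergy_eq {d m : ℕ} [NeZero d] {γ : ℝ} {v : Tangential d → CVec m}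
    (hv : MemLp (fun z => Real.exp (-(γ * z 0)) • v z) 2 volume) :
    boundaryEnergy γ v = ENNReal.ofReal (∫ z, ‖Real.exp (-(γ * z 0)) • v z‖ ^ 2) := by
  rw [boundaryEnergy, ← lintegral_enorm_sq hv]
  simp only [exp_mul_enorm_sq]

variable {E : Type*} [NormedAddCommGroup E] [InnerProductSpace ℂ E] {d : ℕ} [NeZero d]

/-- The weight `e^{γt}` intertwines the formal adjoint with and without `γ`. -/
theorem diffOp_exp_smul (a : Fin d → E →L[ℂ] E) (D : E →L[ℂ] E) (γ : ℝ) {φ : SpaceTime d → E}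
    (hφ : IsTestFunction φ) :
    IsTestFunction (fun q : SpaceTime d => Real.exp (γ * q.1 0) • φ q) ∧
      ∀ q : SpaceTime d, diffOp (fun j => -a j) (-D) (a 0) γ
        (fun q => Real.exp (γ * q.1 0) • φ q) q =
          Real.exp (γ * q.1 0) • diffOp (fun j => -a j) (-D) (a 0) 0 φ q := by
  have h1 : ContDiff ℝ ∞ fun q : SpaceTime d => γ * q.1 0 :=
    contDiff_const.mul (timeForm d).contDiff
  have hexp : ContDiff ℝ ∞ fun q : SpaceTime d => Real.exp (γ * q.1 0) :=
    Real.contDiff_exp.comp h1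
  refine ⟨IsTestFunction.smul hexp hφ, fun q => ?_⟩
  have h2 : fderiv ℝ (fun q : SpaceTime d => Real.exp (γ * q.1 0)) q =
      (Real.exp (γ * q.1 0) * γ) • timeForm d := by
    have h3 : HasFDerivAt (fun q : SpaceTime d => γ * q.1 0) (γ • timeForm d) q :=
      ((timeForm d).hasFDerivAt (x := q)).const_mul γ
    rw [h3.exp.fderiv, smul_smul]
  have h4 : diffOp (fun j => -a j) (-D) (a 0) γ φ q =
      diffOp (fun j => -a j) (-D) (a 0) 0 φ q + (γ : ℂ) • a 0 (φ q) := by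
    simp [diffOp]
  rw [diffOp_smul (hexp.differentiable (by simp)) hφ.differentiable, h2, h4, principalPart_smul,
    principalPart_timeForm, ← Complex.coe_smul]
  simp only [smul_add, smul_apply, neg_apply, smul_neg, Complex.ofReal_mul, mul_smul]
  abel

/-- A smooth weight that lies above both `γ t` and `γ' t`, with gradient close to `γ dt` when `γ'`
is close to `γ`: a smooth version of `max (γ t) (γ' t)`. -/
theorem exists_interpolating_weight {γ γ' : ℝ} (hγ : γ ≤ γ') :
    ∃ ψ : SpaceTime d → ℝ, ContDiff ℝ ∞ ψ ∧ (∀ q, γ * q.1 0 ≤ ψ q) ∧ (∀ q, γ' * q.1 0 ≤ ψ q) ∧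
      ∀ q, ‖fderiv ℝ ψ q - γ • timeForm d‖ ≤ γ' - γ := by
  set r : ℝ → ℝ := fun t => √(1 + t ^ 2) with hr
  have hrc : ContDiff ℝ ∞ r :=
    (contDiff_const.add (contDiff_id.pow 2)).sqrt fun t => by
      have := sq_nonneg t
      simp only [id]
      positivity
  have hr1 : ∀ t, |t| ≤ r t := fun t => Real.le_sqrt_of_sq_le (by rw [sq_abs]; linarith)
  have hr0 : ∀ t, 0 < r t := fun t => Real.sqrt_pos.2 (by positivity)
  have hrd : ∀ t, HasDerivAt r (t / r t) t := by
    intro t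
    have h1 : HasDerivAt (fun t : ℝ => 1 + t ^ 2) (2 * t) t := by
      simpa using (hasDerivAt_pow 2 t).const_add 1
    have h2 := h1.sqrt (by positivity)
    convert h2 using 1
    rw [mul_div_mul_left _ _ two_ne_zero]
  have hn : ‖timeForm d‖ ≤ 1 := ContinuousLinearMap.opNorm_le_bound _ zero_le_one fun q => by
    rw [one_mul, timeForm_apply]
    exact (PiLp.norm_apply_le q.1 0).trans (norm_fst_le q)
  set c := (γ' - γ) / 2 with hc
  have hc0 : 0 ≤ c := by rw [hc]; linarith
  refine ⟨fun q => (γ + c) * timeForm d q + c * r (timeForm d q), ?_, fun q => ?_, fun q => ?_,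
    fun q => ?_⟩
  · exact (contDiff_const.mul (timeForm d).contDiff).add
      (contDiff_const.mul (hrc.comp (timeForm d).contDiff))
  · have h1 := (neg_le_abs _).trans (hr1 (timeForm d q))
    have h2 := mul_le_mul_of_nonneg_left h1 hc0
    rw [← timeForm_apply]
    linarith
  · have h1 := (le_abs_self _).trans (hr1 (timeForm d q))
    have h2 := mul_le_mul_of_nonneg_left h1 hc0
    have h3 : γ' = γ + 2 * c := by rw [hc]; ring
    rw [← timeForm_apply, h3]
    linarith
  · have h1 := (timeForm d).hasFDerivAt (x := q)
    have h2 := ((h1.const_mul (γ + c)).add (((hrd (timeForm d q)).comp_hasFDerivAt q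
      h1).const_mul c)).fderiv
    rw [show fderiv ℝ (fun q => (γ + c) * timeForm d q + c * r (timeForm d q)) q = _ from h2]
    have h3 : (γ + c) • timeForm d + c • (timeForm d q / r (timeForm d q)) • timeForm d -
        γ • timeForm d = (c * (1 + timeForm d q / r (timeForm d q))) • timeForm d := by
      rw [smul_smul, ← add_smul, ← sub_smul]
      congr 1
      ring
    rw [h3, norm_smul, Real.norm_eq_abs, abs_mul, abs_of_nonneg hc0]
    have h4 : |timeForm d q / r (timeForm d q)| ≤ 1 := by
      rw [abs_div, abs_of_pos (hr0 _)]
      exact div_le_one_of_le₀ (hr1 _) (hr0 _).le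
    have h5 : |1 + timeForm d q / r (timeForm d q)| ≤ 2 := by
      refine (abs_add_le _ _).trans ?_
      rw [abs_one]
      linarith
    calc _ ≤ c * 2 * 1 := by gcongr
      _ = γ' - γ := by rw [hc]; ring

end Weights

/-! ### Well-posedness -/

section WellPosedness

variable {d N p : ℕ} {A : Fin (d + 1) → Matrix (Fin N) (Fin N) ℂ} {B : Matrix (Fin p) (Fin N) ℂ}

theorem adjointOp_eq (hA : SymmetricHyperbolic A) (S : CVec N →L[ℂ] CVec N)
    (φ : SpaceTime d → CVec N) (q : SpaceTime d) :
    adjointOp A φ q = diffOp (fun j : Fin d => -coef (A j.castSucc)) (-coef (A (Fin.last d)))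
      S 0 φ q := by
  simp only [adjointOp, diffOp, (hA.isHermitian _).eq, neg_apply, Finset.sum_neg_distrib,
    Complex.ofReal_zero, zero_smul, add_zero, coef_apply, neg_add]

/-- Since `ker D ≤ ker B`, the boundary operator factors through `D`. -/
theorem exists_factor_of_ker_le
    (hB : LinearMap.ker (act (A (Fin.last d))) ≤ LinearMap.ker (act B)) :
    ∃ β : CVec N →L[ℂ] CVec p, β ∘L coef (A (Fin.last d)) = coef B := by
  obtain ⟨R, hR⟩ := exists_pseudoInverse (coef (A (Fin.last d)))
  refine ⟨coef B ∘L R, ContinuousLinearMap.ext fun x => ?_⟩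
  have h1 : R (coef (A (Fin.last d)) x) - x ∈ LinearMap.ker (act (A (Fin.last d))) := by
    rw [LinearMap.mem_ker, map_sub, sub_eq_zero]
    exact hR x
  have h2 := hB h1
  rw [LinearMap.mem_ker, map_sub, sub_eq_zero] at h2
  exact h2

/-- The difference of two weak solutions with the same data is a homogeneous weak solution. -/
theorem isWeakSolutionOn_sub (hA : SymmetricHyperbolic A) {β : CVec N →L[ℂ] CVec p}
    (hβ : β ∘L coef (A (Fin.last d)) = coef B) {f u v : SpaceTime d → CVec N}
    {g : Tangential d → CVec p} (hu : MemL2loc u (volume.restrict (halfSpace d)))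
    (hv : MemL2loc v (volume.restrict (halfSpace d))) (hu' : IsWeakSolution A B f g u)
    (hv' : IsWeakSolution A B f g v) (S : CVec N →L[ℂ] CVec N) :
    IsWeakSolutionOn (fun j : Fin d => coef (A j.castSucc)) (coef (A (Fin.last d))) S 0 β 0
      (fun q => u q - v q) := by
  intro φ b hφ hb hφb
  have hbc : ∀ z, act (A (Fin.last d)).conjTranspose (φ (z, 0)) = act B.conjTranspose (b z) := by
    intro z
    refine ext_inner_right ℂ fun y => ?_
    rw [(hA.isHermitian _).eq, ← coef_apply, ← coef_apply, hφb, inner_coef_conjTranspose, ← hβ]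
    rfl
  have h1 := hu' φ b hφ hb hbc
  have h2 := hv' φ b hφ hb hbc
  simp only [adjointOp_eq hA S] at h1 h2
  have hL := hφ.diffOp (fun j : Fin d => -coef (A j.castSucc)) (-coef (A (Fin.last d))) S 0
  simp only [inner_sub_right, Pi.zero_apply, inner_zero_right, integral_zero]
  rw [integral_sub (hu.integrable_inner hL.continuous hL.2)
    (hv.integrable_inner hL.continuous hL.2)]
  linear_combination h1 - h2

theorem ae_eq_of_isBoundaryTrace {f u : SpaceTime d → CVec N} {h h' : Tangential d → CVec N}
    (hh : IsBoundaryTrace A f u h) (hh' : IsBoundaryTrace A f u h') : h =ᵐ[volume] h' := by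
  have hl := (hh.1.sub hh'.1).locallyIntegrable
  have key : ∀ᵐ z, h z - h' z = 0 := by
    refine ae_eq_zero_of_integral_contDiff_smul_eq_zero hl fun g hg hgc => ?_
    let η : ContDiffBump (0 : ℝ) := ⟨1, 2, one_pos, one_lt_two⟩
    refine ext_inner_left ℂ fun b => ?_
    have hφ : IsTestFunction fun q : SpaceTime d => (g q.1 * η q.2) • b := by
      refine ⟨((hg.comp contDiff_fst).mul (η.contDiff.comp contDiff_snd)).smul contDiff_const,
        HasCompactSupport.intro (hgc.prod η.hasCompactSupport) ?_⟩
      rintro ⟨z, x⟩ hq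
      rw [Set.mem_prod, not_and_or] at hq
      rcases hq with h | h <;> have := image_eq_zero_of_notMem_tsupport h <;>
        simp only at this <;> simp [this]
    have h1 := hh.2 _ hφ
    have h2 := hh'.2 _ hφ
    have hg' : IsTestFunction fun z : Tangential d => g z • b :=
      ⟨hg.smul contDiff_const, hgc.smul_right⟩
    have h0 : η 0 = 1 := η.one_of_mem_closedBall (by simp [η])
    simp only [h0, mul_one] at h1 h2
    have h3 := hl.integrable_smul_left_of_hasCompactSupport hg.continuous hgc
    rw [inner_zero_right, ← integral_inner h3]
    have h4 : ∀ z, inner ℂ b (g z • (h z - h' z)) =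
        inner ℂ (g z • b) (h z) - inner ℂ (g z • b) (h' z) := fun z => by
      rw [← inner_sub_right]
      simp only [← Complex.coe_smul, inner_smul_left, inner_smul_right, Complex.conj_ofReal]
    simp only [h4]
    rw [integral_sub (hh.1.integrable_inner hg'.continuous hg'.2)
      (hh'.1.integrable_inner hg'.continuous hg'.2)]
    linear_combination h1 - h2
  filter_upwards [key] with z hz using sub_eq_zero.1 hz

theorem coef_surjective (hA : SymmetricHyperbolic A)
    (hp : ∃ σ γ, (σ, γ) ∈ upperSphere d ∧ Module.finrank ℂ (stableSubspace A σ γ) = p)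
    (hB : KreissSakamoto A B 0) :
    ∃ R : CVec p →L[ℂ] CVec N, ∀ y, coef B (R y) = y := by
  obtain ⟨g, hg⟩ := LinearMap.exists_rightInverse_of_surjective
    (coef B : CVec N →ₗ[ℂ] CVec p) (LinearMap.range_eq_top.2 fun y => by
      obtain ⟨v, -, hv⟩ := exists_mem_stableSubspace hA hp hB 0 one_pos y
      exact ⟨v, hv⟩)
  exact ⟨LinearMap.toContinuousLinearMap g, fun y => LinearMap.congr_fun hg y⟩

variable [NeZero d]

/-- For each `γ > 0`, weighted data have a weighted solution, with trace and energy bound. It may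
depend on `γ`. Causality plays no role. -/
theorem exists_weighted_solution (hA : SymmetricHyperbolic A)
    (hp : ∃ σ γ, (σ, γ) ∈ upperSphere d ∧ Module.finrank ℂ (stableSubspace A σ γ) = p)
    (hB : KreissSakamoto A B 0) :
    ∃ C, 0 < C ∧ ∀ γ : ℝ, 0 < γ → ∀ (f : SpaceTime d → CVec N) (g : Tangential d → CVec p),
      MemLp (fun q => Real.exp (-(γ * q.1 0)) • f q) 2 (volume.restrict (halfSpace d)) →
      MemLp (fun z => Real.exp (-(γ * z 0)) • g z) 2 volume →
      ∃ (u : SpaceTime d → CVec N) (h : Tangential d → CVec N),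
        MemL2loc u (volume.restrict (halfSpace d)) ∧
        MemLp (fun q => Real.exp (-(γ * q.1 0)) • u q) 2 (volume.restrict (halfSpace d)) ∧
        IsBoundaryTrace A f u h ∧ IsWeakSolution A B f g u ∧
        ENNReal.ofReal γ * interiorEnergy γ u + boundaryEnergy γ h ≤ ENNReal.ofReal C *
          (ENNReal.ofReal (1 / γ) * interiorEnergy γ f + boundaryEnergy γ g) := by
  obtain ⟨C, hC, hest⟩ := exists_halfLineEstimate_adjoint hA hp hB
  obtain ⟨R, hR⟩ := coef_surjective hA hp hB
  set D := coef (A (Fin.last d)) with hDdef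
  have hD : ∀ x y, inner ℂ (D x) y = inner ℂ x (D y) := inner_coef_left (hA.isHermitian _)
  set c := ‖R‖ ^ 2 with hc
  -- The boundary value `b = R g` has `B b = g`, and the trace is `D b - k`. The factors `2` stem
  -- from `|D b - k|² ≤ 2 |D b|² + 2 |k|²`.
  refine ⟨2 * C * (1 + c) + 2 * ‖D‖ ^ 2 * c, by positivity, fun γ hγ f g hf hg => ?_⟩
  have hb : MemLp (fun z => R (Real.exp (-(γ * z 0)) • g z)) 2 volume := R.comp_memLp' hg
  obtain ⟨u, k, hu, hk, hkZ, hid, hen⟩ := (hest γ hγ).exists_solution hC.le hγ hD hf hb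
  set b : Tangential d → CVec N := fun z => R (Real.exp (-(γ * z 0)) • g z) with hbdef
  have hexp : ∀ t : ℝ, Real.exp (-(γ * t)) * Real.exp (γ * t) = 1 := fun t => by
    rw [← Real.exp_add]; simp
  have hDb : MemLp (fun z => D (b z)) 2 volume := D.comp_memLp' hb
  have hDbk : MemLp (fun z => D (b z) - k z) 2 volume := hDb.sub hk
  have htr : IsBoundaryTrace A f (fun q => Real.exp (γ * q.1 0) • u q)
      (fun z => Real.exp (γ * z 0) • (D (b z) - k z)) := by
    refine ⟨memL2loc_smul hDbk (by fun_prop), fun φ hφ => ?_⟩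
    obtain ⟨h1, h2⟩ := diffOp_exp_smul (fun j : Fin d => coef (A j.castSucc)) D γ hφ
    simp only [Fin.castSucc_zero] at h2
    have h3 := hid _ h1
    have hsw : ∀ (t : ℝ) (x y : CVec N), inner ℂ (Real.exp (γ * t) • x) y =
        inner ℂ x (Real.exp (γ * t) • y) := fun t x y => by
      simp only [← Complex.coe_smul, inner_smul_left, inner_smul_right, Complex.conj_ofReal]
    simp only [h2, hsw, smul_smul, mul_comm (Real.exp (γ * _)), hexp, one_smul] at h3
    rw [h3]
    simp only [adjointOp_eq hA (coef (A 0)), ← hDdef]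
    rfl
  refine ⟨fun q => Real.exp (γ * q.1 0) • u q, fun z => Real.exp (γ * z 0) • (D (b z) - k z),
    memL2loc_smul hu (by fun_prop), ?_, htr, ?_, ?_⟩
  · simpa only [smul_smul, hexp, one_smul] using hu
  · intro φ ψ hφ hψ hφψ
    rw [htr.2 φ hφ]
    congr 1
    refine integral_congr_ae (Eventually.of_forall fun z => ?_)
    obtain ⟨k', hk', hk'z⟩ := hkZ z
    have h1 : coef B k' = 0 := hk'
    have h2 : D k' = k z := hk'z
    have h3 := hφψ z
    rw [(hA.isHermitian _).eq, ← coef_apply, ← coef_apply, ← hDdef] at h3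
    simp only
    rw [← h2, ← map_sub, ← Complex.coe_smul, inner_smul_right, ← hD, h3,
      inner_coef_conjTranspose, map_sub, h1, sub_zero, hbdef]
    simp only
    rw [hR, ← Complex.coe_smul, inner_smul_right, ← mul_assoc, ← Complex.ofReal_mul, mul_comm
      (Real.exp _), hexp, Complex.ofReal_one, one_mul]
  · have hU : MemLp (fun q : SpaceTime d => Real.exp (-(γ * q.1 0)) •
        Real.exp (γ * q.1 0) • u q) 2 (volume.restrict (halfSpace d)) := by
      simpa only [smul_smul, hexp, one_smul] using hu
    have hH : MemLp (fun z : Tangential d => Real.exp (-(γ * z 0)) •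
        Real.exp (γ * z 0) • (D (b z) - k z)) 2 volume := by
      simpa only [smul_smul, hexp, one_smul] using hDbk
    rw [interiorEnergy_eq hU, boundaryEnergy_eq hH, interiorEnergy_eq hf, boundaryEnergy_eq hg]
    simp only [smul_smul, hexp, one_smul]
    have hF0 : 0 ≤ ∫ q in halfSpace d, ‖Real.exp (-(γ * q.1 0)) • f q‖ ^ 2 :=
      integral_nonneg fun q => by positivity
    have hG0 : 0 ≤ ∫ z, ‖Real.exp (-(γ * z 0)) • g z‖ ^ 2 :=
      integral_nonneg fun q => by positivity
    have hU0 : 0 ≤ ∫ q in halfSpace d, ‖u q‖ ^ 2 := integral_nonneg fun q => by positivity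
    have hH0 : 0 ≤ ∫ z, ‖D (b z) - k z‖ ^ 2 := integral_nonneg fun q => by positivity
    have hb2 : ∫ z, ‖b z‖ ^ 2 ≤ c * ∫ z, ‖Real.exp (-(γ * z 0)) • g z‖ ^ 2 := by
      rw [← integral_const_mul]
      refine integral_mono (hb.integrable_norm_pow two_ne_zero)
        ((hg.integrable_norm_pow two_ne_zero).const_mul _) fun z => ?_
      simp only
      rw [hc, ← mul_pow]
      exact pow_le_pow_left₀ (norm_nonneg _) (R.le_opNorm _) 2
    have hH2 : ∫ z, ‖D (b z) - k z‖ ^ 2 ≤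
        2 * ‖D‖ ^ 2 * (∫ z, ‖b z‖ ^ 2) + 2 * ∫ z, ‖k z‖ ^ 2 := by
      rw [← integral_const_mul, ← integral_const_mul, ← integral_add
        ((hb.integrable_norm_pow two_ne_zero).const_mul _)
        ((hk.integrable_norm_pow two_ne_zero).const_mul _)]
      refine integral_mono (hDbk.integrable_norm_pow two_ne_zero)
        (((hb.integrable_norm_pow two_ne_zero).const_mul _).add
        ((hk.integrable_norm_pow two_ne_zero).const_mul _)) fun z => ?_
      simp only
      have h1 : ‖D (b z) - k z‖ ≤ ‖D‖ * ‖b z‖ + ‖k z‖ :=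
        (norm_sub_le _ _).trans (by gcongr; exact D.le_opNorm _)
      refine (pow_le_pow_left₀ (norm_nonneg _) h1 2).trans (add_sq_le.trans_eq ?_)
      ring
    rw [← ENNReal.ofReal_mul hγ.le, ← ENNReal.ofReal_add (by positivity) hH0,
      ← ENNReal.ofReal_mul (by positivity), ← ENNReal.ofReal_add (by positivity) hG0,
      ← ENNReal.ofReal_mul (by positivity)]
    refine ENNReal.ofReal_le_ofReal ?_
    rw [one_div]
    set X := ∫ q in halfSpace d, ‖Real.exp (-(γ * q.1 0)) • f q‖ ^ 2
    set Y := ∫ z, ‖Real.exp (-(γ * z 0)) • g z‖ ^ 2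
    have hγX : 0 ≤ γ⁻¹ * X := by positivity
    have hc0 : 0 ≤ c := by positivity
    have hk0 : 0 ≤ ∫ z, ‖k z‖ ^ 2 := integral_nonneg fun q => by positivity
    have h1 : γ * (∫ q in halfSpace d, ‖u q‖ ^ 2) + ∫ z, ‖k z‖ ^ 2 ≤ C * (γ⁻¹ * X + c * Y) :=
      hen.trans (by gcongr)
    have h2 : 2 * ‖D‖ ^ 2 * (∫ z, ‖b z‖ ^ 2) ≤ 2 * ‖D‖ ^ 2 * (c * Y) := by gcongr
    have h3 : γ⁻¹ * X + c * Y ≤ (1 + c) * (γ⁻¹ * X + Y) := by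
      nlinarith [mul_nonneg hc0 hγX]
    have h4 : C * (γ⁻¹ * X + c * Y) ≤ C * ((1 + c) * (γ⁻¹ * X + Y)) := by gcongr
    have h5 : 2 * ‖D‖ ^ 2 * (c * Y) ≤ 2 * ‖D‖ ^ 2 * c * (γ⁻¹ * X + Y) := by
      rw [mul_assoc _ c]
      gcongr
      linarith
    have h6 : 0 ≤ γ * ∫ q in halfSpace d, ‖u q‖ ^ 2 := by positivity
    calc _ ≤ 2 * (γ * (∫ q in halfSpace d, ‖u q‖ ^ 2) + ∫ z, ‖k z‖ ^ 2) +
          2 * ‖D‖ ^ 2 * (c * Y) := by linarith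
      _ ≤ 2 * (C * ((1 + c) * (γ⁻¹ * X + Y))) + 2 * ‖D‖ ^ 2 * c * (γ⁻¹ * X + Y) := by linarith
      _ = _ := by ring

end WellPosedness

/-! ### Independence of the weight, and causality -/

section Causality

variable {d N p : ℕ} [NeZero d] {A : Fin (d + 1) → Matrix (Fin N) (Fin N) ℂ}
  {B : Matrix (Fin p) (Fin N) ℂ}

/-- `u` is a weak solution that is square integrable with weight `e^{-γt}`. It is not required to
vanish for `t < 0`. -/
def IsWeightedSolution (A : Fin (d + 1) → Matrix (Fin N) (Fin N) ℂ)
    (B : Matrix (Fin p) (Fin N) ℂ) (f : SpaceTime d → CVec N) (g : Tangential d → CVec p)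
    (γ : ℝ) (u : SpaceTime d → CVec N) : Prop :=
  MemL2loc u (volume.restrict (halfSpace d)) ∧ IsWeakSolution A B f g u ∧
    MemLp (fun q => Real.exp (-(γ * q.1 0)) • u q) 2 (volume.restrict (halfSpace d))

/-- Weighted solutions with the same data coincide if the quotient of the weights is close to
one. -/
theorem exists_ae_eq_of_weights_close (hA : SymmetricHyperbolic A) (hB : KreissSakamoto A B 0) :
    ∃ δ > 0, ∀ (f : SpaceTime d → CVec N) (g : Tangential d → CVec p) (γ γ' : ℝ)
      (u v : SpaceTime d → CVec N), 0 < γ → γ ≤ γ' → γ' ≤ (1 + δ) * γ →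
      IsWeightedSolution A B f g γ u → IsWeightedSolution A B f g γ' v →
      u =ᵐ[volume.restrict (halfSpace d)] v := by
  obtain ⟨C, hC, hest⟩ := exists_halfLineEstimate hA hB
  obtain ⟨β, hβ⟩ := exists_factor_of_ker_le hB.1
  set a : Fin d → CVec N →L[ℂ] CVec N := fun j => coef (A j.castSucc) with ha
  set D := coef (A (Fin.last d)) with hD
  set m := ∑ j, ‖a j‖ + ‖D‖
  obtain ⟨δ, hδ0, hδ⟩ : ∃ δ > 0, 4 * C * (m * δ) ^ 2 ≤ 1 := by
    have hlim : Tendsto (fun δ : ℝ => 4 * C * (m * δ) ^ 2) (𝓝[>] 0)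
        (𝓝 (4 * C * (m * 0) ^ 2)) :=
      (Continuous.tendsto (by fun_prop) 0).mono_left nhdsWithin_le_nhds
    have h1 : (4 * C * (m * 0) ^ 2 : ℝ) < 1 := by norm_num
    obtain ⟨δ, h2, h3⟩ := ((hlim.eventually_le_const h1).and self_mem_nhdsWithin).exists
    exact ⟨δ, h3, h2⟩
  refine ⟨δ, hδ0, fun f g γ γ' u v hγ hle hle' hu hv => ?_⟩
  obtain ⟨ψ, hψ, hψ1, hψ2, hψd⟩ := exists_interpolating_weight (d := d) hle
  have hψc := hψ.continuous
  have hw := isWeakSolutionOn_sub hA hβ hu.1 hv.1 hu.2.1 hv.2.1 (a 0)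
  have hmem : ∀ {γ : ℝ} {u : SpaceTime d → CVec N}, (∀ q, γ * q.1 0 ≤ ψ q) →
      MemL2loc u (volume.restrict (halfSpace d)) →
      MemLp (fun q => Real.exp (-(γ * q.1 0)) • u q) 2 (volume.restrict (halfSpace d)) →
      MemLp (fun q => Real.exp (-ψ q) • u q) 2 (volume.restrict (halfSpace d)) := by
    intro γ u h1 h2 h3
    have hc : Continuous fun q => Real.exp (-ψ q) := by fun_prop
    refine h3.of_le (hc.aestronglyMeasurable.smul h2.aestronglyMeasurable)
      (Eventually.of_forall fun q => ?_)
    rw [norm_smul, norm_smul, Real.norm_of_nonneg (Real.exp_pos _).le,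
      Real.norm_of_nonneg (Real.exp_pos _).le]
    have := h1 q
    gcongr
  have hint := ((hmem hψ1 hu.1 hu.2.2).sub (hmem hψ2 hv.1 hv.2.2)).integrable_norm_pow two_ne_zero
  have key := hw.eq_zero_of_integrable hγ hC.le (fun j => inner_coef_left (hA.isHermitian _))
    (inner_coef_left (hA.isHermitian _)) (by rw [hβ, Fin.castSucc_zero]; exact hest γ hγ)
    (hu.1.sub hv.1) hψ (fun q => (hψd q).trans (by linarith)) hδ
    (hint.congr (Eventually.of_forall fun q => by
      simp only [Pi.sub_apply, ← smul_sub]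
      rw [norm_smul, Real.norm_of_nonneg (Real.exp_pos _).le, mul_pow]))
  filter_upwards [key] with q hq using sub_eq_zero.1 hq

/-- Weighted solutions for arbitrary weights `γ ≥ γ₀` coincide if solutions exist for all weights in
between: the weights are connected by steps by the factor `1 + δ`. -/
theorem ae_eq_of_isWeightedSolution (hA : SymmetricHyperbolic A)
    (hB : KreissSakamoto A B 0) {f : SpaceTime d → CVec N} {g : Tangential d → CVec p} {γ₀ : ℝ}
    (hγ₀ : 0 < γ₀) (hex : ∀ γ, γ₀ ≤ γ → ∃ u, IsWeightedSolution A B f g γ u) {γ : ℝ}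
    (hγ : γ₀ ≤ γ) {u v : SpaceTime d → CVec N} (hu : IsWeightedSolution A B f g γ₀ u)
    (hv : IsWeightedSolution A B f g γ v) : u =ᵐ[volume.restrict (halfSpace d)] v := by
  obtain ⟨δ, hδ, hclose⟩ := exists_ae_eq_of_weights_close (p := p) hA hB
  have hchain : ∀ (n : ℕ) (γ : ℝ) (v : SpaceTime d → CVec N), γ₀ ≤ γ → γ ≤ (1 + δ) ^ n * γ₀ →
      IsWeightedSolution A B f g γ v → u =ᵐ[volume.restrict (halfSpace d)] v := by
    intro n
    induction n with
    | zero =>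
      intro γ v h1 h2 h3
      refine hclose f g γ₀ γ u v hγ₀ h1 ?_ hu h3
      rw [pow_zero, one_mul] at h2
      nlinarith [mul_pos hδ hγ₀]
    | succ n ih =>
      intro γ v h1 h2 h3
      have hδ1 : 0 < 1 + δ := by linarith
      obtain ⟨u', hu'⟩ := hex (max γ₀ (γ / (1 + δ))) (le_max_left _ _)
      have h4 : γ / (1 + δ) ≤ (1 + δ) ^ n * γ₀ := by
        rw [div_le_iff₀ hδ1]
        calc γ ≤ _ := h2
          _ = _ := by ring
      have h5 : γ₀ ≤ (1 + δ) ^ n * γ₀ :=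
        le_mul_of_one_le_left hγ₀.le (one_le_pow₀ (by linarith))
      refine (ih _ u' (le_max_left _ _) (max_le h5 h4) hu').trans
        (hclose f g _ γ u' v (lt_max_of_lt_left hγ₀) (max_le h1 ?_) ?_ hu' h3)
      · exact div_le_self (hγ₀.le.trans h1) (by linarith)
      · rw [← div_le_iff₀' hδ1]
        exact le_max_right _ _
  obtain ⟨n, hn⟩ := pow_unbounded_of_one_lt (γ / γ₀) (show 1 < 1 + δ by linarith)
  exact hchain n γ v hγ ((div_le_iff₀ hγ₀).1 hn.le) hv

theorem ae_eq_of_isCausalSolution (hA : SymmetricHyperbolic A) (hB : KreissSakamoto A B 0)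
    {f : SpaceTime d → CVec N} {g : Tangential d → CVec p} {u v : SpaceTime d → CVec N}
    (hu : IsCausalSolution A B f g u) (hv : IsCausalSolution A B f g v) :
    u =ᵐ[volume.restrict (halfSpace d)] v := by
  obtain ⟨C, hC, hest⟩ := exists_halfLineEstimate hA hB
  obtain ⟨β, hβ⟩ := exists_factor_of_ker_le hB.1
  set a : Fin d → CVec N →L[ℂ] CVec N := fun j => coef (A j.castSucc) with ha
  have hw := isWeakSolutionOn_sub hA hβ hu.1 hv.1 hu.2.2 hv.2.2 (a 0)
  have key := hw.eq_zero_of_causal hC.le (fun j => inner_coef_left (hA.isHermitian _))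
    (inner_coef_left (hA.isHermitian _))
    (fun γ hγ => by rw [hβ, Fin.castSucc_zero]; exact hest γ hγ)
    (hu.1.sub hv.1) (by
      filter_upwards [hu.2.1, hv.2.1] with q h1 h2 h3
      rw [h1 h3, h2 h3, sub_zero])
  filter_upwards [key] with q hq using sub_eq_zero.1 hq

/-- A function with `γ ∫ e^{-2γt} |u|²` bounded as `γ → ∞` vanishes for `t < 0`, where the weight is
at least one. -/
theorem interiorVanishes_of_energy_le {u : SpaceTime d → CVec N} {K : ENNReal} (hK : K ≠ ⊤)
    (hu : MemL2loc u (volume.restrict (halfSpace d)))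
    (h : ∀ γ : ℝ, 1 ≤ γ → ENNReal.ofReal γ * interiorEnergy γ u ≤ K) : InteriorVanishes u := by
  set ν := (volume : Measure (SpaceTime d)).restrict (halfSpace d)
  have hmeas : MeasurableSet {q : SpaceTime d | q.1 0 < 0} :=
    measurableSet_lt (timeForm d).continuous.measurable measurable_const
  set X := ∫⁻ q in {q : SpaceTime d | q.1 0 < 0}, ‖u q‖ₑ ^ 2 ∂ν with hX
  have h1 : ∀ γ : ℝ, 1 ≤ γ → ENNReal.ofReal γ * X ≤ K := by
    intro γ hγ
    refine le_trans (mul_le_mul_right ?_ _) (h γ hγ)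
    rw [hX, interiorEnergy]
    refine (setLIntegral_mono' hmeas fun q hq => ?_).trans (setLIntegral_le_lintegral
      {q : SpaceTime d | q.1 0 < 0} _)
    refine le_mul_of_one_le_left zero_le ?_
    rw [← ENNReal.ofReal_one]
    refine ENNReal.ofReal_le_ofReal (Real.one_le_exp ?_)
    have : q.1 0 < 0 := hq
    nlinarith
  have hX0 : X = 0 := by
    by_contra hne
    have hXtop : X ≠ ⊤ := by
      have := h1 1 le_rfl
      rw [ENNReal.ofReal_one, one_mul] at this
      exact ne_top_of_le_ne_top hK this
    have hx : 0 < X.toReal := ENNReal.toReal_pos hne hXtop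
    have h2 := h1 (K.toReal / X.toReal + 1) (by
      have : 0 ≤ K.toReal / X.toReal := by positivity
      linarith)
    have h3 := ENNReal.toReal_mono hK h2
    rw [ENNReal.toReal_mul, ENNReal.toReal_ofReal (by positivity), add_mul,
      div_mul_cancel₀ _ hx.ne'] at h3
    linarith
  rw [hX, lintegral_eq_zero_iff' ((hu.aestronglyMeasurable.restrict.enorm).pow_const 2)] at hX0
  rw [InteriorVanishes]
  filter_upwards [(ae_restrict_iff' hmeas).1 hX0] with q h2 h3
  simpa using h2 h3

theorem stronglyWellPosed (hA : SymmetricHyperbolic A)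
    (hp : ∃ σ γ, (σ, γ) ∈ upperSphere d ∧ Module.finrank ℂ (stableSubspace A σ γ) = p)
    (hB : KreissSakamoto A B 0) : StronglyWellPosed A B := by
  obtain ⟨C, hC, hex⟩ := exists_weighted_solution hA hp hB
  refine ⟨C, 1, hC, one_pos, fun f g hf hg hf0 hg0 => ?_⟩
  have hfγ := fun (γ : ℝ) (hγ : 1 ≤ γ) => memLp_exp_smul hf
    (t := fun q : SpaceTime d => q.1 0) (timeForm d).continuous hf0 (zero_le_one.trans hγ)
  have hgγ := fun (γ : ℝ) (hγ : 1 ≤ γ) => memLp_exp_smul hg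
    (t := fun z : Tangential d => z 0) (by fun_prop) hg0 (zero_le_one.trans hγ)
  have hex' := fun (γ : ℝ) (hγ : 1 ≤ γ) =>
    hex γ (one_pos.trans_le hγ) f g (hfγ γ hγ).1 (hgγ γ hγ).1
  obtain ⟨u, h, hu, huL, hh, huw, -⟩ := hex' 1 le_rfl
  -- the solutions for different weights coincide, so one solution has all energy bounds
  have hen : ∀ γ : ℝ, 1 ≤ γ → ENNReal.ofReal γ * interiorEnergy γ u + boundaryEnergy γ h ≤
      ENNReal.ofReal C * (ENNReal.ofReal (1 / γ) * interiorEnergy γ f + boundaryEnergy γ g) := by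
    intro γ hγ
    obtain ⟨u', h', hu', huL', hh', huw', hen'⟩ := hex' γ hγ
    have huu : u =ᵐ[volume.restrict (halfSpace d)] u' :=
      ae_eq_of_isWeightedSolution hA hB one_pos (fun γ hγ => by
        obtain ⟨v, _, h1, h2, _, h4, _⟩ := hex' γ hγ
        exact ⟨v, h1, h4, h2⟩) hγ ⟨hu, huw, huL⟩ ⟨hu', huw', huL'⟩
    have hhu : IsBoundaryTrace A f u h' := by
      refine ⟨hh'.1, fun φ hφ => (hh'.2 φ hφ).trans ?_⟩
      congr 1
      refine integral_congr_ae ?_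
      filter_upwards [huu] with q hq
      rw [hq]
    have hhh := ae_eq_of_isBoundaryTrace hh hhu
    have e1 : interiorEnergy γ u = interiorEnergy γ u' := lintegral_congr_ae (by
      filter_upwards [huu] with q hq
      rw [hq])
    have e2 : boundaryEnergy γ h = boundaryEnergy γ h' := lintegral_congr_ae (by
      filter_upwards [hhh] with q hq
      rw [hq])
    rw [e1, e2]
    exact hen'
  have hcausal : IsCausalSolution A B f g u := by
    refine ⟨hu, interiorVanishes_of_energy_le (K := ENNReal.ofReal C *
      (eLpNorm f 2 (volume.restrict (halfSpace d)) ^ 2 + eLpNorm g 2 volume ^ 2)) ?_ hu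
      fun γ hγ => ?_, huw⟩
    · exact ENNReal.mul_ne_top ENNReal.ofReal_ne_top (ENNReal.add_ne_top.2
        ⟨ENNReal.pow_ne_top hf.2.ne, ENNReal.pow_ne_top hg.2.ne⟩)
    · refine le_self_add.trans ((hen γ hγ).trans (mul_le_mul_right (add_le_add ?_ ?_) _))
      · refine (mul_le_of_le_one_left zero_le ?_).trans ?_
        · rw [← ENNReal.ofReal_one]
          exact ENNReal.ofReal_le_ofReal (div_le_one_of_le₀ hγ (by linarith))
        · rw [interiorEnergy, eLpNorm_two_sq]
          refine lintegral_mono_ae ?_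
          filter_upwards [(hfγ γ hγ).2] with q hq
          rw [exp_mul_enorm_sq]
          gcongr
          exact enorm_le_iff_norm_le.2 hq
      · rw [boundaryEnergy, eLpNorm_two_sq]
        refine lintegral_mono_ae ?_
        filter_upwards [(hgγ γ hγ).2] with q hq
        rw [exp_mul_enorm_sq]
        gcongr
        exact enorm_le_iff_norm_le.2 hq
  exact ⟨u, hcausal, fun w hw => ae_eq_of_isCausalSolution hA hB hw hcausal, h, hh, hen⟩

end Causality

end

end HyperbolicBVP

theorem corollary2 (d N p : ℕ) [NeZero d]
    (A : Fin (d + 1) → Matrix (Fin N) (Fin N) ℂ)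
    (B : Matrix (Fin p) (Fin N) ℂ)
    (hA : HyperbolicBVP.SymmetricHyperbolic A)
    (hp : ∃ σ γ, (σ, γ) ∈ HyperbolicBVP.upperSphere d ∧
      Module.finrank ℂ (HyperbolicBVP.stableSubspace A σ γ) = p)
    (hB : HyperbolicBVP.KreissSakamoto A B 0) :
    HyperbolicBVP.StronglyWellPosed A B :=
  HyperbolicBVP.stronglyWellPosed hA hp hB
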